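/- Let $p$ be an odd prime, $F$ a totally real number field, $F'/F$ a Galois extension of degree $p$ with $F'$ totally real and unramified outside $p$, $K$ a totally imaginary quadratic extension of $F$, and $K'=F'K$. Write $\rho$ for the nontrivial automorphism of $K/F$ (and of $K'/F'$), and $X^*={}^tX^{\rho}$ for a square matrix $X$. Let $S$ be a finite set of primes of $F$ that contains all primes above $p$ and all primes ramified in $K/F$. *Local series.* Let $v$ be a prime of $F$, $\mathfrak g$ the ring of integers of $F_v$, $q$ the order of its residue field, $K_v=K\otimes_FF_v$, and $\mathfrak r$ the integral closure of $\mathfrak g$ in $K_v$. Let $S_v$ be the group of hermitian matrices ($h^*=h$) in $M_n(K_v)$, $S_v(\mathfrak r)=S_v\cap M_n(\mathfrak r)$ and $T_v=\{x\in S_v : \mathrm{tr}(S_v(\mathfrak r)x)\subset\mathfrak g\}$. Every $x\in M_n(K_v)$ can be written as $x=d^{-1}c$ with $c,d\in M_n(\mathfrak r)$, $\det d\in K_v^\times$ and $[c\ d]$ primitive (right invertible over $\mathfrak r$); put $\nu_0(x)=\det(d)\,\mathfrak r$, and for $\sigma\in S_v$ define $k(\sigma)$ by $[\mathfrak g:\mathfrak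 g\cap\nu_0(\sigma)]=q^{k(\sigma)}$. Fix an additive character $\chi_v:F_v\to S^1$ with $\mathfrak g=\{a\in F_v : \chi_v(a\mathfrak g)=1\}$. For $\zeta\in T_v$ with $\det\zeta\in K_v^\times$ define $g_\zeta$ by $$\sum_{\sigma\in S_v/S_v(\mathfrak r)}\chi_v(\mathrm{tr}(\zeta\sigma))\,t^{k(\sigma)}=g_\zeta(t)\prod_{i=1}^n\bigl(1-\tau^{i-1}q^{i-1}t\bigr),$$ where $\tau^{i}$ is $1$ if $i$ is even or $K_v\cong F_v\times F_v$, $-1$ if $i$ is odd and $K_v$ is an unramified field extension of $F_v$, and $0$ if $i$ is odd and $K_v/F_v$ is ramified. *Coefficients.* For a positive definite hermitian matrix $\beta\in M_n(K)$ (positive definite at all archimedean places) and $A\in GL_n(\mathbb A_K)$ put $\zeta_v=\omega_vA_v^*\beta A_v$, where $\omega_v$ generates the local different $\mathfrak d(F/\mathbb Q)_v$, and let $g_{\beta,m(A),v}=g_{\zeta_v}$ if $\zeta_v\in T_v$ and $g_{\beta,m(A),v}=0$ otherwise. For a nonzero ideal $\mathfrak a$ of $\mathcal O_F$ let $n_{\mathfrak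 a}(\beta,m(A))$ be the product, over the primes $v\mid\mathfrak a$, of the coefficient of $t^{\mathrm{ord}_v(\mathfrak a)}$ in $g_{\beta,m(A),v}(t)$. Let $n'_{\mathfrak a'}(\beta,m(A))$, for nonzero ideals $\mathfrak a'$ of $\mathcal O_{F'}$, be defined in the same way from $K'/F'$ and the images of $\beta$ and $A$ in $M_n(K')$ and $GL_n(\mathbb A_{K'})$. *Claim.* For every prime $\mathfrak q$ of $F$ that is not in $S$ and every integer $j\ge 0$, the numbers $n_{\mathfrak q^j}(\beta,m(A))$ and $n'_{(\mathfrak q\mathcal O_{F'})^j}(\beta,m(A))$ are integers, and $$n_{\mathfrak q^j}(\beta,m(A))\equiv n'_{(\mathfrak q\mathcal O_{F'})^j}(\beta,m(A))\pmod p .$$ This holds for all choices of the characters and of the generators of the differents over $F$ and $F'$, and it includes both the case where $\mathfrak q$ splits in $F'$ and the case where it is inert. -/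

import Mathlib

open scoped TensorProduct Matrix
open IsDedekindDomain NumberField

noncomputable section

namespace SiegelSeries

/-! ### Local theory

`Fv` is a non-archimedean local field with ring of integers `g`, `Kv` is the quadratic étale
`Fv`-algebra (a quadratic extension field or `Fv × Fv`) and `ρ` is its nontrivial involution. -/

section Local

variable {Fv Kv : Type*} [Field Fv] [CommRing Kv] [Algebra Fv Kv]
variable (g : ValuationSubring Fv) (ρ : Kv →+* Kv) (n : ℕ)

/-- `X ↦ X^*`, the transpose of the conjugate matrix. -/
def adjT {R : Type*} [CommRing R] (σ : R →+* R) {n : ℕ} (X : Matrix (Fin n) (Fin n) R) :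
    Matrix (Fin n) (Fin n) R :=
  (X.map σ)ᵀ

/-- The maximal order `𝔯` of `Kv`: the integral closure of `g`
(for `Kv = Fv × Fv` this is `g × g`). -/
abbrev maxOrder (Kv : Type*) [CommRing Kv] [Algebra Fv Kv] : Subalgebra g Kv :=
  integralClosure g Kv

/-- `S`, the additive group of hermitian `n × n` matrices over `Kv`. -/
def herm : AddSubgroup (Matrix (Fin n) (Fin n) Kv) where
  carrier := {X | adjT ρ X = X}
  zero_mem' := by ext i j; simp [adjT]
  add_mem' {X Y} hX hY := by
    have hX' : adjT ρ X = X := hX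
    have hY' : adjT ρ Y = Y := hY
    have : adjT ρ (X + Y) = adjT ρ X + adjT ρ Y := by ext i j; simp [adjT]
    change adjT ρ (X + Y) = X + Y
    rw [this, hX', hY']
  neg_mem' {X} hX := by
    have hX' : adjT ρ X = X := hX
    have : adjT ρ (-X) = -adjT ρ X := by ext i j; simp [adjT]
    change adjT ρ (-X) = -X
    rw [this, hX']

/-- `S(𝔯)`, the subgroup of `S` of the hermitian matrices with entries in `𝔯`. -/
def intHerm : AddSubgroup (herm ρ n) where
  carrier := {X | ∀ i j, X.1 i j ∈ maxOrder g Kv}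
  zero_mem' := fun _ _ => (maxOrder g Kv).zero_mem
  add_mem' hX hY := fun i j => (maxOrder g Kv).add_mem (hX i j) (hY i j)
  neg_mem' hX := fun i j => (maxOrder g Kv).neg_mem (hX i j)

/-- `T = {x ∈ S | tr(S(𝔯) x) ⊆ g}`. -/
def dualLattice : Set (Matrix (Fin n) (Fin n) Kv) :=
  {x | x ∈ herm ρ n ∧
    ∀ y : herm ρ n, y ∈ intHerm g ρ n → ∃ a ∈ g, (y.1 * x).trace = algebraMap Fv Kv a}

/-- `x = d⁻¹ c` with `c`, `d` integral, `d` invertible over `Kv` and `[c d]` primitive. A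
`n × 2n` matrix over `𝔯` has rank `n` and all its elementary divisors equal to `𝔯` exactly
if it has a right inverse with entries in `𝔯`. For `Kv = Fv × Fv` the condition is the
conjunction of the conditions on the two components. -/
def IsReducedFraction {n : ℕ} (x : Matrix (Fin n) (Fin n) Kv)
    (c d : Matrix (Fin n) (Fin n) (maxOrder g Kv)) : Prop :=
  IsUnit (d.map (algebraMap (maxOrder g Kv) Kv)).det ∧
  d.map (algebraMap (maxOrder g Kv) Kv) * x = c.map (algebraMap (maxOrder g Kv) Kv) ∧
  ∃ u w : Matrix (Fin n) (Fin n) (maxOrder g Kv), c * u + d * w = 1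

/-- The denominator ideal `ν₀(x) = det(d) 𝔯`, where `x = d⁻¹ c` is a reduced fraction. The
ideal `det(d) 𝔯` is the same for all the reduced fractions that represent `x`. -/
def denomIdeal {n : ℕ} (x : Matrix (Fin n) (Fin n) Kv) : Ideal (maxOrder g Kv) :=
  Ideal.span {δ | ∃ c d, IsReducedFraction g x c d ∧ δ = d.det}

/-- `ν[x] = N(g ∩ ν₀(x))`, the index of `g ∩ ν₀(x)` in `g`. -/
def nu {n : ℕ} (x : Matrix (Fin n) (Fin n) Kv) : ℕ :=
  Nat.card (g ⧸ (denomIdeal g x).comap (algebraMap g (maxOrder g Kv)))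

/-- The number of elements of the residue field of `Fv`. -/
def resCard : ℕ := Nat.card (IsLocalRing.ResidueField g)

/-- The additive character `χ` of `Fv` satisfies `g = {a ∈ Fv | χ(a g) = 1}`. -/
def HasConductorOne (χ : AddChar Fv Circle) : Prop :=
  ∀ a : Fv, a ∈ g ↔ ∀ b ∈ g, χ (a * b) = 1

/-- The element of `Fv` with image `x` in `Kv`. It is used for `x = tr(ζ σ)` with `ζ` and `σ`
hermitian, which is fixed by `ρ`, hence in (the image of) `Fv`. -/
def descend (x : Kv) : Fv := Function.invFun (algebraMap Fv Kv) x

/-- The formal series `A_ζ(t) = ∑_{σ ∈ S/S(𝔯)} χ(tr(ζ σ)) t^{k(σ)}`, where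
`ν[σ] = q^{k(σ)}`, for `ζ ∈ T`. Neither `χ(tr(ζ σ))` nor `k(σ)` depends on the representative
of the class, and the number of classes with a given `k(σ)` is finite. -/
def seriesA (χ : AddChar Fv Circle) {n : ℕ} (ζ : Matrix (Fin n) (Fin n) Kv) : PowerSeries ℂ :=
  PowerSeries.mk fun k =>
    ∑ᶠ s : {s : herm ρ n ⧸ intHerm g ρ n // nu g s.out.1 = resCard g ^ k},
      ((χ (descend (ζ * s.1.out.1).trace) : Circle) : ℂ)

/-- The different of `Kv` over `Fv` is trivial, i.e. the dual of `𝔯` for the trace form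
is `𝔯`. -/
def DifferentTrivial (Kv : Type*) [CommRing Kv] [Algebra Fv Kv] : Prop :=
  ∀ x : Kv, (∀ y ∈ maxOrder g Kv, Algebra.trace Fv Kv (x * y) ∈ g) → x ∈ maxOrder g Kv

open Classical in
/-- The symbol `τ^i`: it is `1` if `i` is even or `Kv` is split, `-1` if `i` is odd and `Kv` is
an unramified field extension, `0` if `i` is odd and `Kv` is ramified. -/
def tau (Kv : Type*) [CommRing Kv] [Algebra Fv Kv] (i : ℕ) : ℤ :=
  if Even i ∨ ¬ IsField Kv then 1 else if DifferentTrivial g Kv then -1 else 0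

/-- `f_ζ(t) = ∏_{i=1}^{n} (1 - τ^{i-1} q^{i-1} t)` for `ζ` of full rank `n`. -/
def seriesF (Kv : Type*) [CommRing Kv] [Algebra Fv Kv] (n : ℕ) : PowerSeries ℂ :=
  ∏ i ∈ Finset.range n,
    (1 - PowerSeries.C ((tau g Kv i : ℂ) * (resCard g : ℂ) ^ i) * PowerSeries.X)

open Classical in
/-- `g_ζ(t)`, defined by `A_ζ(t) = f_ζ(t) g_ζ(t)`, for `ζ ∈ T` of full rank; it is
set to be `0` if `ζ ∉ T`. -/
def seriesG (χ : AddChar Fv Circle) {n : ℕ} (ζ : Matrix (Fin n) (Fin n) Kv) : PowerSeries ℂ :=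
  if ζ ∈ dualLattice g ρ n then seriesA g ρ χ ζ * (seriesF g Kv n)⁻¹ else 0

end Local

/-! ### Ring homomorphisms between tensor products over different fields -/

section Tensor

variable {F F' A A' K K' : Type*} [Field F] [Field F'] [CommRing A] [CommRing A'] [CommRing K]
  [CommRing K'] [Algebra F A] [Algebra F K] [Algebra F' A'] [Algebra F' K']

/-- The ring homomorphism `A ⊗_F K → A' ⊗_{F'} K'`, `a ⊗ k ↦ φ(a) ⊗ ψ(k)`, for compatible
ring homomorphisms `ι : F → F'`, `φ : A → A'` and `ψ : K → K'`. -/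
def tensorMap (ι : F →+* F') (φ : A →+* A') (ψ : K →+* K')
    (hφ : ∀ x, φ (algebraMap F A x) = algebraMap F' A' (ι x))
    (hψ : ∀ x, ψ (algebraMap F K x) = algebraMap F' K' (ι x)) :
    A ⊗[F] K →+* A' ⊗[F'] K' :=
  letI : Algebra F (A' ⊗[F'] K') := ((algebraMap F' (A' ⊗[F'] K')).comp ι).toAlgebra
  let f : A →ₐ[F] A' ⊗[F'] K' :=
    { (Algebra.TensorProduct.includeLeftRingHom : A' →+* A' ⊗[F'] K').comp φ with
      commutes' := fun x => by
        change (φ (algebraMap F A x)) ⊗ₜ[F'] (1 : K') = algebraMap F' (A' ⊗[F'] K') (ι x)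
        rw [hφ]; rfl }
  let h : K →ₐ[F] A' ⊗[F'] K' :=
    { (Algebra.TensorProduct.includeRight : K' →ₐ[F'] A' ⊗[F'] K').toRingHom.comp ψ with
      commutes' := fun x => by
        change (1 : A') ⊗ₜ[F'] (ψ (algebraMap F K x)) = algebraMap F' (A' ⊗[F'] K') (ι x)
        rw [hψ, Algebra.TensorProduct.algebraMap_apply'] }
  (Algebra.TensorProduct.productMap f h).toRingHom

theorem tensorMap_tmul (ι : F →+* F') (φ : A →+* A') (ψ : K →+* K')
    (hφ : ∀ x, φ (algebraMap F A x) = algebraMap F' A' (ι x))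
    (hψ : ∀ x, ψ (algebraMap F K x) = algebraMap F' K' (ι x)) (a : A) (k : K) :
    tensorMap ι φ ψ hφ hψ (a ⊗ₜ k) = φ a ⊗ₜ ψ k := by
  change (φ a ⊗ₜ[F'] (1 : K')) * ((1 : A') ⊗ₜ[F'] ψ k) = _
  simp

end Tensor

/-! ### Extension of completions and of finite adeles -/

section Completion

variable (F F' : Type*) [Field F] [NumberField F] [Field F'] [NumberField F'] [Algebra F F']

instance underLiesOver (w : HeightOneSpectrum (𝓞 F')) :
    w.asIdeal.LiesOver (w.under (𝓞 F)).asIdeal := ⟨rfl⟩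

/-- The continuous extension `F_v → F'_w` of the inclusion `F → F'`, where `w` is a prime of `F'`
above the prime `v` of `F`. -/
def completionMap (w : HeightOneSpectrum (𝓞 F')) :
    (w.under (𝓞 F)).adicCompletion F →+* w.adicCompletion F' :=
  ((HeightOneSpectrum.adicCompletion.equiv F' w).symm.toRingHom.comp
    (UniformSpace.Completion.mapRingHom
      (algebraMap (WithVal ((w.under (𝓞 F)).valuation F)) (WithVal (w.valuation F')))
      (HeightOneSpectrum.uniformContinuous_algebraMap_liesOver F F'
        (w.under (𝓞 F)) w).continuous)).comp
    (HeightOneSpectrum.adicCompletion.equiv F (w.under (𝓞 F))).toRingHom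

theorem completionMap_coe (w : HeightOneSpectrum (𝓞 F')) (x : F) :
    completionMap F F' w (algebraMap F _ x) = algebraMap F' _ (algebraMap F F' x) := by
  change HeightOneSpectrum.adicCompletion.ofCompletion (UniformSpace.Completion.mapRingHom
    (algebraMap (WithVal ((w.under (𝓞 F)).valuation F)) (WithVal (w.valuation F')))
    (HeightOneSpectrum.uniformContinuous_algebraMap_liesOver F F' (w.under (𝓞 F)) w).continuous
    (((WithVal.equiv ((w.under (𝓞 F)).valuation F)).symm x :
      WithVal ((w.under (𝓞 F)).valuation F)) : ((w.under (𝓞 F)).valuation F).Completion)) = _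
  rw [UniformSpace.Completion.mapRingHom_coe
    (HeightOneSpectrum.uniformContinuous_algebraMap_liesOver F F' (w.under (𝓞 F)) w).continuous]
  rfl

theorem continuous_completionMap (w : HeightOneSpectrum (𝓞 F')) :
    Continuous (completionMap F F' w) := by
  refine (HeightOneSpectrum.adicCompletion.continuous_ofCompletion F' w).comp ?_
  exact UniformSpace.Completion.continuous_map.comp
    (HeightOneSpectrum.adicCompletion.continuous_toCompletion F _)

theorem completionMap_mapsTo (w : HeightOneSpectrum (𝓞 F')) :
    Set.MapsTo (completionMap F F' w) ((w.under (𝓞 F)).adicCompletionIntegers F)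
      (w.adicCompletionIntegers F') := by
  intro x hx
  have ho : IsOpen (((w.under (𝓞 F)).adicCompletionIntegers F : Set _) ∩
      {y | completionMap F F' w y - completionMap F F' w x ∈ w.adicCompletionIntegers F'}) := by
    refine (Valued.isOpen_valuationSubring _).inter ?_
    exact (Valued.isOpen_valuationSubring (w.adicCompletion F')).preimage
      ((continuous_completionMap F F' w).sub continuous_const)
  obtain ⟨y, hy⟩ := ((w.under (𝓞 F)).denseRange_algebraMap F).exists_mem_open ho
    ⟨x, hx, by simp⟩
  obtain ⟨hy1, hy2⟩ := hy
  have hy3 : completionMap F F' w (algebraMap F _ y) ∈ w.adicCompletionIntegers F' := by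
    rw [completionMap_coe]
    have hy4 : (w.under (𝓞 F)).valuation F y ≤ 1 := by
      rw [← HeightOneSpectrum.valuedAdicCompletion_eq_valuation' (w.under (𝓞 F)) y]
      exact hy1
    change Valued.v (algebraMap F' (w.adicCompletion F') (algebraMap F F' y)) ≤ 1
    have := HeightOneSpectrum.valuedAdicCompletion_eq_valuation' w (algebraMap F F' y)
    refine this.trans_le ?_
    rw [← HeightOneSpectrum.valuation_liesOver F' (w.under (𝓞 F)) w]
    exact pow_le_one' hy4 _
  have := sub_mem hy3 hy2
  simpa using this

theorem tendsto_under :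
    Filter.Tendsto (fun w : HeightOneSpectrum (𝓞 F') => w.under (𝓞 F))
      Filter.cofinite Filter.cofinite := by
  refine Filter.Tendsto.cofinite_of_finite_preimage_singleton fun v => ?_
  refine Set.Finite.of_finite_image (f := HeightOneSpectrum.asIdeal) ?_
    (HeightOneSpectrum.asIdeal_injective.injOn)
  refine (IsDedekindDomain.primesOver_finite v.asIdeal (𝓞 F')).subset ?_
  rintro _ ⟨w, hw, rfl⟩
  have hw' : w.under (𝓞 F) = v := hw
  exact ⟨w.isPrime, ⟨by rw [← hw']; rfl⟩⟩

/-- The inclusion of the finite adeles of `F` in the finite adeles of `F'`. -/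
def finiteAdeleMap : FiniteAdeleRing (𝓞 F) F →+* FiniteAdeleRing (𝓞 F') F' :=
  RestrictedProduct.mapAlongRingHom
    (fun v : HeightOneSpectrum (𝓞 F) => v.adicCompletion F)
    (fun w : HeightOneSpectrum (𝓞 F') => w.adicCompletion F')
    (fun w => w.under (𝓞 F)) (tendsto_under F F') (completionMap F F')
    (Filter.Eventually.of_forall (completionMap_mapsTo F F'))

theorem finiteAdeleMap_apply (x : FiniteAdeleRing (𝓞 F) F) (w : HeightOneSpectrum (𝓞 F')) :
    finiteAdeleMap F F' x w = completionMap F F' w (x (w.under (𝓞 F))) := rfl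

theorem finiteAdeleMap_algebraMap (x : F) :
    finiteAdeleMap F F' (algebraMap F _ x) = algebraMap F' _ (algebraMap F F' x) := by
  refine FiniteAdeleRing.ext _ fun w => ?_
  rw [finiteAdeleMap_apply]
  exact completionMap_coe F F' w x

end Completion

/-! ### Global objects

`K` is a quadratic extension of the number field `F`. The adele ring of `K` is used in the form
`𝔸_K = 𝔸_F ⊗_F K`, and `K_v = F_v ⊗_F K` for a prime `v` of `F`. -/

section Global

variable (F K : Type*) [Field F] [NumberField F] [Field K] [Algebra F K]

/-- `𝔸_K = 𝔸_F ⊗_F K`. -/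
abbrev Adeles : Type _ := AdeleRing (𝓞 F) F ⊗[F] K

/-- `𝔸_{K,f} = 𝔸_{F,f} ⊗_F K`. -/
abbrev FiniteAdeles : Type _ := FiniteAdeleRing (𝓞 F) F ⊗[F] K

/-- `K_v = F_v ⊗_F K`. -/
abbrev LocalAlg (v : HeightOneSpectrum (𝓞 F)) : Type _ := v.adicCompletion F ⊗[F] K

/-- The projection of the adeles of `K` to the finite adeles. -/
def finitePart : Adeles F K →+* FiniteAdeles F K :=
  tensorMap (RingHom.id F) (RingHom.snd (InfiniteAdeleRing F) (FiniteAdeleRing (𝓞 F) F))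
    (RingHom.id K) (fun _ => rfl) (fun _ => rfl)

/-- The evaluation of finite adeles of `F` at `v`. -/
def evalAt (v : HeightOneSpectrum (𝓞 F)) : FiniteAdeleRing (𝓞 F) F →+* v.adicCompletion F where
  toFun a := a v
  map_one' := rfl
  map_mul' _ _ := rfl
  map_zero' := rfl
  map_add' _ _ := rfl

/-- The component at `v` of a finite adele of `K`. -/
def component (v : HeightOneSpectrum (𝓞 F)) : FiniteAdeles F K →+* LocalAlg F K v :=
  tensorMap (RingHom.id F) (evalAt F v) (RingHom.id K) (fun _ => rfl) (fun _ => rfl)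

variable {K} in
/-- The involution of `K_v` that is induced by an automorphism `ρ` of `K` over `F`. -/
def localConj (ρ : K ≃ₐ[F] K) (v : HeightOneSpectrum (𝓞 F)) : LocalAlg F K v →+* LocalAlg F K v :=
  tensorMap (RingHom.id F) (RingHom.id (v.adicCompletion F)) (ρ : K →+* K) (fun _ => rfl)
    (fun x => ρ.commutes x)

variable {F}

/-- `χ_v` is an additive character of `F_v` with `g_v = {a | χ_v(a g_v) = 1}`, for all `v`. -/
def IsCharFamily (χ : ∀ v : HeightOneSpectrum (𝓞 F), AddChar (v.adicCompletion F) Circle) :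
    Prop :=
  ∀ v, HasConductorOne (v.adicCompletionIntegers F) (χ v)

/-- `ω_v` is a generator of the different `𝔡(F/ℚ)_v`, for all `v`. -/
def IsDifferentFamily (ω : ∀ v : HeightOneSpectrum (𝓞 F), v.adicCompletionIntegers F) : Prop :=
  ∀ v, (differentIdeal ℤ (𝓞 F)).map (algebraMap (𝓞 F) (v.adicCompletionIntegers F)) =
    Ideal.span {ω v}

variable {K}

open scoped ComplexOrder in
/-- `β` is a hermitian matrix over `K`, with respect to the automorphism `ρ` of `K`, and it is
positive definite at all the archimedean places. -/
def IsPosDefHermitian (ρ : K ≃ₐ[F] K) {n : ℕ} (β : Matrix (Fin n) (Fin n) K) : Prop :=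
  adjT (ρ : K →+* K) β = β ∧ ∀ φ : K →+* ℂ, (β.map φ).PosDef

/-- `ζ_v = ω_v A_v^* β A_v`. -/
def zeta (ρ : K ≃ₐ[F] K) (ω : ∀ v : HeightOneSpectrum (𝓞 F), v.adicCompletionIntegers F) {n : ℕ}
    (β : Matrix (Fin n) (Fin n) K) (A : GL (Fin n) (FiniteAdeles F K))
    (v : HeightOneSpectrum (𝓞 F)) : Matrix (Fin n) (Fin n) (LocalAlg F K v) :=
  (ω v : v.adicCompletion F) •
    (adjT (localConj F ρ v) (A.1.map (component F K v)) *
      β.map (Algebra.TensorProduct.includeRight : K →ₐ[F] LocalAlg F K v) *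
      A.1.map (component F K v))

/-- `g_{β,m(A),v}(t)`. -/
def siegelG (ρ : K ≃ₐ[F] K)
    (χ : ∀ v : HeightOneSpectrum (𝓞 F), AddChar (v.adicCompletion F) Circle)
    (ω : ∀ v : HeightOneSpectrum (𝓞 F), v.adicCompletionIntegers F) {n : ℕ}
    (β : Matrix (Fin n) (Fin n) K) (A : GL (Fin n) (FiniteAdeles F K))
    (v : HeightOneSpectrum (𝓞 F)) : PowerSeries ℂ :=
  seriesG (v.adicCompletionIntegers F) (localConj F ρ v) (χ v) (zeta ρ ω β A v)

/-- `n_𝔞(β, m(A))`, the coefficient at the ideal `𝔞` of the formal product of the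
`g_{β,m(A),v}(t)` with `t` replaced by the prime `v`: the product, over the primes `v` that
divide `𝔞`, of the coefficient of `t^{ord_v(𝔞)}` in `g_{β,m(A),v}(t)`. -/
def siegelCoeff (ρ : K ≃ₐ[F] K)
    (χ : ∀ v : HeightOneSpectrum (𝓞 F), AddChar (v.adicCompletion F) Circle)
    (ω : ∀ v : HeightOneSpectrum (𝓞 F), v.adicCompletionIntegers F) {n : ℕ}
    (β : Matrix (Fin n) (Fin n) K) (A : GL (Fin n) (FiniteAdeles F K)) (𝔞 : Ideal (𝓞 F)) : ℂ :=
  ∏ᶠ (v : HeightOneSpectrum (𝓞 F)) (_ : v.asIdeal ∣ 𝔞),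
    PowerSeries.coeff (multiplicity v.asIdeal 𝔞) (siegelG ρ χ ω β A v)

end Global

section BaseChange

variable (F K F' K' : Type*) [Field F] [NumberField F] [Field K] [Algebra F K]
  [Field F'] [NumberField F'] [Field K'] [Algebra F' K'] [Algebra F F'] [Algebra K K']
  [Algebra F K'] [IsScalarTower F F' K'] [IsScalarTower F K K']

/-- The inclusion of the finite adeles of `K` in the finite adeles of `K'`. -/
def finiteAdelesMap : FiniteAdeles F K →+* FiniteAdeles F' K' :=
  tensorMap (algebraMap F F') (finiteAdeleMap F F') (algebraMap K K')
    (finiteAdeleMap_algebraMap F F')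
    (fun x => by
      rw [← IsScalarTower.algebraMap_apply F K K', ← IsScalarTower.algebraMap_apply F F' K'])

end BaseChange

end SiegelSeries

end

namespace SiegelSeries

/-! ### Unramified quadratic algebras -/

/-! Let $w$ be a prime of $F'$ above $v = \mathfrak q$. Since $v$ is unramified in $K$, there is a
$\theta$ with $K_v = F_v \oplus F_v\theta$ and unit discriminant; then $\mathfrak r = \mathfrak g
\oplus \mathfrak g\theta$, $T_v$ consists of the integral hermitian matrices, and the same $\theta$
serves over $F'_w$.

Integrality: scaling by the units of $\mathfrak g$ permutes the classes $\sigma$ with given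
$k(\sigma)$. A character sum with this symmetry equals the number of $\sigma$ with
$\mathrm{tr}(\zeta\sigma) \in \mathfrak g$ minus the number with $\mathrm{tr}(\zeta\sigma) \in
\varpi^{-1} + \mathfrak g$ (`sum_char_eq_card_sub_card`, `coeff_seriesA`). So the coefficients of
$A_\zeta$ are integers that do not depend on $\chi$, and those of $g_\zeta$ are integers because
$f_\zeta$ has constant term 1.

Congruence: a generator of the decomposition group of $w$ gives an automorphism $\gamma$ of $F'_w$
over $F_v$ with $\gamma^p = 1$. It acts on the finite sets counted over $F'_w$, and its fixed points
are exactly the sets counted over $F_v$, because a $\gamma$-fixed class in $F'_w/\mathfrak g'$ comes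
from $F_v$. Hence the counts agree mod $p$ (`fiberCount_modEq`). The same argument on residue fields
gives $q' \equiv q$, and $\tau$ is unchanged because $p$ is odd (`tau_eq`). So $A$ and $f$ agree mod
$p$, and $g$ agrees after cancelling $f$ (`exists_int_coeff_seriesG`). The generators of the
differents at $v$ and $w$ differ by a unit, which is absorbed in the character.

The arithmetic inputs are `exists_isCyclicBaseChange`, which constructs $\gamma$, and
`exists_isReducedFraction_localAlg`, which keeps $k(\sigma)$ unchanged under base change. Globally,
$\mathfrak q$ has 1 or $p$ primes above it. In the first case the local congruence is the claim; in
the second, a product of $p$ integers congruent to $a$ is $a^p \equiv a$. -/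

/-- `K = F ⊕ F θ` is a quadratic algebra with conjugation `ρ` such that `θ` has trace `s` and
norm `P` in `g` and the discriminant `s² - 4P` is a unit of `g`. -/
structure IsUnramifiedQuadratic {F K : Type*} [Field F] [CommRing K] [Algebra F K]
    (g : ValuationSubring F) (ρ : K →+* K) (θ : K) (s P : F) : Prop where
  trace_mem : s ∈ g
  norm_mem : P ∈ g
  disc_unit : ∃ e ∈ g, (s ^ 2 - 4 * P) * e = 1
  theta_sq : θ * θ = algebraMap F K s * θ - algebraMap F K P
  conj_theta : ρ θ = algebraMap F K s - θ
  conj_algebraMap : ∀ a, ρ (algebraMap F K a) = algebraMap F K a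
  bij : Function.Bijective fun ab : F × F => algebraMap F K ab.1 + algebraMap F K ab.2 * θ

namespace IsUnramifiedQuadratic

variable {F K : Type*} [Field F] [CommRing K] [Algebra F K]
  {g : ValuationSubring F} {ρ : K →+* K} {θ : K} {s P : F}

section

variable (h : IsUnramifiedQuadratic g ρ θ s P)
include h

theorem exists_rep (x : K) : ∃ a b, x = algebraMap F K a + algebraMap F K b * θ := by
  obtain ⟨⟨a, b⟩, hab⟩ := h.bij.2 x
  exact ⟨a, b, hab.symm⟩

theorem rep_inj {a b a' b' : F}
    (hab : algebraMap F K a + algebraMap F K b * θ = algebraMap F K a' + algebraMap F K b' * θ) :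
    a = a' ∧ b = b' := by
  have := @h.bij.1 (a, b) (a', b') hab
  simpa using this

theorem algebraMap_injective : Function.Injective (algebraMap F K) := by
  intro a b hab
  refine (h.rep_inj (a := a) (b := 0) (a' := b) (b' := 0) ?_).1
  simp [hab]

theorem conj_rep (a b : F) : ρ (algebraMap F K a + algebraMap F K b * θ) =
    algebraMap F K (a + b * s) + algebraMap F K (-b) * θ := by
  simp only [map_add, map_mul, map_neg, h.conj_algebraMap, h.conj_theta]
  ring

theorem conj_conj (x : K) : ρ (ρ x) = x := by
  obtain ⟨a, b, rfl⟩ := h.exists_rep x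
  rw [h.conj_rep, h.conj_rep]
  simp

theorem sub_conj_sq : (θ - ρ θ) * (θ - ρ θ) = algebraMap F K (s ^ 2 - 4 * P) := by
  rw [h.conj_theta]
  simp only [map_sub, map_mul, map_pow, map_ofNat]
  linear_combination 4 * h.theta_sq

theorem isUnit_sub_conj : IsUnit (θ - ρ θ) := by
  obtain ⟨e, -, he⟩ := h.disc_unit
  refine IsUnit.of_mul_eq_one ((θ - ρ θ) * algebraMap F K e) ?_
  rw [← mul_assoc, h.sub_conj_sq, ← map_mul, he, map_one]

theorem fixed_iff {x : K} : ρ x = x ↔ ∃ a, x = algebraMap F K a := by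
  constructor
  · intro hx
    obtain ⟨a, b, rfl⟩ := h.exists_rep x
    have hb : algebraMap F K b * (θ - ρ θ) = 0 := by
      simp only [map_add, map_mul, h.conj_algebraMap] at hx
      linear_combination -hx
    rw [h.isUnit_sub_conj.mul_left_eq_zero] at hb
    exact ⟨a, by rw [hb]; ring⟩
  · rintro ⟨a, rfl⟩
    exact h.conj_algebraMap a

theorem algebraMap_mem_maxOrder_iff {a : F} : algebraMap F K a ∈ maxOrder g K ↔ a ∈ g := by
  constructor
  · intro ha
    have : IsIntegral g a := by
      rw [← isIntegral_algebraMap_iff h.algebraMap_injective]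
      exact ha
    obtain ⟨y, rfl⟩ := IsIntegrallyClosed.isIntegral_iff.1 this
    exact y.2
  · intro ha
    exact (maxOrder g K).algebraMap_mem ⟨a, ha⟩

theorem theta_mem : θ ∈ maxOrder g K := by
  refine ⟨Polynomial.X ^ 2 - Polynomial.C ⟨s, h.trace_mem⟩ * Polynomial.X +
    Polynomial.C ⟨P, h.norm_mem⟩, ?_, ?_⟩
  · monicity!
  · have h1 : algebraMap g K ⟨s, h.trace_mem⟩ = algebraMap F K s := rfl
    have h2 : algebraMap g K ⟨P, h.norm_mem⟩ = algebraMap F K P := rfl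
    simp only [Polynomial.eval₂_add, Polynomial.eval₂_sub, Polynomial.eval₂_pow,
      Polynomial.eval₂_X, Polynomial.eval₂_mul, Polynomial.eval₂_C, h1, h2]
    linear_combination h.theta_sq

theorem conj_mem {x : K} (hx : x ∈ maxOrder g K) : ρ x ∈ maxOrder g K := by
  let f : K →ₐ[g] K := { ρ with commutes' := fun a => h.conj_algebraMap a }
  exact IsIntegral.map f hx

/-- For $x = a + b\theta$ one has $(x - \rho x)(\theta - \rho\theta) = b(s^2 - 4P)$, so a unit
discriminant makes $b$ integral, and then $a$. -/
theorem rep_mem_maxOrder_iff {a b : F} :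
    algebraMap F K a + algebraMap F K b * θ ∈ maxOrder g K ↔ a ∈ g ∧ b ∈ g := by
  constructor
  · intro hx
    have hd := (maxOrder g K).sub_mem hx (h.conj_mem hx)
    have hb : algebraMap F K (b * (s ^ 2 - 4 * P)) ∈ maxOrder g K := by
      have := (maxOrder g K).mul_mem hd
        ((maxOrder g K).sub_mem h.theta_mem (h.conj_mem h.theta_mem))
      convert this using 1
      rw [map_mul, ← h.sub_conj_sq]
      simp only [map_add, map_mul, h.conj_algebraMap]
      ring
    rw [h.algebraMap_mem_maxOrder_iff] at hb
    obtain ⟨e, he, hde⟩ := h.disc_unit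
    have hb' : b ∈ g := by
      have := g.mul_mem _ _ hb he
      rwa [mul_assoc, hde, mul_one] at this
    refine ⟨?_, hb'⟩
    rw [← h.algebraMap_mem_maxOrder_iff (K := K)]
    have := (maxOrder g K).sub_mem hx ((maxOrder g K).mul_mem
      ((h.algebraMap_mem_maxOrder_iff (K := K)).2 hb') h.theta_mem)
    simpa using this
  · rintro ⟨ha, hb⟩
    exact (maxOrder g K).add_mem (h.algebraMap_mem_maxOrder_iff.2 ha)
      ((maxOrder g K).mul_mem (h.algebraMap_mem_maxOrder_iff.2 hb) h.theta_mem)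

/-- An element all of whose products with `1` and `θ` have integral trace is integral. -/
theorem mem_maxOrder_of_trace {x : K} (h1 : x + ρ x ∈ maxOrder g K)
    (h2 : x * θ + ρ (x * θ) ∈ maxOrder g K) : x ∈ maxOrder g K := by
  obtain ⟨e, he, hde⟩ := h.disc_unit
  -- Cramer's rule: the bracket equals $x(\theta - \rho\theta)$, and the last factor inverts $\theta
  -- - \rho\theta$.
  have h3 : x = ((x * θ + ρ (x * θ)) - ρ θ * (x + ρ x)) * ((θ - ρ θ) * algebraMap F K e) := by
    have : (θ - ρ θ) * ((θ - ρ θ) * algebraMap F K e) = 1 := by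
      rw [← mul_assoc, h.sub_conj_sq, ← map_mul, hde, map_one]
    rw [map_mul]
    linear_combination (-x) * this
  rw [h3]
  exact mul_mem (sub_mem h2 (mul_mem (h.conj_mem h.theta_mem) h1))
    (mul_mem (sub_mem h.theta_mem (h.conj_mem h.theta_mem)) (h.algebraMap_mem_maxOrder_iff.2 he))

/-- The algebra `K` in coordinates with respect to `1` and `θ`. -/
noncomputable def coordEquiv : QuadraticAlgebra F (-P) s ≃ₐ[F] K :=
  AlgEquiv.ofBijective (QuadraticAlgebra.lift ⟨θ, by
    rw [h.theta_sq, Algebra.smul_def, Algebra.smul_def, map_neg]; ring⟩) (by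
    convert h.bij.comp (QuadraticAlgebra.equivProd (-P) s).bijective using 1
    ext z
    simp [QuadraticAlgebra.equivProd, QuadraticAlgebra.lift, Algebra.smul_def])

theorem coordEquiv_apply (z : QuadraticAlgebra F (-P) s) :
    h.coordEquiv z = algebraMap F K z.re + algebraMap F K z.im * θ := by
  simp [coordEquiv, QuadraticAlgebra.lift, Algebra.smul_def]

theorem trace_rep (a b : F) :
    Algebra.trace F K (algebraMap F K a + algebraMap F K b * θ) = 2 * a + b * s := by
  have : algebraMap F K a + algebraMap F K b * θ = h.coordEquiv ⟨a, b⟩ :=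
    (h.coordEquiv_apply ⟨a, b⟩).symm
  rw [this, Algebra.trace_eq_of_algEquiv,
    Algebra.trace_eq_matrix_trace (QuadraticAlgebra.basis (-P) s), Matrix.trace_fin_two]
  simp [Algebra.leftMulMatrix_eq_repr_mul, QuadraticAlgebra.basis]
  ring

/-- `DifferentTrivial`, hence `tau`, is phrased with `Algebra.trace`; this translates it into the
conjugation. -/
theorem algebraMap_trace (x : K) : algebraMap F K (Algebra.trace F K x) = x + ρ x := by
  obtain ⟨a, b, rfl⟩ := h.exists_rep x
  rw [h.trace_rep, h.conj_rep]
  simp only [map_add, map_mul, map_neg, map_ofNat]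
  ring

/-- Pairing with $1$ and $\theta$ already forces integrality. As a consequence the value 0 of `tau`
never occurs here. -/
theorem differentTrivial : DifferentTrivial g K := by
  intro x hx
  refine h.mem_maxOrder_of_trace ?_ ?_
  · rw [← h.algebraMap_trace, h.algebraMap_mem_maxOrder_iff]
    simpa using hx 1 (one_mem _)
  · rw [← h.algebraMap_trace, h.algebraMap_mem_maxOrder_iff]
    exact hx θ h.theta_mem

end

end IsUnramifiedQuadratic

end SiegelSeries

namespace SiegelSeries

/-! ### Reduced fractions and denominator ideals -/

section Fractions

variable {F K : Type*} [Field F] [CommRing K] [Algebra F K] {g : ValuationSubring F} {n : ℕ}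

/-- Primitivity $cu + dw = 1$ says $d(xu + w) = 1$, so $d'd^{-1} = d'(xu + w) = c'u + d'w$ is
integral. Every denominator of $x$ is thus a left multiple of any other one. -/
theorem IsReducedFraction.exists_mul_eq {x : Matrix (Fin n) (Fin n) K}
    {c d c' d' : Matrix (Fin n) (Fin n) (maxOrder g K)}
    (h : IsReducedFraction g x c d) (h' : IsReducedFraction g x c' d') :
    ∃ e : Matrix (Fin n) (Fin n) (maxOrder g K), e * d = d' := by
  obtain ⟨hd, hdx, u, w, huw⟩ := h
  obtain ⟨-, hdx', -⟩ := h'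
  refine ⟨c' * u + d' * w, ?_⟩
  have hinj : Function.Injective (algebraMap (maxOrder g K) K) := Subtype.val_injective
  refine Matrix.map_injective hinj ?_
  set f := algebraMap (maxOrder g K) K
  have huw' : c.map f * u.map f + d.map f * w.map f = 1 := by
    have := congrArg (fun m => m.map f) huw
    simpa [Matrix.map_add, Matrix.map_mul, Matrix.map_one] using this
  have hr : (x * u.map f + w.map f) * d.map f = 1 := by
    refine mul_eq_one_comm.1 ?_
    rw [mul_add, ← mul_assoc, hdx, huw']
  change ((c' * u + d' * w) * d).map f = d'.map f
  simp only [Matrix.map_mul, Matrix.map_add f (map_add f)]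
  rw [← hdx', mul_assoc (d'.map f), ← mul_add, mul_assoc, hr, mul_one]

theorem IsReducedFraction.denomIdeal_eq {x : Matrix (Fin n) (Fin n) K}
    {c d : Matrix (Fin n) (Fin n) (maxOrder g K)} (h : IsReducedFraction g x c d) :
    denomIdeal g x = Ideal.span {d.det} := by
  refine le_antisymm (Ideal.span_le.2 ?_) (Ideal.span_mono ?_)
  · rintro _ ⟨c', d', h', rfl⟩
    obtain ⟨e, rfl⟩ := h.exists_mul_eq h'
    rw [SetLike.mem_coe, Ideal.mem_span_singleton, Matrix.det_mul]
    exact dvd_mul_left _ _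
  · rintro _ rfl
    exact ⟨c, d, h, rfl⟩

/-- $[c + dy\ \ d]$ arises from $[c\ d]$ by a unipotent column operation, so it stays primitive with
the same denominator. -/
theorem IsReducedFraction.add {x : Matrix (Fin n) (Fin n) K}
    {c d : Matrix (Fin n) (Fin n) (maxOrder g K)} (h : IsReducedFraction g x c d)
    (y : Matrix (Fin n) (Fin n) (maxOrder g K)) :
    IsReducedFraction g (x + y.map (algebraMap (maxOrder g K) K)) (c + d * y) d := by
  obtain ⟨hd, hdx, u, w, huw⟩ := h
  refine ⟨hd, ?_, u, w - y * u, ?_⟩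
  · rw [mul_add, hdx, Matrix.map_add _ (map_add _), Matrix.map_mul]
  · rw [← huw, add_mul, mul_sub, mul_assoc]
    abel

theorem denomIdeal_le_add (x y : Matrix (Fin n) (Fin n) K) (hy : ∀ i j, y i j ∈ maxOrder g K) :
    denomIdeal g x ≤ denomIdeal g (x + y) := by
  refine Ideal.span_mono ?_
  rintro _ ⟨c, d, h, rfl⟩
  exact ⟨_, d, h.add (Matrix.of fun i j => ⟨y i j, hy i j⟩), rfl⟩

theorem denomIdeal_add (x y : Matrix (Fin n) (Fin n) K) (hy : ∀ i j, y i j ∈ maxOrder g K) :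
    denomIdeal g (x + y) = denomIdeal g x := by
  refine le_antisymm ?_ (denomIdeal_le_add x y hy)
  simpa using denomIdeal_le_add (x + y) (-y) fun i j => neg_mem (hy i j)

theorem denomIdeal_le_smul (x : Matrix (Fin n) (Fin n) K) (u : gˣ) :
    denomIdeal g x ≤ denomIdeal g ((u : F) • x) := by
  refine Ideal.span_mono ?_
  rintro _ ⟨c, d, ⟨hd, hdx, a, b, hab⟩, rfl⟩
  refine ⟨(u : g) • c, d, ⟨hd, ?_, (↑u⁻¹ : g) • a, b, ?_⟩, rfl⟩
  · rw [Matrix.mul_smul, hdx]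
    ext i j
    simp only [Matrix.smul_apply, Matrix.map_apply]
    rfl
  · rw [Matrix.smul_mul, Matrix.mul_smul, smul_smul, u.mul_inv, one_smul, hab]

theorem denomIdeal_smul (x : Matrix (Fin n) (Fin n) K) (u : gˣ) :
    denomIdeal g ((u : F) • x) = denomIdeal g x := by
  refine le_antisymm ?_ (denomIdeal_le_smul x u)
  have := denomIdeal_le_smul ((u : F) • x) u⁻¹
  rwa [smul_smul, show ((↑u⁻¹ : g) : F) * ((u : g) : F) = 1 from congrArg Subtype.val u.inv_mul,
    one_smul] at this

/-- From $dx = c$ one gets $\det(d)\,x = \mathrm{adj}(d)\,c$. This bounds the denominators of the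
entries at each level and yields `finite_level`. -/
theorem mul_mem_maxOrder_of_mem_denomIdeal {x : Matrix (Fin n) (Fin n) K} {δ : maxOrder g K}
    (hδ : δ ∈ denomIdeal g x) (i j : Fin n) : (δ : K) * x i j ∈ maxOrder g K := by
  induction hδ using Submodule.span_induction with
  | mem δ h =>
    obtain ⟨c, d, ⟨hd, hdx, -⟩, rfl⟩ := h
    set f := algebraMap (maxOrder g K) K
    have : (d.det : K) • x = (d.adjugate * c).map f := by
      rw [Matrix.map_mul, ← hdx, ← mul_assoc, ← Matrix.map_mul, Matrix.adjugate_mul]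
      ext i j
      rw [Matrix.mul_apply, Finset.sum_eq_single i]
      · simp; rfl
      · intro b _ hb
        simp [Matrix.one_apply_ne hb.symm]
      · simp
    have h2 := congrFun (congrFun this i) j
    rw [Matrix.smul_apply, smul_eq_mul] at h2
    rw [h2]
    exact ((d.adjugate * c) i j).2
  | zero => simp
  | add a b _ _ ha hb =>
    rw [Subalgebra.coe_add, add_mul]
    exact add_mem ha hb
  | smul a b _ hb =>
    rw [smul_eq_mul, Subalgebra.coe_mul, mul_assoc]
    exact mul_mem a.2 hb

variable {F' K' : Type*} [Field F'] [CommRing K'] [Algebra F' K'] {g' : ValuationSubring F'}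

/-- The restriction to the maximal orders of a ring homomorphism that preserves them. -/
def maxOrderMap (ψ : K →+* K') (hψ : ∀ x ∈ maxOrder g K, ψ x ∈ maxOrder g' K') :
    maxOrder g K →+* maxOrder g' K' :=
  ψ.restrict (maxOrder g K) (maxOrder g' K') hψ

/-- Primitivity is witnessed by a right inverse, so it survives any ring homomorphism that respects
the orders. -/
theorem IsReducedFraction.map {x : Matrix (Fin n) (Fin n) K}
    {c d : Matrix (Fin n) (Fin n) (maxOrder g K)} (h : IsReducedFraction g x c d)
    (ψ : K →+* K') (hψ : ∀ x ∈ maxOrder g K, ψ x ∈ maxOrder g' K') :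
    IsReducedFraction g' (x.map ψ) (c.map (maxOrderMap ψ hψ)) (d.map (maxOrderMap ψ hψ)) := by
  obtain ⟨hd, hdx, u, w, huw⟩ := h
  have key : ∀ e : Matrix (Fin n) (Fin n) (maxOrder g K),
      (e.map (maxOrderMap ψ hψ)).map (algebraMap (maxOrder g' K') K') =
        (e.map (algebraMap (maxOrder g K) K)).map ψ := fun e => rfl
  refine ⟨?_, ?_, u.map (maxOrderMap ψ hψ), w.map (maxOrderMap ψ hψ), ?_⟩
  · rw [key, ← RingHom.mapMatrix_apply, ← RingHom.map_det]
    exact hd.map ψ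
  · rw [key, key, ← Matrix.map_mul, hdx]
  · rw [← Matrix.map_mul, ← Matrix.map_mul, ← Matrix.map_add _ (map_add _), huw]
    simp

theorem map_mem_denomIdeal {x : Matrix (Fin n) (Fin n) K}
    (ψ : K →+* K') (hψ : ∀ x ∈ maxOrder g K, ψ x ∈ maxOrder g' K')
    {δ : maxOrder g K} (hδ : δ ∈ denomIdeal g x) :
    maxOrderMap ψ hψ δ ∈ denomIdeal g' (x.map ψ) := by
  have : denomIdeal g x ≤ (denomIdeal g' (x.map ψ)).comap (maxOrderMap ψ hψ) := by
    refine Ideal.span_le.2 ?_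
    rintro _ ⟨c, d, h, rfl⟩
    refine Ideal.subset_span ⟨_, _, h.map ψ hψ, ?_⟩
    rw [← RingHom.mapMatrix_apply, ← RingHom.map_det]
  exact this hδ

end Fractions

/-! ### Ideals of discrete valuation rings and the index `ν` -/

section Index

/-- An ideal of a discrete valuation ring is determined by the powers of $\varpi$ in it. This
replaces the index defining $k(\sigma)$ by a membership condition that can be followed through base
change and automorphisms. -/
theorem ideal_card_quotient_eq_pow_iff {R : Type*} [CommRing R] [IsDomain R]
    [IsDiscreteValuationRing R] [Finite (IsLocalRing.ResidueField R)] {ϖ : R}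
    (hϖ : Irreducible ϖ) (I : Ideal R) (k : ℕ) :
    Nat.card (R ⧸ I) = Nat.card (IsLocalRing.ResidueField R) ^ k ↔
      ∀ m, ϖ ^ m ∈ I ↔ k ≤ m := by
  have hq : 1 < Nat.card (IsLocalRing.ResidueField R) := Finite.one_lt_card
  have hcard : ∀ m, Nat.card (R ⧸ Ideal.span {ϖ ^ m}) =
      Nat.card (IsLocalRing.ResidueField R) ^ m := by
    intro m
    have := cardQuot_pow_of_prime (IsDiscreteValuationRing.not_a_field R) (i := m)
    rw [hϖ.maximalIdeal_eq, Ideal.span_singleton_pow] at this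
    simp only [Submodule.cardQuot_apply] at this
    rw [this, ← hϖ.maximalIdeal_eq]
    rfl
  have hmem : ∀ m k, ϖ ^ m ∈ Ideal.span {ϖ ^ k} ↔ k ≤ m := by
    intro m k
    rw [Ideal.mem_span_singleton, pow_dvd_pow_iff hϖ.ne_zero hϖ.not_isUnit]
  by_cases hI : I = ⊥
  -- The zero ideal satisfies neither side: `R` is infinite, since it is not a field, and no power
  -- of `ϖ` vanishes.
  · subst hI
    constructor
    · intro h
      have hfin : Finite (R ⧸ (⊥ : Ideal R)) :=
        Nat.finite_of_card_ne_zero (h ▸ pow_ne_zero _ (by omega))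
      have : Finite R := Finite.of_equiv _ (RingEquiv.quotientBot R).toEquiv
      exact absurd (Finite.isField_of_domain R) (IsDiscreteValuationRing.not_isField R)
    · intro h
      have := (h k).2 le_rfl
      rw [Ideal.mem_bot] at this
      exact absurd this (pow_ne_zero _ hϖ.ne_zero)
  · obtain ⟨m, rfl⟩ := IsDiscreteValuationRing.ideal_eq_span_pow_irreducible hI hϖ
    rw [hcard, Nat.pow_right_inj hq]
    simp only [hmem]
    constructor
    · rintro rfl; simp
    · intro h
      exact le_antisymm ((h k).2 le_rfl) ((h m).1 le_rfl)

variable {F K : Type*} [Field F] [CommRing K] [Algebra F K] {g : ValuationSubring F}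
  [IsDiscreteValuationRing g] [Finite (IsLocalRing.ResidueField g)] {n : ℕ}

theorem nu_eq_pow_iff {ϖ : g} (hϖ : Irreducible ϖ) (x : Matrix (Fin n) (Fin n) K) (k : ℕ) :
    nu g x = resCard g ^ k ↔
      ∀ m, algebraMap g (maxOrder g K) (ϖ ^ m) ∈ denomIdeal g x ↔ k ≤ m :=
  ideal_card_quotient_eq_pow_iff hϖ _ k

end Index

end SiegelSeries

namespace SiegelSeries

/-! ### Character sums over sets with an action of the units -/

section CharacterSum

variable {F : Type*} [Field F] {g : ValuationSubring F}

theorem HasConductorOne.apply_eq_one {χ : AddChar F Circle} (hχ : HasConductorOne g χ) {a : F}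
    (ha : a ∈ g) : χ a = 1 := by
  simpa using (hχ a).1 ha 1 g.one_mem

theorem HasConductorOne.apply_eq {χ : AddChar F Circle} (hχ : HasConductorOne g χ) {a b : F}
    (hab : a - b ∈ g) : χ a = χ b := by
  have := hχ.apply_eq_one hab
  rw [← sub_add_cancel a b, AddChar.map_add_eq_mul, this, one_mul]

theorem mul_mem_iff_of_unit (u : gˣ) (a : F) : (u : F) * a ∈ g ↔ a ∈ g := by
  refine ⟨fun h => ?_, fun h => g.mul_mem _ _ u.1.2 h⟩
  have := g.mul_mem _ _ (↑u⁻¹ : g).2 h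
  rwa [← mul_assoc, show ((↑u⁻¹ : g) : F) * ((u : g) : F) = 1 from
    congrArg Subtype.val u.inv_mul, one_mul] at this

/-- The additive character `a ↦ χ(ua)`. -/
noncomputable def twist (χ : AddChar F Circle) (u : F) : AddChar F Circle where
  toFun a := χ (u * a)
  map_zero_eq_one' := by simp
  map_add_eq_mul' a b := by rw [mul_add, AddChar.map_add_eq_mul]

theorem HasConductorOne.twist {χ : AddChar F Circle} (hχ : HasConductorOne g χ) (u : gˣ) :
    HasConductorOne g (twist χ u) := by
  intro a
  rw [← mul_mem_iff_of_unit u a, hχ]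
  simp only [mul_assoc]
  rfl

variable {ϖ : g} (hϖ : Irreducible ϖ)
include hϖ

theorem uniformizer_ne_zero : (ϖ : F) ≠ 0 := by
  simpa using hϖ.ne_zero

theorem uniformizer_inv_notMem : (ϖ : F)⁻¹ ∉ g := by
  intro h
  refine hϖ.not_isUnit (IsUnit.of_mul_eq_one ⟨_, h⟩ ?_)
  exact Subtype.ext (mul_inv_cancel₀ (uniformizer_ne_zero hϖ))

theorem isUnit_one_add (b : g) {m : ℕ} (hm : m ≠ 0) : IsUnit (1 + ϖ ^ m * b) := by
  by_contra h
  have h1 : 1 + ϖ ^ m * b ∈ IsLocalRing.maximalIdeal g := h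
  have h2 : ϖ ^ m * b ∈ IsLocalRing.maximalIdeal g := by
    refine Ideal.mul_mem_right _ _ (Ideal.pow_mem_of_mem _ ?_ _ (Nat.pos_of_ne_zero hm))
    exact hϖ.not_isUnit
  have h3 := Ideal.sub_mem _ h1 h2
  rw [add_sub_cancel_right] at h3
  exact (IsLocalRing.mem_maximalIdeal _).1 h3 isUnit_one

variable [IsDiscreteValuationRing g]

theorem exists_pow_mul_mem (a : F) : ∃ m : ℕ, (ϖ : F) ^ m * a ∈ g := by
  obtain ⟨x, y, hy, rfl⟩ := IsFractionRing.div_surjective (A := g) a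
  have hy0 : y ≠ 0 := nonZeroDivisors.ne_zero hy
  obtain ⟨m, u, rfl⟩ := IsDiscreteValuationRing.eq_unit_mul_pow_irreducible hy0 hϖ
  refine ⟨m, ?_⟩
  have : (ϖ : F) ^ m * (algebraMap g F x / algebraMap g F (u * ϖ ^ m)) = ((↑u⁻¹ * x : g) : F) := by
    have h0 := uniformizer_ne_zero hϖ
    have hu : ((↑u⁻¹ : g) : F) * ((u : g) : F) = 1 := congrArg Subtype.val u.inv_mul
    have hu0 : ((u : g) : F) ≠ 0 := right_ne_zero_of_mul_eq_one hu
    simp only [map_mul, map_pow]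
    change (ϖ : F) ^ m * ((x : F) / ((u : g) * (ϖ : F) ^ m)) = ((↑u⁻¹ : g) : F) * x
    field_simp
    linear_combination (-(x : F)) * hu
  rw [this]
  exact Subtype.mem _

/-- It makes $b \mapsto \chi(wb)$ a character of the residue field when $\varpi w \in \mathfrak g$
and $\chi$ is trivial on $\mathfrak g$. -/
theorem mul_mem_of_residue_eq {w : F} (hw : (ϖ : F) * w ∈ g) {a b : g}
    (hab : IsLocalRing.residue g a = IsLocalRing.residue g b) : w * a - w * b ∈ g := by
  have h1 : a - b ∈ IsLocalRing.maximalIdeal g := by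
    rw [← Ideal.Quotient.eq]
    exact hab
  rw [hϖ.maximalIdeal_eq, Ideal.mem_span_singleton] at h1
  obtain ⟨c, hc⟩ := h1
  have h2 : w * a - w * b = (ϖ : F) * w * c := by
    have : (a : F) - b = ϖ * c := congrArg Subtype.val hc
    linear_combination w * this
  rw [h2]
  exact g.mul_mem _ _ hw c.2

/-- Orthogonality: since $w \notin \mathfrak g$, some $b_0$ has $\chi(wb_0) \ne 1$, and translation
by $b_0$ multiplies the sum by this value. -/
theorem sum_residue_char_eq_zero [Fintype (IsLocalRing.ResidueField g)] {χ : AddChar F Circle}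
    (hχ : HasConductorOne g χ) {w : F} (hw : (ϖ : F) * w ∈ g) (hw' : w ∉ g) :
    ∑ b : IsLocalRing.ResidueField g, (χ (w * (b.out : g)) : ℂ) = 0 := by
  have hout : ∀ b : IsLocalRing.ResidueField g, IsLocalRing.residue g b.out = b :=
    fun b => Quotient.out_eq b
  obtain ⟨b₀, hb₀, hne⟩ : ∃ b ∈ g, χ (w * b) ≠ 1 := by
    by_contra! h
    exact hw' ((hχ w).2 h)
  have hshift : ∀ b : IsLocalRing.ResidueField g,
      χ (w * ((b + IsLocalRing.residue g ⟨b₀, hb₀⟩).out : g)) =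
        χ (w * (b.out : g)) * χ (w * b₀) := by
    intro b
    rw [← AddChar.map_add_eq_mul, ← mul_add]
    refine hχ.apply_eq (mul_mem_of_residue_eq hϖ hw (b := b.out + ⟨b₀, hb₀⟩) ?_)
    rw [hout, map_add, hout]
  have hsum : ∑ b : IsLocalRing.ResidueField g, (χ (w * (b.out : g)) : ℂ) =
      (∑ b : IsLocalRing.ResidueField g, (χ (w * (b.out : g)) : ℂ)) * χ (w * b₀) := by
    rw [Finset.sum_mul, ← Equiv.sum_comp (Equiv.addRight (IsLocalRing.residue g ⟨b₀, hb₀⟩))]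
    refine Finset.sum_congr rfl fun b _ => ?_
    rw [Equiv.coe_addRight, hshift, Circle.coe_mul]
  have hne' : (χ (w * b₀) : ℂ) ≠ 1 := by
    rwa [Ne, Circle.coe_eq_one]
  by_contra h0
  exact hne' (mul_left_cancel₀ h0 (by rw [← hsum, mul_one]))

-- Equivariance is asked only modulo `g`: `t` will be evaluated on chosen representatives of
-- classes, where it is defined only up to `g`.
variable {X : Type*} [Fintype X] {t : X → F}
  (ht : ∀ u : gˣ, ∃ e : Equiv.Perm X, ∀ x, t (e x) - (u : F) * t x ∈ g)
include ht

-- The unit $1 + \varpi^m b$ permutes the elements of exact level $m + 1$ and multiplies the summand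
-- at $x$ by $\chi(\varpi^m t(x) b)$. Averaging over residues $b$ gives 0. The condition `m ≠ 0`
-- ensures that $1 + \varpi^m b$ is a unit.
open Classical in
theorem sum_char_level_eq_zero [Fintype (IsLocalRing.ResidueField g)] {χ : AddChar F Circle}
    (hχ : HasConductorOne g χ) {m : ℕ} (hm : m ≠ 0) :
    ∑ x with (ϖ : F) ^ (m + 1) * t x ∈ g ∧ (ϖ : F) ^ m * t x ∉ g, (χ (t x) : ℂ) = 0 := by
  set E : Finset X := {x | (ϖ : F) ^ (m + 1) * t x ∈ g ∧ (ϖ : F) ^ m * t x ∉ g} with hE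
  have hstep : ∀ b : IsLocalRing.ResidueField g, ∑ x ∈ E, (χ (t x) : ℂ) =
      ∑ x ∈ E, (χ (t x) : ℂ) * χ ((ϖ : F) ^ m * t x * (b.out : g)) := by
    intro b
    obtain ⟨u, hu⟩ := isUnit_one_add hϖ b.out hm
    obtain ⟨e, he⟩ := ht u
    have hpow : ∀ k x, (ϖ : F) ^ k * t (e x) ∈ g ↔ (ϖ : F) ^ k * t x ∈ g := by
      intro k x
      rw [← mul_mem_iff_of_unit u ((ϖ : F) ^ k * t x)]
      have h1 : (ϖ : F) ^ k * (t (e x) - (u : F) * t x) ∈ g :=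
        g.mul_mem _ _ (ϖ ^ k).2 (he x)
      constructor
      · intro h
        have := sub_mem h h1
        convert this using 1; ring
      · intro h
        have := add_mem h h1
        convert this using 1; ring
    refine (Finset.sum_equiv e (t := E) (fun x => ?_) (fun x _ => ?_)).symm
    · simp [hE, hpow]
    · rw [← Circle.coe_mul, ← AddChar.map_add_eq_mul]
      congr 1
      refine (hχ.apply_eq ?_).symm
      have hu' : (u : F) = 1 + (ϖ : F) ^ m * (b.out : g) := by
        rw [hu]; rfl
      have := he x
      rw [hu'] at this
      convert this using 1
      ring
  have htot : (Fintype.card (IsLocalRing.ResidueField g) : ℂ) * ∑ x ∈ E, (χ (t x) : ℂ) = 0 := by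
    calc (Fintype.card (IsLocalRing.ResidueField g) : ℂ) * ∑ x ∈ E, (χ (t x) : ℂ)
        = ∑ b : IsLocalRing.ResidueField g, ∑ x ∈ E, (χ (t x) : ℂ) := by
          rw [Finset.sum_const, Finset.card_univ, nsmul_eq_mul]
      _ = ∑ b : IsLocalRing.ResidueField g, ∑ x ∈ E,
            (χ (t x) : ℂ) * χ ((ϖ : F) ^ m * t x * (b.out : g)) :=
          Finset.sum_congr rfl fun b _ => hstep b
      _ = 0 := by
          rw [Finset.sum_comm]
          refine Finset.sum_eq_zero fun x hx => ?_
          rw [← Finset.mul_sum, sum_residue_char_eq_zero hϖ hχ, mul_zero]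
          · rw [← mul_assoc, ← pow_succ']
            exact (Finset.mem_filter.1 hx).2.1
          · exact (Finset.mem_filter.1 hx).2.2
  rcases mul_eq_zero.1 htot with h | h
  · exact absurd h (Nat.cast_ne_zero.2 Fintype.card_ne_zero)
  · exact h

-- The elements are sorted by the residue $b$ of $\varpi t(x)$. The unit action makes all fibres
-- over $b \ne 0$ equally large, and $\sum_{b \ne 0} \chi(b/\varpi) = -1$.
open Classical in
theorem sum_char_first_level [Fintype (IsLocalRing.ResidueField g)] {χ : AddChar F Circle}
    (hχ : HasConductorOne g χ) :
    ∑ x with (ϖ : F) * t x ∈ g, (χ (t x) : ℂ) =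
      (Nat.card {x // t x ∈ g} : ℂ) - Nat.card {x // t x - (ϖ : F)⁻¹ ∈ g} := by
  have hϖ0 := uniformizer_ne_zero hϖ
  have hout : ∀ b : IsLocalRing.ResidueField g, IsLocalRing.residue g b.out = b :=
    fun b => Quotient.out_eq b
  have hmem : ∀ (x : X) (b : IsLocalRing.ResidueField g), t x - (ϖ : F)⁻¹ * (b.out : g) ∈ g ↔
      ∃ h : (ϖ : F) * t x ∈ g, IsLocalRing.residue g ⟨_, h⟩ = b := by
    intro x b
    constructor
    · intro h
      have h1 : (ϖ : F) * t x = ϖ * (t x - (ϖ : F)⁻¹ * (b.out : g)) + (b.out : g) := by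
        field_simp; ring
      have h2 : (ϖ : F) * t x ∈ g := by
        rw [h1]
        exact add_mem (g.mul_mem _ _ ϖ.2 h) b.out.2
      refine ⟨h2, ?_⟩
      have h3 : (⟨_, h2⟩ : g) = ϖ * ⟨_, h⟩ + b.out := Subtype.ext h1
      rw [h3, map_add, map_mul, hout, (IsLocalRing.residue_eq_zero_iff _).2, zero_mul, zero_add]
      exact hϖ.not_isUnit
    · rintro ⟨h, hb⟩
      have := mul_mem_of_residue_eq hϖ (w := (ϖ : F)⁻¹) (a := ⟨_, h⟩) (b := b.out)
        (by rw [mul_inv_cancel₀ hϖ0]; exact g.one_mem) (by rw [hb, hout])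
      rwa [inv_mul_cancel_left₀ hϖ0] at this
  have hfib : ∑ x with (ϖ : F) * t x ∈ g, (χ (t x) : ℂ) =
      ∑ b : IsLocalRing.ResidueField g,
        (Nat.card {x // t x - (ϖ : F)⁻¹ * (b.out : g) ∈ g} : ℂ) *
          χ ((ϖ : F)⁻¹ * (b.out : g)) := by
    have : ∀ b : IsLocalRing.ResidueField g,
        (Nat.card {x // t x - (ϖ : F)⁻¹ * (b.out : g) ∈ g} : ℂ) * χ ((ϖ : F)⁻¹ * (b.out : g)) =
        ∑ x, if t x - (ϖ : F)⁻¹ * (b.out : g) ∈ g then (χ (t x) : ℂ) else 0 := by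
      intro b
      rw [← Finset.sum_filter, Nat.card_eq_fintype_card, Fintype.card_subtype, ← nsmul_eq_mul,
        ← Finset.sum_const]
      refine Finset.sum_congr rfl fun x hx => ?_
      rw [hχ.apply_eq (Finset.mem_filter.1 hx).2]
    rw [Finset.sum_congr rfl fun b _ => this b, Finset.sum_comm, Finset.sum_filter]
    refine Finset.sum_congr rfl fun x _ => ?_
    by_cases h : (ϖ : F) * t x ∈ g
    · simp [hmem, h]
    · simp [hmem, h]
  have hunit : ∀ b : IsLocalRing.ResidueField g, b ≠ 0 →
      Nat.card {x // t x - (ϖ : F)⁻¹ * (b.out : g) ∈ g} =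
        Nat.card {x // t x - (ϖ : F)⁻¹ ∈ g} := by
    intro b hb
    have hbu : IsUnit b.out := by
      by_contra h
      exact hb (by rw [← hout b]; exact (IsLocalRing.residue_eq_zero_iff _).2 h)
    obtain ⟨u, hu⟩ := hbu
    obtain ⟨e, he⟩ := ht u
    refine (Nat.card_congr (e.subtypeEquiv fun x => ?_)).symm
    rw [← hu, ← mul_mem_iff_of_unit u (t x - (ϖ : F)⁻¹)]
    constructor
    · intro h
      have := add_mem h (he x)
      convert this using 1; ring
    · intro h
      have := sub_mem h (he x)
      convert this using 1; ring
  have hzero : Nat.card {x // t x - (ϖ : F)⁻¹ * ((0 : IsLocalRing.ResidueField g).out : g) ∈ g} =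
      Nat.card {x // t x ∈ g} := by
    have h0 : (ϖ : F)⁻¹ * ((0 : IsLocalRing.ResidueField g).out : g) ∈ g := by
      have := mul_mem_of_residue_eq hϖ (w := (ϖ : F)⁻¹)
        (a := (0 : IsLocalRing.ResidueField g).out) (b := 0)
        (by rw [mul_inv_cancel₀ hϖ0]; exact g.one_mem) (by rw [hout, map_zero])
      simpa using this
    refine Nat.card_congr (Equiv.subtypeEquivRight fun x => ?_)
    exact ⟨fun h => by simpa using add_mem h h0, fun h => sub_mem h h0⟩
  have hz1 : χ ((ϖ : F)⁻¹ * ((0 : IsLocalRing.ResidueField g).out : g)) = 1 := by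
    refine hχ.apply_eq_one ?_
    have := mul_mem_of_residue_eq hϖ (w := (ϖ : F)⁻¹)
      (a := (0 : IsLocalRing.ResidueField g).out) (b := 0)
      (by rw [mul_inv_cancel₀ hϖ0]; exact g.one_mem) (by rw [hout, map_zero])
    simpa using this
  have hres := sum_residue_char_eq_zero hϖ hχ (w := (ϖ : F)⁻¹)
    (by rw [mul_inv_cancel₀ hϖ0]; exact g.one_mem) (uniformizer_inv_notMem hϖ)
  rw [← Finset.add_sum_erase _ _ (Finset.mem_univ 0), hz1, Circle.coe_one] at hres
  rw [hfib, ← Finset.add_sum_erase _ _ (Finset.mem_univ 0), hzero, hz1, Circle.coe_one, mul_one,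
    Finset.sum_congr rfl fun b hb => by rw [hunit b (Finset.ne_of_mem_erase hb)],
    ← Finset.mul_sum]
  linear_combination (Nat.card {x // t x - (ϖ : F)⁻¹ ∈ g} : ℂ) * hres

/-- A sum of values of a character of conductor `g` over a finite set with an equivariant action
of the units of `g` is a difference of two cardinalities that do not involve the character. -/
theorem sum_char_eq_card_sub_card [Finite (IsLocalRing.ResidueField g)] {χ : AddChar F Circle}
    (hχ : HasConductorOne g χ) :
    ∑ x, (χ (t x) : ℂ) =
      (Nat.card {x // t x ∈ g} : ℂ) - Nat.card {x // t x - (ϖ : F)⁻¹ ∈ g} := by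
  classical
  have := Fintype.ofFinite (IsLocalRing.ResidueField g)
  -- Only the first level contributes: each further level adds 0 by `sum_char_level_eq_zero`.
  have hlevel : ∀ m : ℕ, ∑ x with (ϖ : F) ^ (m + 1) * t x ∈ g, (χ (t x) : ℂ) =
      (Nat.card {x // t x ∈ g} : ℂ) - Nat.card {x // t x - (ϖ : F)⁻¹ ∈ g} := by
    intro m
    induction m with
    | zero => simpa using sum_char_first_level hϖ ht hχ
    | succ m ih =>
      rw [← ih, ← Finset.sum_filter_add_sum_filter_not _ (fun x => (ϖ : F) ^ (m + 1) * t x ∈ g),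
        Finset.filter_filter, Finset.filter_filter,
        sum_char_level_eq_zero hϖ ht hχ (m := m + 1) (by omega), add_zero]
      refine Finset.sum_congr (Finset.filter_congr fun x _ => ?_) fun _ _ => rfl
      refine and_iff_right_of_imp fun h => ?_
      rw [pow_succ', mul_assoc]
      exact g.mul_mem _ _ ϖ.2 h
  -- As `X` is finite, one level contains all of it.
  choose m hm using fun x => exists_pow_mul_mem hϖ (t x)
  rw [← hlevel (Finset.univ.sup m)]
  refine Finset.sum_congr ?_ fun _ _ => rfl
  refine (Finset.filter_true_of_mem fun x _ => ?_).symm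
  obtain ⟨j, hj⟩ := Nat.exists_eq_add_of_le
    ((Finset.le_sup (f := m) (Finset.mem_univ x)).trans (Nat.le_succ _))
  rw [← Nat.succ_eq_add_one, hj, add_comm, pow_add, mul_assoc]
  exact g.mul_mem _ _ (ϖ ^ j).2 (hm x)

end CharacterSum

end SiegelSeries

namespace SiegelSeries

/-! ### The coefficients of the series as differences of cardinalities -/

section Counting

variable {F K : Type*} [Field F] [CommRing K] [Algebra F K]
  {g : ValuationSubring F} {ρ : K →+* K} {n : ℕ}

theorem mem_herm_iff {X : Matrix (Fin n) (Fin n) K} :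
    X ∈ herm ρ n ↔ ∀ i j, ρ (X j i) = X i j := by
  change adjT ρ X = X ↔ _
  rw [← Matrix.ext_iff]
  rfl

theorem mk_eq_mk_iff {x y : herm ρ n} :
    (QuotientAddGroup.mk x : herm ρ n ⧸ intHerm g ρ n) = QuotientAddGroup.mk y ↔
      ∀ i j, y.1 i j - x.1 i j ∈ maxOrder g K := by
  rw [QuotientAddGroup.eq]
  change (∀ i j, (-x + y : herm ρ n).1 i j ∈ maxOrder g K) ↔ _
  refine forall₂_congr fun i j => ?_
  rw [show (-x + y : herm ρ n).1 i j = y.1 i j - x.1 i j by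
    simp [neg_add_eq_sub]]

theorem out_sub_mem (x : herm ρ n) (i j : Fin n) :
    (QuotientAddGroup.mk x : herm ρ n ⧸ intHerm g ρ n).out.1 i j - x.1 i j ∈ maxOrder g K := by
  refine mk_eq_mk_iff.1 ?_ i j
  exact (Quotient.out_eq _).symm

theorem nu_out (x : herm ρ n) :
    nu g (QuotientAddGroup.mk x : herm ρ n ⧸ intHerm g ρ n).out.1 = nu g x.1 := by
  have : (QuotientAddGroup.mk x : herm ρ n ⧸ intHerm g ρ n).out.1 =
    x.1 + ((QuotientAddGroup.mk x : herm ρ n ⧸ intHerm g ρ n).out.1 - x.1) := by simp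
  rw [nu, this, denomIdeal_add x.1 (_ - x.1) fun i j => out_sub_mem x i j]
  rfl

theorem nu_smul (x : Matrix (Fin n) (Fin n) K) (u : gˣ) : nu g ((u : F) • x) = nu g x := by
  rw [nu, denomIdeal_smul]
  rfl

theorem conj_trace_mul {ζ σ : Matrix (Fin n) (Fin n) K}
    (hζ : ζ ∈ herm ρ n) (hσ : σ ∈ herm ρ n) : ρ (ζ * σ).trace = (ζ * σ).trace := by
  rw [Matrix.trace_mul_comm]
  simp only [Matrix.trace, Matrix.diag, Matrix.mul_apply, map_sum, map_mul]
  rw [Finset.sum_comm]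
  rw [mem_herm_iff] at hζ hσ
  refine Finset.sum_congr rfl fun i _ => Finset.sum_congr rfl fun j _ => ?_
  rw [hσ, hζ, mul_comm]

theorem trace_mul_mem {ζ σ : Matrix (Fin n) (Fin n) K} (hζ : ∀ i j, ζ i j ∈ maxOrder g K)
    (hσ : ∀ i j, σ i j ∈ maxOrder g K) : (ζ * σ).trace ∈ maxOrder g K :=
  sum_mem fun i _ => by
    rw [Matrix.diag_apply, Matrix.mul_apply]
    exact sum_mem fun j _ => mul_mem (hζ i j) (hσ j i)

/-- The number of classes `σ` with `k(σ) = k` and `tr(ζσ) ∈ c + g`. -/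
noncomputable def fiberCount (g : ValuationSubring F) (ρ : K →+* K)
    (ζ : Matrix (Fin n) (Fin n) K) (k : ℕ) (c : F) : ℕ :=
  Nat.card {s : herm ρ n ⧸ intHerm g ρ n //
    nu g s.out.1 = resCard g ^ k ∧ descend (ζ * s.out.1).trace - c ∈ g}

variable {θ : K} {s P : F} (h : IsUnramifiedQuadratic g ρ θ s P)
include h

theorem descend_algebraMap (a : F) : descend (algebraMap F K a) = a :=
  Function.leftInverse_invFun h.algebraMap_injective a

theorem algebraMap_descend_trace {ζ σ : Matrix (Fin n) (Fin n) K}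
    (hζ : ζ ∈ herm ρ n) (hσ : σ ∈ herm ρ n) :
    algebraMap F K (descend (ζ * σ).trace) = (ζ * σ).trace := by
  obtain ⟨a, ha⟩ := h.fixed_iff.1 (conj_trace_mul hζ hσ)
  rw [ha, descend_algebraMap h]

/-- Pairing $\zeta$ with $zE_{ij} + \rho(z)E_{ji}$ gives the trace of $\zeta_{ji}z$, so the choices
$z = 1, \theta$ make off-diagonal entries integral by `mem_maxOrder_of_trace`. The diagonal is
tested with $E_{ii}$. Without a unit discriminant the dual lattice could be larger. -/
theorem mem_dualLattice_iff {ζ : Matrix (Fin n) (Fin n) K} :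
    ζ ∈ dualLattice g ρ n ↔ ζ ∈ herm ρ n ∧ ∀ i j, ζ i j ∈ maxOrder g K := by
  refine and_congr_right fun hζ => ⟨fun hT => ?_, fun hT y hy => ?_⟩
  · have hζ' := mem_herm_iff.1 hζ
    have hint : ∀ y : Matrix (Fin n) (Fin n) K, y ∈ herm ρ n → (∀ i j, y i j ∈ maxOrder g K) →
        (y * ζ).trace ∈ maxOrder g K := by
      intro y hy hy'
      obtain ⟨a, ha, hya⟩ := hT ⟨y, hy⟩ hy'
      change (y * ζ).trace = _ at hya
      rw [hya]
      exact h.algebraMap_mem_maxOrder_iff.2 ha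
    have hoff : ∀ i j, ∀ z ∈ maxOrder g K, i ≠ j → ζ j i * z + ρ (ζ j i * z) ∈ maxOrder g K := by
      intro i j z hz hij
      have h1 := hint (Matrix.single i j z + Matrix.single j i (ρ z)) ?_ ?_
      · convert h1 using 1
        rw [Matrix.add_mul, Matrix.trace_add, Matrix.trace_single_mul, Matrix.trace_single_mul,
          map_mul, hζ']
        simp [mul_comm]
      · rw [mem_herm_iff]
        intro a b
        rw [Matrix.add_apply, Matrix.add_apply, map_add, add_comm]
        congr 1
        · simp only [Matrix.single_apply]
          split_ifs <;> first | (exfalso; tauto) | simp [h.conj_conj]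
        · simp only [Matrix.single_apply]
          split_ifs <;> first | (exfalso; tauto) | simp
      · intro a b
        rw [Matrix.add_apply]
        simp only [Matrix.single_apply]
        refine add_mem ?_ ?_
        · split_ifs
          exacts [hz, zero_mem _]
        · split_ifs
          exacts [h.conj_mem hz, zero_mem _]
    intro i j
    by_cases hij : i = j
    · subst hij
      have h1 := hint (Matrix.single i i 1) ?_ ?_
      · simpa [Matrix.trace_single_mul] using h1
      · rw [mem_herm_iff]
        intro a b
        simp only [Matrix.single_apply]
        split_ifs <;> first | (exfalso; tauto) | simp
      · intro a b
        simp only [Matrix.single_apply]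
        split_ifs
        exacts [one_mem _, zero_mem _]
    · refine h.mem_maxOrder_of_trace ?_ (hoff j i θ h.theta_mem (Ne.symm hij))
      simpa using hoff j i 1 (one_mem _) (Ne.symm hij)
  · refine ⟨descend (y.1 * ζ).trace, ?_, (algebraMap_descend_trace h y.2 hζ).symm⟩
    rw [← h.algebraMap_mem_maxOrder_iff (K := K), algebraMap_descend_trace h y.2 hζ]
    exact trace_mul_mem hy hT

theorem descend_trace_sub_mem {ζ : Matrix (Fin n) (Fin n) K} (hζ : ζ ∈ dualLattice g ρ n)
    {x y : Matrix (Fin n) (Fin n) K} (hx : x ∈ herm ρ n) (hy : y ∈ herm ρ n)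
    (hxy : ∀ i j, x i j - y i j ∈ maxOrder g K) :
    descend (ζ * x).trace - descend (ζ * y).trace ∈ g := by
  obtain ⟨h1, h2⟩ := (mem_dualLattice_iff h).1 hζ
  rw [← h.algebraMap_mem_maxOrder_iff (K := K), map_sub, algebraMap_descend_trace h h1 hx,
    algebraMap_descend_trace h h1 hy, ← Matrix.trace_sub, ← Matrix.mul_sub]
  exact trace_mul_mem h2 hxy

theorem descend_trace_out_sub_mem {ζ : Matrix (Fin n) (Fin n) K} (hζ : ζ ∈ dualLattice g ρ n)
    (x : herm ρ n) :
    descend (ζ * (QuotientAddGroup.mk x : herm ρ n ⧸ intHerm g ρ n).out.1).trace -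
      descend (ζ * x.1).trace ∈ g :=
  descend_trace_sub_mem h hζ (Subtype.mem _) x.2 (out_sub_mem x)

theorem smul_mem_herm (a : F) {x : Matrix (Fin n) (Fin n) K} (hx : x ∈ herm ρ n) :
    a • x ∈ herm ρ n := by
  rw [mem_herm_iff] at hx ⊢
  intro i j
  rw [Matrix.smul_apply, Matrix.smul_apply, Algebra.smul_def, Algebra.smul_def, map_mul,
    h.conj_algebraMap, hx]

theorem descend_trace_smul (a : F) {ζ x : Matrix (Fin n) (Fin n) K} (hζ : ζ ∈ herm ρ n)
    (hx : x ∈ herm ρ n) : descend (ζ * (a • x)).trace = a * descend (ζ * x).trace := by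
  refine h.algebraMap_injective ?_
  rw [algebraMap_descend_trace h hζ (smul_mem_herm h a hx), map_mul,
    algebraMap_descend_trace h hζ hx, Matrix.mul_smul, Matrix.trace_smul, Algebra.smul_def]

/-- Multiplication by a unit of `g` on the classes of hermitian matrices. -/
theorem exists_unit_smul_equiv (u : gˣ) : ∃ e : Equiv.Perm (herm ρ n ⧸ intHerm g ρ n),
    ∀ x : herm ρ n, e (QuotientAddGroup.mk x) =
      QuotientAddGroup.mk ⟨(u : F) • x.1, smul_mem_herm h u x.2⟩ := by
  let f : gˣ → (herm ρ n ⧸ intHerm g ρ n) → (herm ρ n ⧸ intHerm g ρ n) := fun u =>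
    Quotient.map' (fun x => ⟨(u : F) • x.1, smul_mem_herm h u x.2⟩) (by
      intro x y hxy
      refine Quotient.exact' (mk_eq_mk_iff.2 fun i j => ?_)
      have := mk_eq_mk_iff.1 (Quotient.sound' hxy) i j
      simp only [Matrix.smul_apply, ← smul_sub]
      rw [Algebra.smul_def]
      exact mul_mem (h.algebraMap_mem_maxOrder_iff.2 u.1.2) this)
  have hf : ∀ u (x : herm ρ n), f u (QuotientAddGroup.mk x) =
    QuotientAddGroup.mk ⟨(u : F) • x.1, smul_mem_herm h u x.2⟩ := fun u x => rfl
  have hmul : ∀ u v : gˣ, u * v = 1 → ∀ s, f u (f v s) = s := by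
    intro u v huv s
    induction s using QuotientAddGroup.induction_on with
    | H x =>
      rw [hf, hf]
      congr 1
      refine Subtype.ext ?_
      change (u : F) • (v : F) • x.1 = x.1
      rw [smul_smul, show ((u : g) : F) * ((v : g) : F) = 1 from
        congrArg (fun z : gˣ => ((z : g) : F)) huv, one_smul]
  exact ⟨⟨f u, f u⁻¹, hmul _ _ (inv_mul_cancel u), hmul _ _ (mul_inv_cancel u)⟩, hf u⟩

/-- A scalar factor of $\zeta$ moves into the character. For a unit the twisted character still has
conductor $\mathfrak g$, so the choice of generators of the differents will not matter. -/
theorem seriesA_smul {χ : AddChar F Circle} (u : F) {ζ : Matrix (Fin n) (Fin n) K}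
    (hζ : ζ ∈ herm ρ n) : seriesA g ρ χ (u • ζ) = seriesA g ρ (twist χ u) ζ := by
  ext k
  rw [seriesA, seriesA, PowerSeries.coeff_mk, PowerSeries.coeff_mk]
  refine finsum_congr fun x => ?_
  rw [Matrix.smul_mul, ← Matrix.mul_smul, descend_trace_smul h u hζ (Subtype.mem _)]
  rfl

variable [IsDiscreteValuationRing g] [Finite (IsLocalRing.ResidueField g)]

/-- At level $k$ the matrix $\varpi^k\sigma$ is integral, and the residues mod $\varpi^k$ of its
coordinates along $1, \theta$ determine the class of $\sigma$. -/
theorem finite_level (k : ℕ) :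
    Finite {s : herm ρ n ⧸ intHerm g ρ n // nu g s.out.1 = resCard g ^ k} := by
  obtain ⟨ϖ, hϖ⟩ := IsDiscreteValuationRing.exists_irreducible g
  have hfin : Finite (g ⧸ Ideal.span {ϖ ^ k}) := by
    refine Nat.finite_of_card_ne_zero ?_
    rw [(ideal_card_quotient_eq_pow_iff hϖ (Ideal.span {ϖ ^ k}) k).2]
    · exact pow_ne_zero _ Nat.card_pos.ne'
    · intro m
      rw [Ideal.mem_span_singleton, pow_dvd_pow_iff hϖ.ne_zero hϖ.not_isUnit]
  have hrep : ∀ (s : {s : herm ρ n ⧸ intHerm g ρ n // nu g s.out.1 = resCard g ^ k})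
      (i j : Fin n), ∃ ab : g × g, algebraMap F K ((ϖ : F) ^ k) * s.1.out.1 i j =
        algebraMap F K ab.1 + algebraMap F K ab.2 * θ := by
    intro s i j
    have h1 := mul_mem_maxOrder_of_mem_denomIdeal
      (((nu_eq_pow_iff hϖ _ k).1 s.2 k).2 le_rfl) i j
    change algebraMap F K ((ϖ : F) ^ k) * s.1.out.1 i j ∈ maxOrder g K at h1
    obtain ⟨a, b, hab⟩ := h.exists_rep (algebraMap F K ((ϖ : F) ^ k) * s.1.out.1 i j)
    rw [hab, h.rep_mem_maxOrder_iff] at h1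
    exact ⟨(⟨a, h1.1⟩, ⟨b, h1.2⟩), hab⟩
  choose f hf using hrep
  refine Finite.of_injective (β := Fin n → Fin n →
    (g ⧸ Ideal.span {ϖ ^ k}) × (g ⧸ Ideal.span {ϖ ^ k}))
    (fun s i j => (Ideal.Quotient.mk _ (f s i j).1, Ideal.Quotient.mk _ (f s i j).2)) ?_
  intro s s' hss
  refine Subtype.ext ?_
  rw [← Quotient.out_eq s.1, ← Quotient.out_eq s'.1]
  refine mk_eq_mk_iff.2 fun i j => ?_
  have h1 := congrFun (congrFun hss i) j
  rw [Prod.mk.injEq, Ideal.Quotient.eq, Ideal.Quotient.eq, Ideal.mem_span_singleton,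
    Ideal.mem_span_singleton] at h1
  obtain ⟨⟨a, ha⟩, b, hb⟩ := h1
  have ha' : ((f s i j).1 : F) - (f s' i j).1 = (ϖ : F) ^ k * a := congrArg Subtype.val ha
  have hb' : ((f s i j).2 : F) - (f s' i j).2 = (ϖ : F) ^ k * b := congrArg Subtype.val hb
  have hu : IsUnit (algebraMap F K ((ϖ : F) ^ k)) :=
    (IsUnit.mk0 _ (pow_ne_zero _ (uniformizer_ne_zero hϖ))).map _
  have h2 : s'.1.out.1 i j - s.1.out.1 i j =
      algebraMap F K ((-a : g) : F) + algebraMap F K ((-b : g) : F) * θ := by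
    refine hu.mul_left_cancel ?_
    have ha2 := congrArg (algebraMap F K) ha'
    have hb2 := congrArg (algebraMap F K) hb'
    simp only [map_sub, map_mul] at ha2 hb2
    rw [mul_sub, hf, hf]
    rw [NegMemClass.coe_neg, NegMemClass.coe_neg, map_neg, map_neg]
    linear_combination -ha2 - θ * hb2
  rw [h2, h.rep_mem_maxOrder_iff]
  exact ⟨(-a).2, (-b).2⟩

/-- Scaling by units preserves the level and multiplies $\mathrm{tr}(\zeta\sigma)$ by the unit, so
`sum_char_eq_card_sub_card` applies. The right-hand side no longer involves $\chi$. -/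
theorem coeff_seriesA {χ : AddChar F Circle} (hχ : HasConductorOne g χ)
    {ζ : Matrix (Fin n) (Fin n) K} (hζ : ζ ∈ dualLattice g ρ n) {ϖ : g} (hϖ : Irreducible ϖ)
    (k : ℕ) : PowerSeries.coeff k (seriesA g ρ χ ζ) =
      (fiberCount g ρ ζ k 0 : ℂ) - fiberCount g ρ ζ k (ϖ : F)⁻¹ := by
  have hfin := finite_level (n := n) h k
  have := Fintype.ofFinite {s : herm ρ n ⧸ intHerm g ρ n // nu g s.out.1 = resCard g ^ k}
  have hcount : ∀ c : F, fiberCount g ρ ζ k c =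
      Nat.card {x : {s : herm ρ n ⧸ intHerm g ρ n // nu g s.out.1 = resCard g ^ k} //
        descend (ζ * x.1.out.1).trace - c ∈ g} := fun c =>
    (Nat.card_congr (Equiv.subtypeSubtypeEquivSubtypeInter
      (fun s : herm ρ n ⧸ intHerm g ρ n => nu g s.out.1 = resCard g ^ k)
      (fun s => descend (ζ * s.out.1).trace - c ∈ g))).symm
  rw [seriesA, PowerSeries.coeff_mk, finsum_eq_sum_of_fintype, hcount, hcount]
  rw [sum_char_eq_card_sub_card hϖ ?_ hχ]
  · simp
  · intro u
    obtain ⟨e, he⟩ := exists_unit_smul_equiv (n := n) h u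
    have hout : ∀ s, e s = QuotientAddGroup.mk ⟨(u : F) • s.out.1, smul_mem_herm h u s.out.2⟩ :=
      fun s => by
        conv_lhs => rw [← Quotient.out_eq s]
        exact he _
    refine ⟨e.subtypePerm fun s => ?_, fun x => ?_⟩
    · rw [hout, nu_out, nu_smul]
    · have h1 := descend_trace_out_sub_mem h hζ
        ⟨(u : F) • x.1.out.1, smul_mem_herm h u x.1.out.2⟩
      rw [← hout, descend_trace_smul h _ ((mem_dualLattice_iff h).1 hζ).1 (Subtype.mem _)] at h1
      exact h1

end Counting

end SiegelSeries

namespace SiegelSeries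

/-! ### Cyclic base change of prime degree -/

/-- `φ : F → F'` is an unramified extension of discretely valued fields (`ϖ` is a uniformizer of
both) with an automorphism `γ` of `F'` over `F`, of order dividing `p`, such that the elements of
`F'` and of `F' / g'` that are fixed by `γ` come from `F`. -/
structure IsCyclicBaseChange {F F' : Type*} [Field F] [Field F'] (p : ℕ)
    (g : ValuationSubring F) (g' : ValuationSubring F') (φ : F →+* F') (γ : F' →+* F')
    (ϖ : g) (ϖ' : g') : Prop where
  irreducible : Irreducible ϖ
  irreducible' : Irreducible ϖ'
  map_uniformizer : φ ϖ = ϖ'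
  mem_iff : ∀ a, φ a ∈ g' ↔ a ∈ g
  apply_map : ∀ a, γ (φ a) = φ a
  iterate_apply : ∀ x, γ^[p] x = x
  map_mem : ∀ x ∈ g', γ x ∈ g'
  exists_of_fixed : ∀ x, γ x = x → ∃ y, x = φ y
  exists_of_sub_mem : ∀ x, γ x - x ∈ g' → ∃ y, x - φ y ∈ g'

section

variable {F F' : Type*} [Field F] [Field F'] {p : ℕ} {g : ValuationSubring F}
  {g' : ValuationSubring F'} {φ : F →+* F'} {γ : F' →+* F'} {ϖ : g} {ϖ' : g'}

namespace IsCyclicBaseChange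

/-- $\gamma$ acts on the residue field of $\mathfrak g'$ with $\gamma^p = 1$ and fixed points the
residue field of $\mathfrak g$; the nontrivial orbits have length $p$. -/
theorem card_residueField_modEq [Fact p.Prime] [IsDiscreteValuationRing g]
    [IsDiscreteValuationRing g'] [Finite (IsLocalRing.ResidueField g')]
    (B : IsCyclicBaseChange p g g' φ γ ϖ ϖ') : resCard g' ≡ resCard g [MOD p] := by
  classical
  let φg : g →+* g' := φ.restrict g g' fun a ha => (B.mem_iff a).2 ha
  let γg : g' →+* g' := γ.restrict g' g' B.map_mem
  have hφϖ : φg ϖ = ϖ' := Subtype.ext B.map_uniformizer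
  have hγϖ : γg ϖ' = ϖ' := by
    refine Subtype.ext ?_
    change γ ϖ' = ϖ'
    rw [← B.map_uniformizer, B.apply_map]
  let φk : g ⧸ IsLocalRing.maximalIdeal g →+* g' ⧸ IsLocalRing.maximalIdeal g' :=
    Ideal.quotientMap _ φg (by
      rw [B.irreducible.maximalIdeal_eq, B.irreducible'.maximalIdeal_eq,
        Ideal.span_singleton_le_iff_mem, Ideal.mem_comap, hφϖ]
      exact Ideal.mem_span_singleton_self _)
  let γk : g' ⧸ IsLocalRing.maximalIdeal g' →+* g' ⧸ IsLocalRing.maximalIdeal g' :=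
    Ideal.quotientMap _ γg (by
      rw [B.irreducible'.maximalIdeal_eq,
        Ideal.span_singleton_le_iff_mem, Ideal.mem_comap, hγϖ]
      exact Ideal.mem_span_singleton_self _)
  have hfin : Finite (g' ⧸ IsLocalRing.maximalIdeal g') :=
    inferInstanceAs (Finite (IsLocalRing.ResidueField g'))
  have := Fintype.ofFinite (g' ⧸ IsLocalRing.maximalIdeal g')
  let f : Function.End (g' ⧸ IsLocalRing.maximalIdeal g') := fun x => γk x
  have hit : ∀ (k : ℕ) (b : g'), (f ^ k) (Ideal.Quotient.mk _ b) =
      Ideal.Quotient.mk _ (γg^[k] b) := by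
    intro k
    induction k with
    | zero => intro b; rfl
    | succ k ih =>
      intro b
      rw [pow_succ, Function.iterate_succ_apply]
      exact ih (γg b)
  have hγg : ∀ (k : ℕ) (b : g'), ((γg^[k] b : g') : F') = γ^[k] b := by
    intro k
    induction k with
    | zero => intro b; rfl
    | succ k ih =>
      intro b
      rw [Function.iterate_succ_apply, Function.iterate_succ_apply, ih]
      rfl
  -- The exponent `p ^ 1` is the form that `Equiv.Perm.card_fixedPoints_modEq` takes.
  have hf : f ^ p ^ 1 = 1 := by
    funext x
    obtain ⟨b, rfl⟩ := Ideal.Quotient.mk_surjective x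
    rw [pow_one, hit]
    change _ = Ideal.Quotient.mk _ b
    congr 1
    exact Subtype.ext (by rw [hγg, B.iterate_apply])
  have hcard := Equiv.Perm.card_fixedPoints_modEq hf
  have hfix : Nat.card (g ⧸ IsLocalRing.maximalIdeal g) = Nat.card (Function.fixedPoints f) := by
    refine Nat.card_congr (Equiv.ofBijective (fun x => ⟨φk x, ?_⟩) ⟨?_, ?_⟩)
    · obtain ⟨b, rfl⟩ := Ideal.Quotient.mk_surjective x
      change Ideal.Quotient.mk _ (γg (φg b)) = Ideal.Quotient.mk _ (φg b)
      congr 1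
      exact Subtype.ext (B.apply_map b)
    · intro x y hxy
      have hinj : Function.Injective φk := by
        let := Ideal.Quotient.field (IsLocalRing.maximalIdeal g)
        have := IsLocalRing.maximalIdeal.isMaximal g'
        exact φk.injective
      exact hinj (congrArg Subtype.val hxy)
    · rintro ⟨x, hx⟩
      obtain ⟨b, rfl⟩ := Ideal.Quotient.mk_surjective x
      have hx' : Ideal.Quotient.mk _ (γg b) = Ideal.Quotient.mk (IsLocalRing.maximalIdeal g') b :=
        hx
      have h0 := uniformizer_ne_zero B.irreducible'
      rw [Ideal.Quotient.eq, B.irreducible'.maximalIdeal_eq, Ideal.mem_span_singleton] at hx'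
      obtain ⟨c, hc⟩ := hx'
      have hc' : γ b - b = ϖ' * c := congrArg Subtype.val hc
      have hγϖ' : γ ϖ' = ϖ' := congrArg Subtype.val hγϖ
      -- Dividing by the uniformizer turns a fixed class mod $\varpi'$ into a fixed class mod
      -- $\mathfrak g'$; then $\varpi y$ lifts the residue.
      obtain ⟨y, hy⟩ := B.exists_of_sub_mem (b / ϖ') (by
        rw [map_div₀, hγϖ', ← sub_div, hc', mul_div_cancel_left₀ _ h0]
        exact c.2)
      have hy2 : (b : F') - φ (ϖ * y) = ϖ' * (b / ϖ' - φ y) := by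
        rw [map_mul, B.map_uniformizer]
        field_simp
      have hy3 : ϖ * y ∈ g := by
        rw [← B.mem_iff]
        have := sub_mem b.2 (g'.mul_mem _ _ ϖ'.2 hy)
        rw [← hy2] at this
        simpa using this
      refine ⟨Ideal.Quotient.mk _ ⟨_, hy3⟩, Subtype.ext ?_⟩
      change Ideal.Quotient.mk _ (φg ⟨_, hy3⟩) = Ideal.Quotient.mk _ b
      symm
      rw [Ideal.Quotient.eq, B.irreducible'.maximalIdeal_eq, Ideal.mem_span_singleton]
      exact ⟨⟨_, hy⟩, Subtype.ext hy2⟩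
  rw [← Nat.card_eq_fintype_card, ← Nat.card_eq_fintype_card, ← hfix] at hcard
  exact hcard

end IsCyclicBaseChange

variable {K K' : Type*} [CommRing K] [Algebra F K] [CommRing K'] [Algebra F' K']
  {ρ : K →+* K} {ρ' : K' →+* K'} {θ : K} {s P : F} {ψ : K →+* K'}

/-- The quadratic equation of $\theta'$ has $\gamma$-fixed coefficients, so letting $\gamma$ act on
coordinates is multiplicative. -/
theorem IsUnramifiedQuadratic.exists_extend {θ' : K'} {s' P' : F'}
    (h' : IsUnramifiedQuadratic g' ρ' θ' s' P') (hs : γ s' = s') (hP : γ P' = P') :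
    ∃ γK : K' →+* K', ∀ a b, γK (algebraMap F' K' a + algebraMap F' K' b * θ') =
      algebraMap F' K' (γ a) + algebraMap F' K' (γ b) * θ' := by
  let m : QuadraticAlgebra F' (-P') s' →+* QuadraticAlgebra F' (-P') s' :=
    { toFun := fun z => ⟨γ z.re, γ z.im⟩
      map_one' := by ext <;> simp [QuadraticAlgebra.re_one, QuadraticAlgebra.im_one]
      map_zero' := by ext <;> simp
      map_add' := fun x y => by ext <;> simp
      map_mul' := fun x y => by ext <;> simp [hs, hP] }
  refine ⟨(h'.coordEquiv.toRingEquiv.toRingHom.comp m).comp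
    h'.coordEquiv.symm.toRingEquiv.toRingHom, fun a b => ?_⟩
  have h1 := h'.coordEquiv_apply ⟨a, b⟩
  have h2 := h'.coordEquiv_apply ⟨γ a, γ b⟩
  rw [← h1, ← h2]
  change h'.coordEquiv (m (h'.coordEquiv.symm (h'.coordEquiv ⟨a, b⟩))) = _
  rw [AlgEquiv.symm_apply_apply]
  rfl

/-- The quadratic form is the norm $x\rho(x)$ of $x = a + b\theta$. If it is anisotropic,
$\rho(x)/N(x)$ inverts $x$. -/
theorem IsUnramifiedQuadratic.isField_iff (h : IsUnramifiedQuadratic g ρ θ s P) :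
    IsField K ↔ ∀ a b : F, a * a + a * b * s + b * b * P = 0 → a = 0 ∧ b = 0 := by
  have hnorm : ∀ a b : F, (algebraMap F K a + algebraMap F K b * θ) *
      ρ (algebraMap F K a + algebraMap F K b * θ) =
        algebraMap F K (a * a + a * b * s + b * b * P) := by
    intro a b
    rw [h.conj_rep]
    simp only [map_add, map_mul, map_neg]
    linear_combination -(algebraMap F K b * algebraMap F K b) * h.theta_sq
  constructor
  · intro hK a b hab
    let := hK.toField
    have h1 := hnorm a b
    rw [hab, map_zero] at h1
    have h2 : algebraMap F K a + algebraMap F K b * θ = 0 := by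
      rcases mul_eq_zero.1 h1 with h2 | h2
      · exact h2
      · have := congrArg ρ h2
        rwa [h.conj_conj, map_zero] at this
    refine h.rep_inj (a' := 0) (b' := 0) ?_
    simpa using h2
  · intro hN
    have hnt : Nontrivial K := h.algebraMap_injective.nontrivial
    refine ⟨exists_pair_ne K, mul_comm, fun {x} hx => ?_⟩
    obtain ⟨a, b, rfl⟩ := h.exists_rep x
    have h0 : a * a + a * b * s + b * b * P ≠ 0 := by
      intro h1
      obtain ⟨rfl, rfl⟩ := hN a b h1
      simp at hx
    refine ⟨ρ (algebraMap F K a + algebraMap F K b * θ) *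
      algebraMap F K (a * a + a * b * s + b * b * P)⁻¹, ?_⟩
    rw [← mul_assoc, hnorm, ← map_mul, mul_inv_cancel₀ h0, map_one]

/-- An isotropic vector over $F'$ gives a root $r$ of $T^2 + sT + P$. Since $\gamma$ permutes the
two roots, $\gamma^2 r = r$; with $\gamma^p r = r$ and $p$ odd this gives $\gamma r = r$, so $r$
comes from $F$. -/
theorem IsCyclicBaseChange.isField_iff (B : IsCyclicBaseChange p g g' φ γ ϖ ϖ') (hp : Odd p)
    (h : IsUnramifiedQuadratic g ρ θ s P)
    (h' : IsUnramifiedQuadratic g' ρ' (ψ θ) (φ s) (φ P)) : IsField K ↔ IsField K' := by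
  rw [h.isField_iff, h'.isField_iff]
  constructor
  · intro hN a b hab
    by_contra hne
    have hb : b ≠ 0 := by
      rintro rfl
      refine hne ⟨?_, rfl⟩
      simpa using hab
    set r : F' := a / b with hr
    have hroot : r * r + r * φ s + φ P = 0 := by
      rw [hr]
      field_simp
      linear_combination hab
    have hγroot : γ r * γ r + γ r * φ s + φ P = 0 := by
      have := congrArg γ hroot
      simpa [B.apply_map] using this
    have h2 : γ (γ r) = r := by
      have : (γ r - r) * (γ r + r + φ s) = 0 := by linear_combination hγroot - hroot
      rcases mul_eq_zero.1 this with h1 | h1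
      · rw [sub_eq_zero.1 h1, sub_eq_zero.1 h1]
      · have h3 : γ r = - r - φ s := by linear_combination h1
        have h4 := congrArg γ h3
        rw [map_sub, map_neg, B.apply_map] at h4
        rw [h4, h3]
        ring
    have hfix : γ r = r := by
      obtain ⟨k, rfl⟩ := hp
      have h3 := B.iterate_apply r
      rw [Function.iterate_add_apply γ (2 * k) 1, Function.iterate_one,
        ← Function.iterate_succ_apply, Function.iterate_succ_apply', Function.iterate_mul,
        Function.iterate_fixed (f := γ^[2]) h2] at h3
      exact h3
    obtain ⟨y, hy⟩ := B.exists_of_fixed r hfix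
    have := hN y 1 (by
      refine φ.injective ?_
      rw [hy] at hroot
      simpa using hroot)
    exact one_ne_zero this.2
  · intro hN a b hab
    have := hN (φ a) (φ b) (by rw [← map_zero φ, ← hab]; simp)
    simpa using this

theorem IsCyclicBaseChange.tau_eq (B : IsCyclicBaseChange p g g' φ γ ϖ ϖ') (hp : Odd p)
    (h : IsUnramifiedQuadratic g ρ θ s P)
    (h' : IsUnramifiedQuadratic g' ρ' (ψ θ) (φ s) (φ P)) (i : ℕ) :
    tau g' K' i = tau g K i := by
  rw [tau, tau, B.isField_iff hp h h', if_pos h.differentTrivial, if_pos h'.differentTrivial]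

/-! ### Congruence of the fibre counts -/

section Counts

variable (h : IsUnramifiedQuadratic g ρ θ s P)
  (h' : IsUnramifiedQuadratic g' ρ' (ψ θ) (φ s) (φ P))
  (hψ : ∀ a, ψ (algebraMap F K a) = algebraMap F' K' (φ a))
include h h' hψ

theorem IsUnramifiedQuadratic.conj_map (x : K) : ρ' (ψ x) = ψ (ρ x) := by
  obtain ⟨a, b, rfl⟩ := h.exists_rep x
  rw [h.conj_rep]
  simp only [map_add ψ, map_mul ψ, hψ]
  rw [h'.conj_rep]
  simp only [map_add, map_mul, map_neg]

theorem IsUnramifiedQuadratic.map_injective : Function.Injective ψ := by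
  rw [injective_iff_map_eq_zero]
  intro x hx
  obtain ⟨a, b, rfl⟩ := h.exists_rep x
  simp only [map_add, map_mul, hψ] at hx
  have := h'.rep_inj (a' := 0) (b' := 0) (by simpa using hx)
  simp only [map_eq_zero] at this
  simp [this.1, this.2]

theorem IsUnramifiedQuadratic.map_mem_herm_iff {n : ℕ} {x : Matrix (Fin n) (Fin n) K} :
    x.map ψ ∈ herm ρ' n ↔ x ∈ herm ρ n := by
  simp only [mem_herm_iff, Matrix.map_apply, h.conj_map h' hψ]
  exact forall₂_congr fun i j => (h.map_injective h' hψ).eq_iff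

theorem IsUnramifiedQuadratic.descend_trace_map {n : ℕ} {ζ x : Matrix (Fin n) (Fin n) K}
    (hζ : ζ ∈ herm ρ n) (hx : x ∈ herm ρ n) :
    descend (ζ.map ψ * x.map ψ).trace = φ (descend (ζ * x).trace) := by
  refine h'.algebraMap_injective ?_
  rw [algebraMap_descend_trace h' ((h.map_mem_herm_iff h' hψ).2 hζ)
    ((h.map_mem_herm_iff h' hψ).2 hx), ← hψ, algebraMap_descend_trace h hζ hx,
    ← Matrix.map_mul, Matrix.trace, Matrix.trace, map_sum]
  rfl

variable (B : IsCyclicBaseChange p g g' φ γ ϖ ϖ')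
include B

theorem IsCyclicBaseChange.map_mem_maxOrder_iff (x : K) :
    ψ x ∈ maxOrder g' K' ↔ x ∈ maxOrder g K := by
  obtain ⟨a, b, rfl⟩ := h.exists_rep x
  rw [h.rep_mem_maxOrder_iff]
  simp only [map_add, map_mul, hψ]
  rw [h'.rep_mem_maxOrder_iff, B.mem_iff, B.mem_iff]

theorem IsCyclicBaseChange.map_mem_dualLattice_iff {n : ℕ} {ζ : Matrix (Fin n) (Fin n) K} :
    ζ.map ψ ∈ dualLattice g' ρ' n ↔ ζ ∈ dualLattice g ρ n := by
  rw [mem_dualLattice_iff h, mem_dualLattice_iff h', h.map_mem_herm_iff h' hψ]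
  simp only [Matrix.map_apply, B.map_mem_maxOrder_iff h h' hψ]

/-- One reduced fraction $d^{-1}c$ computes both denominator ideals, and $\varpi$ stays a
uniformizer. Whether $\varpi^m$ lies in the ideal is the integrality of $\varpi^m/\det d$, which
$\psi$ preserves and reflects. -/
theorem IsCyclicBaseChange.nu_map_eq_pow_iff [IsDiscreteValuationRing g]
    [IsDiscreteValuationRing g'] [Finite (IsLocalRing.ResidueField g)]
    [Finite (IsLocalRing.ResidueField g')] {n : ℕ} {x : Matrix (Fin n) (Fin n) K}
    (hx : ∃ c d, IsReducedFraction g x c d) (k : ℕ) :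
    nu g' (x.map ψ) = resCard g' ^ k ↔ nu g x = resCard g ^ k := by
  have hmax := fun z hz => (B.map_mem_maxOrder_iff h h' hψ z).2 hz
  rw [nu_eq_pow_iff B.irreducible, nu_eq_pow_iff B.irreducible']
  obtain ⟨c, d, hcd⟩ := hx
  refine forall_congr' fun m => iff_congr ?_ Iff.rfl
  rw [hcd.denomIdeal_eq, (hcd.map ψ hmax).denomIdeal_eq, ← RingHom.mapMatrix_apply,
    ← RingHom.map_det, Ideal.mem_span_singleton', Ideal.mem_span_singleton']
  have hdu : IsUnit (d.det : K) := by
    have := hcd.1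
    rwa [← RingHom.mapMatrix_apply, ← RingHom.map_det] at this
  have hpi : ((algebraMap g' (maxOrder g' K') (ϖ' ^ m) : maxOrder g' K') : K') =
      ψ (algebraMap F K ((ϖ : F) ^ m)) := by
    rw [hψ, map_pow φ, B.map_uniformizer]
    rfl
  constructor
  · rintro ⟨a, ha⟩
    obtain ⟨v, hv⟩ := hdu
    have h1 : (a : K') = ψ (algebraMap F K ((ϖ : F) ^ m) * (↑v⁻¹ : K)) := by
      have h2 : (a : K') * ψ v = ψ (algebraMap F K ((ϖ : F) ^ m)) := by
        rw [← hpi, ← ha, hv]; rfl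
      rw [map_mul, ← h2, mul_assoc, ← map_mul, v.mul_inv, map_one, mul_one]
    have h3 := a.2
    rw [h1, B.map_mem_maxOrder_iff h h' hψ] at h3
    refine ⟨⟨_, h3⟩, Subtype.ext ?_⟩
    change algebraMap F K ((ϖ : F) ^ m) * (↑v⁻¹ : K) * (d.det : K) = _
    rw [← hv, mul_assoc, v.inv_mul, mul_one]
    rfl
  · rintro ⟨a, ha⟩
    refine ⟨maxOrderMap ψ hmax a, Subtype.ext ?_⟩
    rw [hpi]
    change ψ a * ψ d.det = _
    rw [← map_mul]
    congr 1
    exact congrArg Subtype.val ha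

/-- A class of hermitian matrices over `K'` that is fixed by `γ` comes from `K`. -/
theorem IsCyclicBaseChange.exists_herm_sub_mem {γK : K' →+* K'}
    (hγK : ∀ a b, γK (algebraMap F' K' a + algebraMap F' K' b * ψ θ) =
      algebraMap F' K' (γ a) + algebraMap F' K' (γ b) * ψ θ)
    {n : ℕ} {x : Matrix (Fin n) (Fin n) K'} (hx : x ∈ herm ρ' n)
    (hfix : ∀ i j, γK (x i j) - x i j ∈ maxOrder g' K') :
    ∃ y : herm ρ n, ∀ i j, x i j - ψ (y.1 i j) ∈ maxOrder g' K' := by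
  rw [mem_herm_iff] at hx
  -- The coordinates along $1$ and $\theta$ are approximated separately. A diagonal entry has no
  -- $\theta$-coordinate, so its approximation can be taken in $F$.
  have hcoord : ∀ i j, ∃ y : K, x i j - ψ y ∈ maxOrder g' K' ∧ (i = j → ρ y = y) := by
    intro i j
    obtain ⟨a, b, hab⟩ := h'.exists_rep (x i j)
    have h1 := hfix i j
    rw [hab, hγK, show algebraMap F' K' (γ a) + algebraMap F' K' (γ b) * ψ θ -
      (algebraMap F' K' a + algebraMap F' K' b * ψ θ) =
      algebraMap F' K' (γ a - a) + algebraMap F' K' (γ b - b) * ψ θ by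
        simp only [map_sub]; ring, h'.rep_mem_maxOrder_iff] at h1
    obtain ⟨ya, hya⟩ := B.exists_of_sub_mem a h1.1
    by_cases hij : i = j
    · refine ⟨algebraMap F K ya, ?_, fun _ => h.conj_algebraMap ya⟩
      subst hij
      obtain ⟨a', ha'⟩ := h'.fixed_iff.1 (hx i i)
      obtain ⟨rfl, rfl⟩ := h'.rep_inj (a := a) (b := b) (a' := a') (b' := 0)
        (by rw [← hab, ha']; simp)
      rw [ha', hψ, ← map_sub, h'.algebraMap_mem_maxOrder_iff]
      exact hya
    · obtain ⟨yb, hyb⟩ := B.exists_of_sub_mem b h1.2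
      refine ⟨algebraMap F K ya + algebraMap F K yb * θ, ?_, fun h => absurd h hij⟩
      rw [hab, map_add, map_mul, hψ, hψ, show algebraMap F' K' a + algebraMap F' K' b * ψ θ -
        (algebraMap F' K' (φ ya) + algebraMap F' K' (φ yb) * ψ θ) =
        algebraMap F' K' (a - φ ya) + algebraMap F' K' (b - φ yb) * ψ θ by
          simp only [map_sub]; ring, h'.rep_mem_maxOrder_iff]
      exact ⟨hya, hyb⟩
  choose y hy hdiag using hcoord
  -- Only the approximations on and above the diagonal are kept; conjugates fill the lower half, so
  -- that the matrix is hermitian.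
  refine ⟨⟨Matrix.of fun i j => if i ≤ j then y i j else ρ (y j i), ?_⟩, fun i j => ?_⟩
  · rw [mem_herm_iff]
    intro i j
    simp only [Matrix.of_apply]
    rcases lt_trichotomy i j with hij | rfl | hij
    · rw [if_neg (not_le.2 hij), if_pos hij.le, h.conj_conj]
    · rw [if_pos le_rfl, hdiag i i rfl]
    · rw [if_pos hij.le, if_neg (not_le.2 hij)]
  · simp only [Matrix.of_apply]
    split_ifs with hij
    · exact hy i j
    · rw [← h.conj_map h' hψ, ← hx i j, ← map_sub]
      exact h'.conj_mem (hy j i)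

/-- $\gamma$ acts on the finite fibre over $F'$ with $\gamma^p = 1$, so its cardinality is congruent
mod $p$ to the number of fixed points. These are the images of the classes in the fibre over $F$. -/
theorem IsCyclicBaseChange.fiberCount_modEq [Fact p.Prime] [IsDiscreteValuationRing g]
    [IsDiscreteValuationRing g'] [Finite (IsLocalRing.ResidueField g)]
    [Finite (IsLocalRing.ResidueField g')] {n : ℕ}
    (hfrac : ∀ x : Matrix (Fin n) (Fin n) K, ∃ c d, IsReducedFraction g x c d)
    {ζ : Matrix (Fin n) (Fin n) K} (hζ : ζ ∈ dualLattice g ρ n) (k : ℕ) (c : F) :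
    fiberCount g' ρ' (ζ.map ψ) k (φ c) ≡ fiberCount g ρ ζ k c [MOD p] := by
  classical
  obtain ⟨γK, hγK⟩ := h'.exists_extend (γ := γ) (B.apply_map s) (B.apply_map P)
  have hζ' := (B.map_mem_dualLattice_iff h h' hψ).2 hζ
  have hζh := ((mem_dualLattice_iff h).1 hζ).1
  have hζh' := ((mem_dualLattice_iff h').1 hζ').1
  have hγψ : ∀ x, γK (ψ x) = ψ x := by
    intro x
    obtain ⟨a, b, rfl⟩ := h.exists_rep x
    simp only [map_add ψ, map_mul ψ, hψ]
    rw [hγK, B.apply_map, B.apply_map]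
  have hγalg : ∀ a, γK (algebraMap F' K' a) = algebraMap F' K' (γ a) := by
    intro a
    simpa using hγK a 0
  have hγconj : ∀ x, ρ' (γK x) = γK (ρ' x) := by
    intro x
    obtain ⟨a, b, rfl⟩ := h'.exists_rep x
    rw [hγK, h'.conj_rep, h'.conj_rep, hγK]
    simp [B.apply_map]
  have hγmax : ∀ x ∈ maxOrder g' K', γK x ∈ maxOrder g' K' := by
    intro x hx
    obtain ⟨a, b, rfl⟩ := h'.exists_rep x
    rw [h'.rep_mem_maxOrder_iff] at hx
    rw [hγK, h'.rep_mem_maxOrder_iff]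
    exact ⟨B.map_mem _ hx.1, B.map_mem _ hx.2⟩
  have hγit : ∀ x, γK^[p] x = x := by
    intro x
    obtain ⟨a, b, rfl⟩ := h'.exists_rep x
    have : ∀ (k : ℕ) a b, γK^[k] (algebraMap F' K' a + algebraMap F' K' b * ψ θ) =
        algebraMap F' K' (γ^[k] a) + algebraMap F' K' (γ^[k] b) * ψ θ := by
      intro k
      induction k with
      | zero => intro a b; rfl
      | succ k ih =>
        intro a b
        simp only [Function.iterate_succ_apply, hγK, ih]
    rw [this, B.iterate_apply, B.iterate_apply]
  have hγherm : ∀ x : Matrix (Fin n) (Fin n) K', x ∈ herm ρ' n → x.map γK ∈ herm ρ' n := by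
    intro x hx
    rw [mem_herm_iff] at hx ⊢
    intro i j
    rw [Matrix.map_apply, Matrix.map_apply, hγconj, hx]
  have hγdenom : ∀ (x : Matrix (Fin n) (Fin n) K') (m : ℕ),
      algebraMap g' (maxOrder g' K') (ϖ' ^ m) ∈ denomIdeal g' x →
      algebraMap g' (maxOrder g' K') (ϖ' ^ m) ∈ denomIdeal g' (x.map γK) := by
    intro x m hx
    have := map_mem_denomIdeal γK hγmax hx
    convert this using 1
    refine Subtype.ext ?_
    change algebraMap F' K' ((ϖ' : F') ^ m) = γK (algebraMap F' K' ((ϖ' : F') ^ m))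
    rw [← B.map_uniformizer, ← map_pow, ← hψ, hγψ]
  -- The converse needs no inverse of $\gamma$: applying it $p - 1$ more times leads back to $x$.
  have hγdenom' : ∀ (x : Matrix (Fin n) (Fin n) K') (m : ℕ),
      algebraMap g' (maxOrder g' K') (ϖ' ^ m) ∈ denomIdeal g' (x.map γK) ↔
      algebraMap g' (maxOrder g' K') (ϖ' ^ m) ∈ denomIdeal g' x := by
    intro x m
    refine ⟨fun hx => ?_, hγdenom x m⟩
    have hit : ∀ i : ℕ, algebraMap g' (maxOrder g' K') (ϖ' ^ m) ∈
        denomIdeal g' (x.map γK^[i + 1]) := by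
      intro i
      induction i with
      | zero => exact hx
      | succ i ih =>
        have := hγdenom _ m ih
        rw [Matrix.map_map] at this
        rwa [Function.iterate_succ']
    have hp := hit (p - 1)
    rwa [Nat.sub_add_cancel (Fact.out : p.Prime).one_le, show γK^[p] = id from funext hγit,
      Matrix.map_id] at hp
  have hγnu : ∀ x : Matrix (Fin n) (Fin n) K', nu g' (x.map γK) = resCard g' ^ k ↔
      nu g' x = resCard g' ^ k := by
    intro x
    rw [nu_eq_pow_iff B.irreducible', nu_eq_pow_iff B.irreducible']
    exact forall_congr' fun m => iff_congr (hγdenom' x m) Iff.rfl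
  -- The image of $\zeta$ is $\gamma$-fixed, so the trace pairing with it is equivariant; as
  -- $\varphi(c)$ is fixed too, $\gamma$ preserves the fibre.
  have hγtr : ∀ x : Matrix (Fin n) (Fin n) K', x ∈ herm ρ' n →
      descend (ζ.map ψ * x.map γK).trace = γ (descend (ζ.map ψ * x).trace) := by
    intro x hx
    refine h'.algebraMap_injective ?_
    rw [algebraMap_descend_trace h' hζh' (hγherm x hx), ← hγalg,
      algebraMap_descend_trace h' hζh' hx]
    have : ζ.map ψ * x.map γK = (ζ.map ψ * x).map γK := by
      rw [Matrix.map_mul]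
      congr 1
      ext i j
      exact (hγψ _).symm
    rw [this, Matrix.trace, Matrix.trace, map_sum]
    rfl
  -- membership in the fibre, in terms of a representative
  have hpred' : ∀ x : herm ρ' n,
      (nu g' (QuotientAddGroup.mk x : herm ρ' n ⧸ intHerm g' ρ' n).out.1 = resCard g' ^ k ∧
        descend (ζ.map ψ * (QuotientAddGroup.mk x : herm ρ' n ⧸ intHerm g' ρ' n).out.1).trace -
          φ c ∈ g') ↔
      (nu g' x.1 = resCard g' ^ k ∧ descend (ζ.map ψ * x.1).trace - φ c ∈ g') := by
    intro x
    rw [nu_out]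
    have h1 := descend_trace_out_sub_mem h' hζ' x
    refine and_congr_right fun _ => ⟨fun h2 => ?_, fun h2 => ?_⟩
    · have := sub_mem h2 h1
      convert this using 1; ring
    · have := add_mem h2 h1
      convert this using 1; ring
  let Γ : herm ρ' n ⧸ intHerm g' ρ' n → herm ρ' n ⧸ intHerm g' ρ' n :=
    Quotient.map' (fun x => ⟨x.1.map γK, hγherm x.1 x.2⟩) (by
      intro x y hxy
      refine Quotient.exact' (mk_eq_mk_iff.2 fun i j => ?_)
      have := mk_eq_mk_iff.1 (Quotient.sound' hxy) i j
      simp only [Matrix.map_apply, ← map_sub]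
      exact hγmax _ this)
  have hΓ : ∀ x : herm ρ' n, Γ (QuotientAddGroup.mk x) =
    QuotientAddGroup.mk ⟨x.1.map γK, hγherm x.1 x.2⟩ := fun x => rfl
  let Ψ : herm ρ n ⧸ intHerm g ρ n → herm ρ' n ⧸ intHerm g' ρ' n :=
    Quotient.map' (fun x => ⟨x.1.map ψ, (h.map_mem_herm_iff h' hψ).2 x.2⟩) (by
      intro x y hxy
      refine Quotient.exact' (mk_eq_mk_iff.2 fun i j => ?_)
      have := mk_eq_mk_iff.1 (Quotient.sound' hxy) i j
      simp only [Matrix.map_apply, ← map_sub]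
      exact (B.map_mem_maxOrder_iff h h' hψ _).2 this)
  have hΨ : ∀ x : herm ρ n, Ψ (QuotientAddGroup.mk x) =
    QuotientAddGroup.mk ⟨x.1.map ψ, (h.map_mem_herm_iff h' hψ).2 x.2⟩ := fun x => rfl
  let X' := {t : herm ρ' n ⧸ intHerm g' ρ' n //
    nu g' t.out.1 = resCard g' ^ k ∧ descend (ζ.map ψ * t.out.1).trace - φ c ∈ g'}
  have hfinX : Finite X' := by
    have := finite_level (n := n) h' k
    exact Finite.of_injective
      (β := {t : herm ρ' n ⧸ intHerm g' ρ' n // nu g' t.out.1 = resCard g' ^ k})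
      (fun t => ⟨t.1, t.2.1⟩) fun t t' htt => Subtype.ext (congrArg (·.1) htt)
  have := Fintype.ofFinite X'
  let f : Function.End X' := fun t => ⟨Γ t.1, by
    obtain ⟨t, ht⟩ := t
    induction t using QuotientAddGroup.induction_on with
    | H x =>
      rw [hpred'] at ht
      change nu g' (Γ (QuotientAddGroup.mk x)).out.1 = _ ∧ _
      rw [hΓ, hpred', hγnu, hγtr _ x.2, ← B.apply_map c, ← map_sub]
      exact ⟨ht.1, B.map_mem _ ht.2⟩⟩
  have hΓit : ∀ (i : ℕ) (x : herm ρ' n), ∃ hx : x.1.map γK^[i] ∈ herm ρ' n,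
      Γ^[i] (QuotientAddGroup.mk x) = QuotientAddGroup.mk ⟨x.1.map γK^[i], hx⟩ := by
    intro i
    induction i with
    | zero => intro x; exact ⟨x.2, rfl⟩
    | succ i ih =>
      intro x
      obtain ⟨hx, hxe⟩ := ih ⟨x.1.map γK, hγherm x.1 x.2⟩
      exact ⟨hx, hxe⟩
  have hfit : ∀ (i : ℕ) (t : X'), ((f ^ i) t).1 = Γ^[i] t.1 := by
    intro i
    induction i with
    | zero => intro t; rfl
    | succ i ih =>
      intro t
      rw [pow_succ, Function.iterate_succ_apply]
      exact ih (f t)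
  have hf : f ^ p ^ 1 = 1 := by
    funext t
    refine Subtype.ext ?_
    rw [pow_one, hfit]
    change Γ^[p] t.1 = t.1
    obtain ⟨t, -⟩ := t
    induction t using QuotientAddGroup.induction_on with
    | H x =>
      obtain ⟨hx, hxe⟩ := hΓit p x
      rw [hxe]
      congr 1
      refine Subtype.ext ?_
      change x.1.map γK^[p] = x.1
      rw [show γK^[p] = id from funext hγit, Matrix.map_id]
  have hcard := Equiv.Perm.card_fixedPoints_modEq hf
  have hpredΨ : ∀ t : herm ρ n ⧸ intHerm g ρ n,
      (nu g' (Ψ t).out.1 = resCard g' ^ k ∧ descend (ζ.map ψ * (Ψ t).out.1).trace - φ c ∈ g') ↔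
      (nu g t.out.1 = resCard g ^ k ∧ descend (ζ * t.out.1).trace - c ∈ g) := by
    intro t
    have ht : Ψ t = QuotientAddGroup.mk
        ⟨t.out.1.map ψ, (h.map_mem_herm_iff h' hψ).2 t.out.2⟩ := by
      conv_lhs => rw [← Quotient.out_eq t]
      exact hΨ _
    rw [ht, hpred', B.nu_map_eq_pow_iff h h' hψ (hfrac _),
      h.descend_trace_map h' hψ hζh t.out.2, ← map_sub, B.mem_iff]
  have hΓΨ : ∀ t, Γ (Ψ t) = Ψ t := by
    intro t
    induction t using QuotientAddGroup.induction_on with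
    | H x =>
      rw [hΨ, hΓ]
      congr 1
      refine Subtype.ext ?_
      ext i j
      exact hγψ _
  -- Injectivity holds because $\psi$ reflects integrality, surjectivity is `exists_herm_sub_mem`.
  have hfix : fiberCount g ρ ζ k c = Nat.card (Function.fixedPoints f) := by
    refine Nat.card_congr (Equiv.ofBijective
      (fun t => ⟨⟨Ψ t.1, (hpredΨ t.1).2 t.2⟩, Subtype.ext (hΓΨ t.1)⟩) ⟨?_, ?_⟩)
    · rintro ⟨t, ht⟩ ⟨t', ht'⟩ htt
      have h1 : Ψ t = Ψ t' := congrArg (fun z => z.1.1) htt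
      refine Subtype.ext ?_
      change t = t'
      clear htt ht ht'
      induction t using QuotientAddGroup.induction_on with
      | H x =>
        induction t' using QuotientAddGroup.induction_on with
        | H y =>
          rw [hΨ, hΨ, mk_eq_mk_iff] at h1
          refine mk_eq_mk_iff.2 fun i j => ?_
          have h2 := h1 i j
          simp only [Matrix.map_apply, ← map_sub] at h2
          exact (B.map_mem_maxOrder_iff h h' hψ _).1 h2
    · rintro ⟨⟨t, ht⟩, htf⟩
      have hΓt : Γ t = t := congrArg Subtype.val htf
      induction t using QuotientAddGroup.induction_on with
      | H x =>
        rw [hΓ, eq_comm, mk_eq_mk_iff] at hΓt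
        obtain ⟨y, hy⟩ := B.exists_herm_sub_mem h h' hψ hγK x.2 hΓt
        have hyx : Ψ (QuotientAddGroup.mk y) = QuotientAddGroup.mk x := by
          rw [hΨ, mk_eq_mk_iff]
          exact hy
        refine ⟨⟨QuotientAddGroup.mk y, ?_⟩, ?_⟩
        · rw [← hpredΨ, hyx]
          exact ht
        · exact Subtype.ext (Subtype.ext hyx)
  rw [← Nat.card_eq_fintype_card, ← Nat.card_eq_fintype_card, ← hfix] at hcard
  exact hcard

end Counts

end

end SiegelSeries

namespace SiegelSeries

/-! ### Congruence of the normalized series -/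

section Series

variable {F F' : Type*} [Field F] [Field F'] {p : ℕ} {g : ValuationSubring F}
  {g' : ValuationSubring F'} {φ : F →+* F'} {γ : F' →+* F'} {ϖ : g} {ϖ' : g'}
variable {K K' : Type*} [CommRing K] [Algebra F K] [CommRing K'] [Algebra F' K']
  {ρ : K →+* K} {ρ' : K' →+* K'} {θ : K} {s P : F} {ψ : K →+* K'} {n : ℕ}

/-- The series `f_ζ(t)` over the integers. -/
noncomputable def intSeriesF (g : ValuationSubring F) (K : Type*) [CommRing K] [Algebra F K]
    (n : ℕ) : PowerSeries ℤ :=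
  ∏ i ∈ Finset.range n, (1 - PowerSeries.C (tau g K i * (resCard g : ℤ) ^ i) * PowerSeries.X)

theorem map_intSeriesF : (intSeriesF g K n).map (Int.castRingHom ℂ) = seriesF g K n := by
  simp [intSeriesF, seriesF, map_prod]

theorem constantCoeff_intSeriesF : PowerSeries.constantCoeff (intSeriesF g K n) = 1 := by
  rw [intSeriesF, map_prod]
  exact Finset.prod_eq_one fun i _ => by simp

theorem constantCoeff_seriesF : PowerSeries.constantCoeff (seriesF g K n) = 1 := by
  rw [seriesF, map_prod]
  exact Finset.prod_eq_one fun i _ => by simp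

/-- The series `A_ζ(t)` over the integers. -/
noncomputable def intSeriesA (g : ValuationSubring F) (ρ : K →+* K)
    (ζ : Matrix (Fin n) (Fin n) K) (ϖ : g) : PowerSeries ℤ :=
  PowerSeries.mk fun k => (fiberCount g ρ ζ k 0 : ℤ) - fiberCount g ρ ζ k (ϖ : F)⁻¹

/-- The series `g_ζ(t)` over the integers. -/
noncomputable def intSeriesG (g : ValuationSubring F) (ρ : K →+* K)
    (ζ : Matrix (Fin n) (Fin n) K) (ϖ : g) : PowerSeries ℤ :=
  intSeriesA g ρ ζ ϖ * (intSeriesF g K n).invOfUnit 1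

theorem intSeriesG_mul (ζ : Matrix (Fin n) (Fin n) K) :
    intSeriesG g ρ ζ ϖ * intSeriesF g K n = intSeriesA g ρ ζ ϖ := by
  rw [intSeriesG, mul_assoc, PowerSeries.invOfUnit_mul _ _ (by
    rw [constantCoeff_intSeriesF, Units.val_one]), mul_one]

/-- $f_\zeta$ has constant term 1, hence is invertible over $\mathbb Z$, and $A_\zeta$ is integral
by `coeff_seriesA`. -/
theorem seriesG_eq_map [IsDiscreteValuationRing g] [Finite (IsLocalRing.ResidueField g)]
    (h : IsUnramifiedQuadratic g ρ θ s P) (hϖ : Irreducible ϖ) {χ : AddChar F Circle}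
    (hχ : HasConductorOne g χ) {ζ : Matrix (Fin n) (Fin n) K} (hζ : ζ ∈ dualLattice g ρ n) :
    seriesG g ρ χ ζ = (intSeriesG g ρ ζ ϖ).map (Int.castRingHom ℂ) := by
  rw [seriesG, if_pos hζ]
  symm
  rw [PowerSeries.eq_mul_inv_iff_mul_eq (by rw [constantCoeff_seriesF]; exact one_ne_zero),
    ← map_intSeriesF, ← map_mul, intSeriesG_mul]
  ext k
  rw [coeff_seriesA h hχ hζ hϖ, PowerSeries.coeff_map, intSeriesA, PowerSeries.coeff_mk]
  simp

theorem smul_mem_dualLattice_iff (h : IsUnramifiedQuadratic g ρ θ s P) (u : gˣ)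
    {ζ : Matrix (Fin n) (Fin n) K} :
    (u : F) • ζ ∈ dualLattice g ρ n ↔ ζ ∈ dualLattice g ρ n := by
  have key : ∀ (u : gˣ) {ζ : Matrix (Fin n) (Fin n) K}, ζ ∈ dualLattice g ρ n →
      (u : F) • ζ ∈ dualLattice g ρ n := by
    intro u ζ hζ
    rw [mem_dualLattice_iff h] at hζ ⊢
    refine ⟨smul_mem_herm h _ hζ.1, fun i j => ?_⟩
    rw [Matrix.smul_apply, Algebra.smul_def]
    exact mul_mem (h.algebraMap_mem_maxOrder_iff.2 u.1.2) (hζ.2 i j)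
  refine ⟨fun hζ => ?_, key u⟩
  have := key u⁻¹ hζ
  rwa [smul_smul, show ((↑u⁻¹ : g) : F) * ((u : g) : F) = 1 from congrArg Subtype.val u.inv_mul,
    one_smul] at this

theorem seriesG_smul (h : IsUnramifiedQuadratic g ρ θ s P) (u : gˣ) (χ : AddChar F Circle)
    (ζ : Matrix (Fin n) (Fin n) K) :
    seriesG g ρ χ ((u : F) • ζ) = seriesG g ρ (twist χ u) ζ := by
  rw [seriesG, seriesG, smul_mem_dualLattice_iff h]
  split_ifs with hζ
  · rw [seriesA_smul h _ ((mem_dualLattice_iff h).1 hζ).1]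
  · rfl

/-- Reduced mod $p$, the series $A$ and $f$ coincide for the two fields, and $f \ne 0$ can be
cancelled in the domain $\mathbb F_p[[t]]$. The unit $u$ is first moved into the character. -/
theorem IsCyclicBaseChange.exists_int_coeff_seriesG [Fact p.Prime] [IsDiscreteValuationRing g]
    [IsDiscreteValuationRing g'] [Finite (IsLocalRing.ResidueField g)]
    [Finite (IsLocalRing.ResidueField g')] (hp : Odd p)
    (B : IsCyclicBaseChange p g g' φ γ ϖ ϖ')
    (h : IsUnramifiedQuadratic g ρ θ s P) (h' : IsUnramifiedQuadratic g' ρ' (ψ θ) (φ s) (φ P))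
    (hψ : ∀ a, ψ (algebraMap F K a) = algebraMap F' K' (φ a))
    (hfrac : ∀ x : Matrix (Fin n) (Fin n) K, ∃ c d, IsReducedFraction g x c d)
    {χ : AddChar F Circle} (hχ : HasConductorOne g χ)
    {χ' : AddChar F' Circle} (hχ' : HasConductorOne g' χ')
    (ζ : Matrix (Fin n) (Fin n) K) (u : g'ˣ) (j : ℕ) :
    ∃ a a' : ℤ, PowerSeries.coeff j (seriesG g ρ χ ζ) = a ∧
      PowerSeries.coeff j (seriesG g' ρ' χ' ((u : F') • ζ.map ψ)) = a' ∧ a ≡ a' [ZMOD p] := by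
  rw [seriesG_smul h']
  by_cases hζ : ζ ∈ dualLattice g ρ n
  · have hζ' := (B.map_mem_dualLattice_iff h h' hψ).2 hζ
    refine ⟨PowerSeries.coeff j (intSeriesG g ρ ζ ϖ),
      PowerSeries.coeff j (intSeriesG g' ρ' (ζ.map ψ) ϖ'), ?_, ?_, ?_⟩
    · rw [seriesG_eq_map h B.irreducible hχ hζ, PowerSeries.coeff_map]
      rfl
    · rw [seriesG_eq_map h' B.irreducible' (hχ'.twist u) hζ', PowerSeries.coeff_map]
      rfl
    · have hA : (intSeriesA g ρ ζ ϖ).map (Int.castRingHom (ZMod p)) =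
          (intSeriesA g' ρ' (ζ.map ψ) ϖ').map (Int.castRingHom (ZMod p)) := by
        ext k
        have h0 := (ZMod.natCast_eq_natCast_iff _ _ _).2
          (B.fiberCount_modEq h h' hψ hfrac hζ k 0)
        -- The shifts match because $\varphi$ sends $\varpi^{-1}$ to $\varpi'^{-1}$.
        have h1 := (ZMod.natCast_eq_natCast_iff _ _ _).2
          (B.fiberCount_modEq h h' hψ hfrac hζ k (ϖ : F)⁻¹)
        rw [map_zero] at h0
        rw [map_inv₀, B.map_uniformizer] at h1
        simp [intSeriesA, PowerSeries.coeff_map, h0, h1]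
      have hF : (intSeriesF g K n).map (Int.castRingHom (ZMod p)) =
          (intSeriesF g' K' n).map (Int.castRingHom (ZMod p)) := by
        have hq := (ZMod.natCast_eq_natCast_iff _ _ _).2 B.card_residueField_modEq
        simp only [intSeriesF, map_prod, map_sub, map_mul, map_one, PowerSeries.map_C,
          PowerSeries.map_X, B.tau_eq hp h h']
        simp [hq]
      have hG : (intSeriesG g ρ ζ ϖ).map (Int.castRingHom (ZMod p)) =
          (intSeriesG g' ρ' (ζ.map ψ) ϖ').map (Int.castRingHom (ZMod p)) := by
        have hne : (intSeriesF g K n).map (Int.castRingHom (ZMod p)) ≠ 0 := by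
          intro h0
          have := congrArg PowerSeries.constantCoeff h0
          rw [← PowerSeries.coeff_zero_eq_constantCoeff_apply, PowerSeries.coeff_map,
            PowerSeries.coeff_zero_eq_constantCoeff_apply, constantCoeff_intSeriesF] at this
          simp at this
        refine mul_right_cancel₀ hne ?_
        conv_rhs => rw [hF]
        rw [← map_mul, ← map_mul, intSeriesG_mul, intSeriesG_mul, hA]
      have := congrArg (PowerSeries.coeff j) hG
      rw [PowerSeries.coeff_map, PowerSeries.coeff_map] at this
      exact (ZMod.intCast_eq_intCast_iff _ _ _).1 this
  · have hζ' := mt (B.map_mem_dualLattice_iff h h' hψ).1 hζ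
    -- Base change reflects membership in the dual lattice, so both series are 0 by convention.
    refine ⟨0, 0, ?_, ?_, rfl⟩
    · rw [seriesG, if_neg hζ]; simp
    · rw [seriesG, if_neg hζ']; simp

end Series

end SiegelSeries

namespace SiegelSeries

/-! ### Completions of number fields -/

section ValuedTopology

open WithZero in
-- Balls of radius $\exp(-m)$ form a neighbourhood base at 0; comparing valuations then settles
-- continuity and induced topologies.
theorem mem_nhds_zero_iff_exp {L : Type*} [Field L] [Valued L (WithZero (Multiplicative ℤ))]
    (hv : Function.Surjective (Valued.v : L → WithZero (Multiplicative ℤ))) {S : Set L} : S ∈ nhds (0 : L) ↔ ∃ m : ℕ, {x : L | Valued.v x ≤ exp (-(m : ℤ))} ⊆ S := by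
  constructor
  · intro hS
    obtain ⟨c, hc⟩ := Valued.mem_nhds_zero.1 hS
    have hne : MonoidWithZeroHom.ValueGroup₀.embedding c.1 ≠ 0 := (map_ne_zero _).2 c.ne_zero
    obtain ⟨m, hm, -⟩ := exists_exp_neg_natCast_lt_and_lt hne hne
    refine ⟨m, fun x hx => hc ?_⟩
    rw [Set.mem_ofPred_eq, Valuation.restrict_lt_iff_lt_embedding]
    exact lt_of_le_of_lt hx hm
  · rintro ⟨m, hm⟩
    obtain ⟨a, ha⟩ := hv (exp (-(m : ℤ)))
    have ha0 : Valued.v.restrict a ≠ 0 := by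
      rw [Ne, Valuation.zero_iff]
      rintro rfl
      rw [map_zero] at ha
      exact exp_ne_zero ha.symm
    refine Filter.mem_of_superset ((Valued.isOpen_closedBall L ha0).mem_nhds (by simp)) ?_
    intro x hx
    refine hm ?_
    rw [Set.mem_ofPred_eq, ← ha]
    exact (Valuation.restrict_le_iff _).1 hx

end ValuedTopology

section Completion

variable (F : Type*) [Field F] [NumberField F] (v : HeightOneSpectrum (𝓞 F))

theorem exists_sub_mem_adicCompletionIntegers (x : v.adicCompletion F) :
    ∃ y : F, x - algebraMap F _ y ∈ v.adicCompletionIntegers F := by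
  have ho : IsOpen {y : v.adicCompletion F | x - y ∈ v.adicCompletionIntegers F} :=
    (Valued.isOpen_valuationSubring (v.adicCompletion F)).preimage
      (continuous_const.sub continuous_id)
  obtain ⟨y, hy⟩ := (v.denseRange_algebraMap F).exists_mem_open ho ⟨x, by simp⟩
  exact ⟨y, hy⟩

theorem algebraMap_mem_adicCompletionIntegers_iff (y : F) :
    algebraMap F (v.adicCompletion F) y ∈ v.adicCompletionIntegers F ↔ v.valuation F y ≤ 1 := by
  rw [← HeightOneSpectrum.valuedAdicCompletion_eq_valuation' v y]
  rfl

/-- By density of $F$ and approximation of $v$-integral elements by $\mathcal O_F$, the finite ring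
$\mathcal O_F/v$ surjects onto the residue field. -/
instance finite_residueField_adicCompletionIntegers :
    Finite (IsLocalRing.ResidueField (v.adicCompletionIntegers F)) := by
  have hq : Finite (𝓞 F ⧸ v.asIdeal) := v.asIdeal.finiteQuotientOfFreeOfNeBot v.ne_bot
  have hmem : ∀ z : v.adicCompletionIntegers F, Valued.v (z : v.adicCompletion F) < 1 →
      IsLocalRing.residue _ z = 0 := by
    intro z hz
    rw [IsLocalRing.residue_eq_zero_iff, IsLocalRing.mem_maximalIdeal, mem_nonunits_iff,
      HeightOneSpectrum.adicCompletionIntegers.isUnit_iff_valued_eq_one]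
    exact hz.ne
  let f : 𝓞 F ⧸ v.asIdeal →+* IsLocalRing.ResidueField (v.adicCompletionIntegers F) :=
    Ideal.Quotient.lift _ ((IsLocalRing.residue _).comp (algebraMap _ _)) (by
      intro a ha
      refine hmem _ ?_
      change Valued.v (algebraMap F (v.adicCompletion F) (algebraMap (𝓞 F) F a)) < 1
      refine (HeightOneSpectrum.valuedAdicCompletion_eq_valuation' v _).trans_lt ?_
      exact (v.valuation_lt_one_iff_mem _).2 ha)
  refine Finite.of_surjective f fun x => ?_
  obtain ⟨x, rfl⟩ := IsLocalRing.residue_surjective x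
  have ho : IsOpen {y : v.adicCompletion F | Valued.v (x - y : v.adicCompletion F) < 1} := by
    have := Valued.isOpen_ball (v.adicCompletion F) 1
    simp only [Valuation.restrict_lt_one_iff] at this
    exact this.preimage (continuous_const.sub continuous_id)
  obtain ⟨y, hy⟩ := (v.denseRange_algebraMap F).exists_mem_open ho ⟨x, by simp⟩
  have hy1 : v.valuation F y ≤ 1 := by
    rw [← algebraMap_mem_adicCompletionIntegers_iff]
    have h1 : (x : v.adicCompletion F) - algebraMap F _ y ∈ v.adicCompletionIntegers F :=
      (HeightOneSpectrum.mem_adicCompletionIntegers (𝓞 F) F v).2 (le_of_lt hy)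
    simpa using sub_mem x.2 h1
  obtain ⟨a, ha⟩ := v.exists_valuation_sub_lt_of_integer hy1 1
  refine ⟨Ideal.Quotient.mk _ a, ?_⟩
  change IsLocalRing.residue _ (algebraMap (𝓞 F) (v.adicCompletionIntegers F) a) = _
  rw [← sub_eq_zero, ← map_sub]
  refine hmem _ ?_
  change Valued.v (algebraMap F (v.adicCompletion F) (algebraMap (𝓞 F) F a) - x) < 1
  have h1 : Valued.v (algebraMap F (v.adicCompletion F) (algebraMap (𝓞 F) F a - y)) < 1 :=
    (HeightOneSpectrum.valuedAdicCompletion_eq_valuation' v _).trans_lt (by simpa using ha)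
  have h2 : algebraMap F (v.adicCompletion F) (algebraMap (𝓞 F) F a) - x =
      algebraMap F (v.adicCompletion F) (algebraMap (𝓞 F) F a - y) -
        (x - algebraMap F (v.adicCompletion F) y) := by
    rw [map_sub]; ring
  rw [h2]
  exact (Valuation.map_sub _ _ _).trans_lt (max_lt h1 hy)

end Completion

section Extension

variable (F F' : Type*) [Field F] [NumberField F] [Field F'] [NumberField F'] [Algebra F F']
  (w : HeightOneSpectrum (𝓞 F'))

/-- On $F$ this is $e = 1$. For general $x$, take $y \in F$ of the same valuation: the images of
$x/y$ and $y/x$ are both integral. -/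
theorem valued_completionMap (he : (w.under (𝓞 F)).asIdeal.ramificationIdx' w.asIdeal = 1)
    (x : (w.under (𝓞 F)).adicCompletion F) :
    Valued.v (completionMap F F' w x) = Valued.v x := by
  have hF : ∀ y : F, Valued.v (completionMap F F' w (algebraMap F _ y)) =
      Valued.v (algebraMap F ((w.under (𝓞 F)).adicCompletion F) y) := by
    intro y
    rw [completionMap_coe]
    have h1 : Valued.v (algebraMap F' (w.adicCompletion F') (algebraMap F F' y)) =
        w.valuation F' (algebraMap F F' y) :=
      HeightOneSpectrum.valuedAdicCompletion_eq_valuation' w _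
    have h2 : Valued.v (algebraMap F ((w.under (𝓞 F)).adicCompletion F) y) =
        (w.under (𝓞 F)).valuation F y :=
      HeightOneSpectrum.valuedAdicCompletion_eq_valuation' _ y
    rw [h1, h2, ← HeightOneSpectrum.valuation_liesOver F' (w.under (𝓞 F)) w, he, pow_one]
  by_cases hx : x = 0
  · simp [hx]
  obtain ⟨y, hy⟩ := (w.under (𝓞 F)).valuation_surjective F (Valued.v x)
  have hy' : Valued.v (algebraMap F ((w.under (𝓞 F)).adicCompletion F) y) = Valued.v x :=
    (HeightOneSpectrum.valuedAdicCompletion_eq_valuation' _ y).trans hy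
  set y' := algebraMap F ((w.under (𝓞 F)).adicCompletion F) y with hy'def
  have hy0 : y' ≠ 0 := by
    intro h0
    rw [h0, map_zero, eq_comm, Valuation.zero_iff] at hy'
    exact hx hy'
  have hvx : Valued.v x ≠ 0 := (Valuation.ne_zero_iff _).2 hx
  have h1 : Valued.v (completionMap F F' w (x / y')) ≤ 1 := by
    refine completionMap_mapsTo F F' w ?_
    change Valued.v (x / y') ≤ 1
    rw [map_div₀, hy', div_self hvx]
  have h2 : Valued.v (completionMap F F' w (y' / x)) ≤ 1 := by
    refine completionMap_mapsTo F F' w ?_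
    change Valued.v (y' / x) ≤ 1
    rw [map_div₀, hy', div_self hvx]
  rw [map_div₀, map_div₀] at h1 h2
  rw [hF, hy'] at h1 h2
  have hvx' : Valued.v (completionMap F F' w x) ≠ 0 := by
    rw [Valuation.ne_zero_iff]
    simpa using hx
  rw [div_le_one₀ (zero_lt_iff.2 hvx)] at h1
  rw [div_le_one₀ (zero_lt_iff.2 hvx')] at h2
  exact le_antisymm h1 h2

/-- The map preserves valuations, so its image is complete, hence closed. This later places limits
of elements of $F_v$ in the image of $F_v$. -/
theorem isClosed_range_completionMap
    (he : (w.under (𝓞 F)).asIdeal.ramificationIdx' w.asIdeal = 1) :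
    IsClosed (Set.range (completionMap F F' w)) := by
  have hind : Topology.IsInducing (completionMap F F' w) := by
    refine (IsTopologicalAddGroup.isInducing_iff_nhds_zero (f := completionMap F F' w)).2 ?_
    have hv := (w.under (𝓞 F)).valuedAdicCompletion_surjective F
    have hw := w.valuedAdicCompletion_surjective F'
    ext S
    rw [Filter.mem_comap, mem_nhds_zero_iff_exp hv]
    constructor
    · rintro ⟨m, hm⟩
      refine ⟨{x | Valued.v x ≤ WithZero.exp (-(m : ℤ))}, (mem_nhds_zero_iff_exp hw).2 ⟨m, le_rfl⟩,
        ?_⟩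
      intro x hx
      refine hm ?_
      rw [Set.mem_preimage, Set.mem_ofPred_eq, valued_completionMap F F' w he] at hx
      exact hx
    · rintro ⟨T, hT, hTS⟩
      obtain ⟨m, hm⟩ := (mem_nhds_zero_iff_exp hw).1 hT
      refine ⟨m, fun x hx => hTS (hm ?_)⟩
      rw [Set.mem_ofPred_eq, valued_completionMap F F' w he]
      exact hx
  have huni : IsUniformInducing (completionMap F F' w) :=
    AddMonoidHom.isUniformInducing_of_isInducing (f := completionMap F F' w) hind
  exact huni.isComplete_range.isClosed

end Extension

end SiegelSeries

namespace SiegelSeries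

/-! ### Automorphisms of completions -/

section Automorphism

open scoped Pointwise

variable {F F' : Type*} [Field F] [Field F'] [NumberField F'] [Algebra F F']

/-- Both valuations are read off from membership in powers of the primes, which $\sigma$ carries
into each other. -/
theorem intValuation_smul {σ : F' ≃ₐ[F] F'} {w w' : HeightOneSpectrum (𝓞 F')}
    (h : σ • w'.asIdeal = w.asIdeal) (r : 𝓞 F') : w.intValuation (σ • r) = w'.intValuation r := by
  have hiff : ∀ n : ℕ, w.intValuation (σ • r) ≤ WithZero.exp (-(n : ℤ)) ↔
      w'.intValuation r ≤ WithZero.exp (-(n : ℤ)) := by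
    intro n
    rw [HeightOneSpectrum.intValuation_le_pow_iff_mem,
      HeightOneSpectrum.intValuation_le_pow_iff_mem, ← h, ← smul_pow',
      Ideal.smul_mem_pointwise_smul_iff]
  by_cases hr : r = 0
  · simp [hr]
  have hr' : σ • r ≠ 0 := by rwa [Ne, smul_eq_zero_iff_eq]
  refine le_antisymm ?_ ?_
  · rw [w'.intValuation_eq_exp_neg_multiplicity hr, hiff,
      w'.intValuation_eq_exp_neg_multiplicity hr]
  · rw [w.intValuation_eq_exp_neg_multiplicity hr', ← hiff,
      w.intValuation_eq_exp_neg_multiplicity hr']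

theorem valuation_apply_eq {σ : F' ≃ₐ[F] F'} {w w' : HeightOneSpectrum (𝓞 F')}
    (h : σ • w'.asIdeal = w.asIdeal) (x : F') : w.valuation F' (σ x) = w'.valuation F' x := by
  have hO : ∀ r : 𝓞 F', w.valuation F' (σ (algebraMap (𝓞 F') F' r)) =
      w'.valuation F' (algebraMap (𝓞 F') F' r) := by
    intro r
    have : σ (algebraMap (𝓞 F') F' r) = algebraMap (𝓞 F') F' (σ • r) := rfl
    rw [this, HeightOneSpectrum.valuation_of_algebraMap, HeightOneSpectrum.valuation_of_algebraMap,
      intValuation_smul h]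
  obtain ⟨a, b, -, rfl⟩ := IsFractionRing.div_surjective (A := 𝓞 F') x
  rw [map_div₀, map_div₀, map_div₀, hO, hO]

variable {w : HeightOneSpectrum (𝓞 F')}

/-- The automorphism `σ` of `F'` as an endomorphism of `F'` with the `w`-adic topology. -/
noncomputable def withValMap (w : HeightOneSpectrum (𝓞 F')) (σ : F' ≃ₐ[F] F') :
    WithVal (w.valuation F') →+* WithVal (w.valuation F') :=
  ((WithVal.equiv (w.valuation F')).symm.toRingHom.comp (σ : F' →+* F')).comp
    (WithVal.equiv (w.valuation F')).toRingHom

theorem continuous_withValMap {σ : F' ≃ₐ[F] F'} (h : σ • w.asIdeal = w.asIdeal) :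
    Continuous (withValMap w σ) := by
  refine continuous_of_continuousAt_zero (withValMap w σ) ?_
  rw [ContinuousAt, map_zero]
  have hsurj : Function.Surjective
      (Valued.v : WithVal (w.valuation F') → WithZero (Multiplicative ℤ)) := fun c => by
    obtain ⟨x, hx⟩ := w.valuation_surjective F' c
    exact ⟨(WithVal.equiv (w.valuation F')).symm x, hx⟩
  intro S hS
  obtain ⟨m, hm⟩ := (mem_nhds_zero_iff_exp hsurj).1 hS
  refine (mem_nhds_zero_iff_exp hsurj).2 ⟨m, fun x hx => hm ?_⟩
  have : Valued.v (withValMap w σ x) = Valued.v x := valuation_apply_eq h _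
  rw [Set.mem_ofPred_eq, this]
  exact hx

/-- The extension to the completion of an automorphism that fixes the prime `w`. -/
noncomputable def completionAut (w : HeightOneSpectrum (𝓞 F')) (σ : F' ≃ₐ[F] F')
    (h : σ • w.asIdeal = w.asIdeal) : w.adicCompletion F' →+* w.adicCompletion F' :=
  ((HeightOneSpectrum.adicCompletion.equiv F' w).symm.toRingHom.comp
    (UniformSpace.Completion.mapRingHom (withValMap w σ) (continuous_withValMap h))).comp
    (HeightOneSpectrum.adicCompletion.equiv F' w).toRingHom

variable {σ : F' ≃ₐ[F] F'} (h : σ • w.asIdeal = w.asIdeal)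

theorem completionAut_coe (x : F') :
    completionAut w σ h (algebraMap F' _ x) = algebraMap F' _ (σ x) := by
  change HeightOneSpectrum.adicCompletion.ofCompletion (UniformSpace.Completion.mapRingHom
    (withValMap w σ) (continuous_withValMap h)
    (((WithVal.equiv (w.valuation F')).symm x : WithVal (w.valuation F')) :
      (w.valuation F').Completion)) = _
  rw [UniformSpace.Completion.mapRingHom_coe (continuous_withValMap h)]
  rfl

theorem continuous_completionAut : Continuous (completionAut w σ h) := by
  refine (HeightOneSpectrum.adicCompletion.continuous_ofCompletion F' w).comp ?_
  exact UniformSpace.Completion.continuous_map.comp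
    (HeightOneSpectrum.adicCompletion.continuous_toCompletion F' _)

theorem completionAut_mem {x : w.adicCompletion F'} (hx : x ∈ w.adicCompletionIntegers F') :
    completionAut w σ h x ∈ w.adicCompletionIntegers F' := by
  have ho : IsOpen ((w.adicCompletionIntegers F' : Set _) ∩
      {y | completionAut w σ h y - completionAut w σ h x ∈ w.adicCompletionIntegers F'}) := by
    refine (Valued.isOpen_valuationSubring _).inter ?_
    exact (Valued.isOpen_valuationSubring (w.adicCompletion F')).preimage
      ((continuous_completionAut h).sub continuous_const)
  obtain ⟨y, hy1, hy2⟩ := (w.denseRange_algebraMap F').exists_mem_open ho ⟨x, hx, by simp⟩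
  have hy3 : completionAut w σ h (algebraMap F' _ y) ∈ w.adicCompletionIntegers F' := by
    rw [completionAut_coe, algebraMap_mem_adicCompletionIntegers_iff, valuation_apply_eq h,
      ← algebraMap_mem_adicCompletionIntegers_iff]
    exact hy1
  have := sub_mem hy3 hy2
  simpa using this

theorem iterate_completionAut {p : ℕ} (hp : σ ^ p = 1) (x : w.adicCompletion F') :
    (completionAut w σ h)^[p] x = x := by
  refine congrFun ((w.denseRange_algebraMap F').equalizer
    ((continuous_completionAut h).iterate p) continuous_id ?_) x
  funext y
  have : ∀ (k : ℕ) (y : F'), (completionAut w σ h)^[k] (algebraMap F' _ y) =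
      algebraMap F' _ ((σ ^ k) y) := by
    intro k
    induction k with
    | zero => intro y; rfl
    | succ k ih =>
      intro y
      rw [Function.iterate_succ_apply, completionAut_coe, ih, pow_succ]
      rfl
  simp only [Function.comp_apply, this, hp]
  rfl

theorem completionAut_completionMap [NumberField F]
    (a : (w.under (𝓞 F)).adicCompletion F) :
    completionAut w σ h (completionMap F F' w a) = completionMap F F' w a := by
  refine congrFun (((w.under (𝓞 F)).denseRange_algebraMap F).equalizer
    ((continuous_completionAut h).comp (continuous_completionMap F F' w))
    (continuous_completionMap F F' w) ?_) a
  funext x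
  simp only [Function.comp_apply, completionMap_coe]
  rw [completionAut_coe, σ.commutes]

end Automorphism

/-! ### Approximation by elements of the ground field -/

section Approximation

open scoped Pointwise

variable (F F' : Type*) [Field F] [NumberField F] [Field F'] [NumberField F'] [Algebra F F']
  [IsGalois F F'] (w : HeightOneSpectrum (𝓞 F'))

/-- An element of `F'` that is fixed by the decomposition group of `w` modulo `w`-integers is
congruent to an element of `F`. -/
theorem exists_sub_algebraMap_le_one
    (hD : (Nat.card (MulAction.stabilizer (F' ≃ₐ[F] F') w.asIdeal) : 𝓞 F') ∉ w.asIdeal) (y : F')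
    (hy : ∀ σ : F' ≃ₐ[F] F', σ • w.asIdeal = w.asIdeal → w.valuation F' (σ y - y) ≤ 1) :
    ∃ z : F, w.valuation F' (y - algebraMap F F' z) ≤ 1 := by
  classical
  set D := MulAction.stabilizer (F' ≃ₐ[F] F') w.asIdeal with hDdef
  have hmemD : ∀ σ : F' ≃ₐ[F] F', σ ∈ D ↔ σ • w.asIdeal = w.asIdeal := fun σ => Iff.rfl
  -- the conjugates of `w`
  let c : (F' ≃ₐ[F] F') → HeightOneSpectrum (𝓞 F') := fun σ =>
    ⟨σ⁻¹ • w.asIdeal, inferInstance, by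
      rw [Ne, ← Ideal.zero_eq_bot, smul_eq_zero_iff_eq]
      exact w.ne_bot⟩
  have hc : ∀ σ, σ • (c σ).asIdeal = w.asIdeal := fun σ => smul_inv_smul σ w.asIdeal
  have hcD : ∀ σ, c σ = w ↔ σ ∈ D := by
    intro σ
    rw [HeightOneSpectrum.ext_iff, hmemD]
    change σ⁻¹ • w.asIdeal = w.asIdeal ↔ _
    rw [inv_smul_eq_iff, eq_comm]
  -- a bound for the denominators of `y`
  have hbound : ∀ σ : F' ≃ₐ[F] F', ∃ N : ℕ,
      WithZero.exp (-(N : ℤ)) * (c σ).valuation F' y ≤ 1 := by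
    intro σ
    by_cases h0 : (c σ).valuation F' y = 0
    · exact ⟨0, by simp [h0]⟩
    · obtain ⟨N, hN, -⟩ := WithZero.exists_exp_neg_natCast_lt_and_lt (inv_ne_zero h0)
        (inv_ne_zero h0)
      refine ⟨N, ?_⟩
      have := mul_le_mul_left (hN.le) ((c σ).valuation F' y)
      rwa [inv_mul_cancel₀ h0] at this
  choose N hN using hbound
  let M := Finset.univ.sup N
  have hM : ∀ σ (a : 𝓞 F'), a ∈ (c σ).asIdeal ^ M →
      (c σ).valuation F' (algebraMap (𝓞 F') F' a * y) ≤ 1 := by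
    intro σ a ha
    rw [map_mul, HeightOneSpectrum.valuation_of_algebraMap]
    rw [← HeightOneSpectrum.intValuation_le_pow_iff_mem] at ha
    refine le_trans (mul_le_mul_left (ha.trans ?_) _) (hN σ)
    rw [WithZero.exp_le_exp, neg_le_neg_iff, Nat.cast_le]
    exact Finset.le_sup (Finset.mem_univ σ)
  -- Chinese remainder theorem: $e$ is close to 1 at $w$ and to 0 at the other conjugates, closely
  -- enough to absorb the poles of $y$.
  obtain ⟨e, he⟩ := IsDedekindDomain.exists_forall_sub_mem_ideal
    (s := (Finset.univ.image c)) (fun u => u.asIdeal) (fun _ => M) (fun u _ => u.prime)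
    (fun u _ u' _ huu' h => huu' (HeightOneSpectrum.ext h))
    (fun u => if u.1 = w then 1 else 0)
  -- Modulo $w$-integers, $\sigma(ey)$ is $\sigma y \equiv y$ for $\sigma \in D$ and 0 otherwise.
  -- Summing over $\sigma$ gives $\mathrm{Tr}(ey) \equiv |D|\,y$, and $|D|$ is a $w$-unit.
  have heσ : ∀ σ, w.valuation F' (σ (algebraMap (𝓞 F') F' e * y) -
      if σ ∈ D then y else 0) ≤ 1 := by
    intro σ
    have h1 := hM σ _ (he (c σ) (Finset.mem_image_of_mem _ (Finset.mem_univ σ)))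
    rw [← valuation_apply_eq (hc σ)] at h1
    simp only [hcD] at h1
    split_ifs with hσ
    · rw [if_pos hσ, map_sub, map_one, sub_mul, one_mul, map_sub] at h1
      have h2 := hy σ hσ
      have : σ (algebraMap (𝓞 F') F' e * y) - y =
        (σ (algebraMap (𝓞 F') F' e * y) - σ y) + (σ y - y) := by ring
      rw [this]
      exact (Valuation.map_add _ _ _).trans (max_le h1 h2)
    · rw [if_neg hσ, sub_zero] at h1
      rwa [sub_zero]
  have hsum : w.valuation F' (algebraMap F F' (Algebra.trace F F' (algebraMap (𝓞 F') F' e * y)) -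
      (Nat.card D : F') * y) ≤ 1 := by
    rw [trace_eq_sum_automorphisms]
    have hcard : (Nat.card D : F') * y = ∑ σ : F' ≃ₐ[F] F', if σ ∈ D then y else 0 := by
      rw [← Finset.sum_filter, Finset.sum_const, nsmul_eq_mul, Nat.card_eq_fintype_card,
        Fintype.card_subtype]
    rw [hcard, ← Finset.sum_sub_distrib]
    exact Valuation.map_sum_le _ fun σ _ => heσ σ
  have hu : w.valuation F' (Nat.card D : F') = 1 := by
    have := (w.valuation_eq_one_iff_notMem (K := F')).2 hD
    simpa using this
  have hD0 : (Nat.card D : F') ≠ 0 := by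
    intro h0
    rw [h0, map_zero] at hu
    exact zero_ne_one hu
  refine ⟨Algebra.trace F F' (algebraMap (𝓞 F') F' e * y) / Nat.card D, ?_⟩
  have h3 : y - algebraMap F F' (Algebra.trace F F' (algebraMap (𝓞 F') F' e * y) / Nat.card D) =
      -((algebraMap F F' (Algebra.trace F F' (algebraMap (𝓞 F') F' e * y)) -
        (Nat.card D : F') * y) / (Nat.card D : F')) := by
    rw [map_div₀, map_natCast]
    field_simp
    ring
  rw [h3, Valuation.map_neg, map_div₀, hu, div_one]
  exact hsum

end Approximation

end SiegelSeries

/-! ### Cyclic base change for the completions of a Galois extension of prime degree -/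

namespace SiegelSeries

section

open scoped Pointwise

theorem irreducible_of_valued_eq {F : Type*} [Field F] [NumberField F]
    {v : HeightOneSpectrum (𝓞 F)} {x : v.adicCompletionIntegers F}
    (hx : Valued.v (x : v.adicCompletion F) = WithZero.exp (-1 : ℤ)) : Irreducible x := by
  have hunit := fun a : v.adicCompletionIntegers F =>
    HeightOneSpectrum.adicCompletionIntegers.isUnit_iff_valued_eq_one (a := a)
  refine ⟨?_, fun a b hab => ?_⟩
  · rw [hunit, hx]
    rw [← WithZero.exp_zero, WithZero.exp_inj]
    norm_num
  · by_contra! hcon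
    have hlt : ∀ a : v.adicCompletionIntegers F, ¬ IsUnit a →
        Valued.v (a : v.adicCompletion F) ≤ WithZero.exp (-1 : ℤ) := by
      intro a ha
      rw [hunit] at ha
      have h1 : Valued.v (a : v.adicCompletion F) < 1 := lt_of_le_of_ne a.2 ha
      by_cases h0 : Valued.v (a : v.adicCompletion F) = 0
      · rw [h0]; exact zero_le
      · rw [← WithZero.log_le_iff_le_exp h0]
        rw [← WithZero.exp_zero, ← WithZero.log_lt_iff_lt_exp h0] at h1
        omega
    have h1 := mul_le_mul' (hlt a hcon.1) (hlt b hcon.2)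
    have h2 : Valued.v (a : v.adicCompletion F) * Valued.v (b : v.adicCompletion F) =
        WithZero.exp (-1 : ℤ) := by
      rw [← map_mul, ← hx, hab]
      rfl
    rw [h2, ← WithZero.exp_add, WithZero.exp_le_exp] at h1
    omega

variable (F F' : Type*) [Field F] [NumberField F] [Field F'] [NumberField F'] [Algebra F F']

theorem ramificationIdx_under_eq_one (w : HeightOneSpectrum (𝓞 F'))
    (hunr : Algebra.IsUnramifiedAt (𝓞 F) w.asIdeal) :
    (w.under (𝓞 F)).asIdeal.ramificationIdx' w.asIdeal = 1 := by
  rw [Ideal.ramificationIdx'_eq_ramificationIdx _ _ (w.under (𝓞 F)).ne_bot]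
  exact Ideal.ramificationIdx_eq_one _ _

variable [IsGalois F F']

/-- $\gamma$ is the completion of a generator of the decomposition group $D$, cyclic because the
Galois group has order $p$. The split case is included: there $D$ is trivial and $\gamma$ is the
identity. -/
theorem exists_isCyclicBaseChange {p : ℕ} (hp : p.Prime) (hdeg : Module.finrank F F' = p)
    (w : HeightOneSpectrum (𝓞 F')) (hpw : (p : 𝓞 F') ∉ w.asIdeal)
    (hunr : Algebra.IsUnramifiedAt (𝓞 F) w.asIdeal) :
    ∃ γ ϖ ϖ', IsCyclicBaseChange p ((w.under (𝓞 F)).adicCompletionIntegers F)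
      (w.adicCompletionIntegers F') (completionMap F F' w) γ ϖ ϖ' := by
  have he := ramificationIdx_under_eq_one F F' w hunr
  have hval := valued_completionMap F F' w he
  have hcard : Nat.card (F' ≃ₐ[F] F') = p := by rw [IsGalois.card_aut_eq_finrank, hdeg]
  have := Fact.mk hp
  have hcyc : IsCyclic (F' ≃ₐ[F] F') := isCyclic_of_prime_card hcard
  set D := MulAction.stabilizer (F' ≃ₐ[F] F') w.asIdeal with hDdef
  obtain ⟨⟨σ, hσ⟩, hgen⟩ := IsCyclic.exists_generator (α := D)
  have hσ' : σ • w.asIdeal = w.asIdeal := hσ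
  have hgen' : ∀ τ : F' ≃ₐ[F] F', τ • w.asIdeal = w.asIdeal → ∃ k : ℕ, σ ^ k = τ := by
    intro τ hτ
    obtain ⟨k, hk⟩ := mem_powers_iff_mem_zpowers.2 (hgen ⟨τ, hτ⟩)
    exact ⟨k, congrArg Subtype.val hk⟩
  -- $|D|$ is 1 or $p$, and neither lies in $w$.
  have hDcard : (Nat.card D : 𝓞 F') ∉ w.asIdeal := by
    rcases (Nat.dvd_prime hp).1 (hcard ▸ D.card_subgroup_dvd_card) with h1 | h1
    · rw [h1, Nat.cast_one]
      exact fun h => w.isPrime.ne_top ((Ideal.eq_top_iff_one _).2 h)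
    · rwa [h1]
  have hσp : σ ^ p = 1 := by rw [← hcard, pow_card_eq_one']
  obtain ⟨a, ha⟩ := (w.under (𝓞 F)).valuedAdicCompletion_surjective F (WithZero.exp (-1 : ℤ))
  have hamem : a ∈ (w.under (𝓞 F)).adicCompletionIntegers F := by
    rw [HeightOneSpectrum.mem_adicCompletionIntegers, ha, ← WithZero.exp_zero,
      WithZero.exp_le_exp]
    norm_num
  have hsub : ∀ x, completionAut w σ hσ' x - x ∈ w.adicCompletionIntegers F' →
      ∃ y, x - completionMap F F' w y ∈ w.adicCompletionIntegers F' := by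
    intro x hx
    obtain ⟨y, hy⟩ := exists_sub_mem_adicCompletionIntegers F' w x
    have hσy : w.valuation F' (σ y - y) ≤ 1 := by
      rw [← algebraMap_mem_adicCompletionIntegers_iff, map_sub, ← completionAut_coe hσ']
      have h1 := completionAut_mem hσ' hy
      rw [map_sub] at h1
      have h2 := add_mem (sub_mem hx h1) hy
      convert h2 using 1
      ring
    -- Invariance modulo integers under the generator passes to all of $D$, because $\sigma$
    -- preserves the valuation.
    have hky : ∀ k : ℕ, w.valuation F' ((σ ^ k) y - y) ≤ 1 := by
      intro k
      induction k with
      | zero => simp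
      | succ k ih =>
        have h1 : (σ ^ (k + 1)) y - y = σ ((σ ^ k) y - y) + (σ y - y) := by
          rw [pow_succ', map_sub, AlgEquiv.mul_apply]
          ring
        rw [h1]
        refine (Valuation.map_add _ _ _).trans (max_le ?_ hσy)
        rw [valuation_apply_eq hσ']
        exact ih
    obtain ⟨z, hz⟩ := exists_sub_algebraMap_le_one F F' w hDcard y fun τ hτ => by
      obtain ⟨k, rfl⟩ := hgen' τ hτ
      exact hky k
    refine ⟨algebraMap F _ z, ?_⟩
    rw [completionMap_coe]
    rw [← algebraMap_mem_adicCompletionIntegers_iff, map_sub] at hz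
    have := add_mem hy hz
    simpa using this
  have hmem : ∀ b, completionMap F F' w b ∈ w.adicCompletionIntegers F' ↔
      b ∈ (w.under (𝓞 F)).adicCompletionIntegers F := by
    intro b
    rw [HeightOneSpectrum.mem_adicCompletionIntegers, HeightOneSpectrum.mem_adicCompletionIntegers,
      hval]
  refine ⟨completionAut w σ hσ', ⟨a, hamem⟩, ⟨completionMap F F' w a, (hmem a).2 hamem⟩,
    irreducible_of_valued_eq ha, irreducible_of_valued_eq ((hval a).trans ha), rfl, hmem,
    completionAut_completionMap hσ', iterate_completionAut hσ' hσp,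
    fun x hx => completionAut_mem hσ' hx, fun x hx => ?_, hsub⟩
  have ha0 : completionMap F F' w a ≠ 0 := by
    rw [← Valuation.ne_zero_iff Valued.v, hval, ha]
    exact WithZero.exp_ne_zero
  -- A fixed $x$ is divided by $\varpi'^m$ before `hsub` is applied: so $x$ is approximated from
  -- $F_v$ to any precision, and the closed range contains it.
  have happrox : ∀ m : ℕ, ∃ y, Valued.v (x - completionMap F F' w y) ≤
      WithZero.exp (-(m : ℤ)) := by
    intro m
    obtain ⟨y, hy⟩ := hsub (x / completionMap F F' w a ^ m) (by
      rw [map_div₀, map_pow, completionAut_completionMap, hx, sub_self]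
      exact zero_mem _)
    refine ⟨a ^ m * y, ?_⟩
    have h1 : x - completionMap F F' w (a ^ m * y) =
        completionMap F F' w a ^ m * (x / completionMap F F' w a ^ m - completionMap F F' w y) := by
      rw [map_mul, map_pow]
      field_simp
    rw [h1, map_mul, map_pow, hval, ha, ← WithZero.exp_nsmul]
    refine (mul_le_mul' le_rfl ((HeightOneSpectrum.mem_adicCompletionIntegers (𝓞 F') F' w).1
      hy)).trans ?_
    simp
  have hcl : x ∈ closure (Set.range (completionMap F F' w)) := by
    rw [mem_closure_iff_nhds]
    intro T hT
    have hT' : (fun z => x - z) ⁻¹' T ∈ nhds (0 : w.adicCompletion F') := by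
      refine (continuous_const.sub continuous_id).continuousAt.preimage_mem_nhds ?_
      simpa using hT
    obtain ⟨m, hm⟩ := (mem_nhds_zero_iff_exp (w.valuedAdicCompletion_surjective F')).1 hT'
    obtain ⟨y, hy⟩ := happrox m
    refine ⟨completionMap F F' w y, ?_, ⟨y, rfl⟩⟩
    have := hm hy
    simpa using this
  rw [(isClosed_range_completionMap F F' w he).closure_eq] at hcl
  obtain ⟨y, rfl⟩ := hcl
  exact ⟨y, rfl⟩

end

end SiegelSeries

namespace SiegelSeries

/-! ### Quadratic extensions of number fields -/

section Quadratic

/-- Otherwise $1, x$ would be an $F$-basis of $K$ fixed by $\rho$, so $\rho = 1$. -/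
theorem fixed_mem_range {F K : Type*} [Field F] [Field K] [Algebra F K]
    [Algebra.IsQuadraticExtension F K] {ρ : K ≃ₐ[F] K} (hρ : ρ ≠ 1) {x : K} (hx : ρ x = x) :
    x ∈ Set.range (algebraMap F K) := by
  by_contra hx'
  have hli : LinearIndependent F ![1, x] := by
    rw [LinearIndependent.pair_iff' one_ne_zero]
    intro a ha
    exact hx' ⟨a, by rw [← ha, Algebra.smul_def, mul_one]⟩
  have hfin : Module.Finite F K := inferInstance
  let b := basisOfLinearIndependentOfCardEqFinrank hli
    (by rw [Fintype.card_fin, Algebra.IsQuadraticExtension.finrank_eq_two])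
  refine hρ (AlgEquiv.ext fun y => ?_)
  have : (ρ.toLinearMap : K →ₗ[F] K) = LinearMap.id := by
    refine b.ext fun i => ?_
    rw [coe_basisOfLinearIndependentOfCardEqFinrank]
    fin_cases i
    · simp
    · simpa using hx
  exact LinearMap.congr_fun this y

theorem conj_conj_eq {F K : Type*} [Field F] [CharZero F] [Field K] [Algebra F K]
    [Algebra.IsQuadraticExtension F K] (ρ : K ≃ₐ[F] K) (x : K) : ρ (ρ x) = x := by
  have hcard : Nat.card (K ≃ₐ[F] K) = 2 := by
    rw [IsGalois.card_aut_eq_finrank, Algebra.IsQuadraticExtension.finrank_eq_two]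
  have : ρ ^ 2 = 1 := by rw [← hcard, pow_card_eq_one']
  exact congrArg (fun σ : K ≃ₐ[F] K => σ x) this

theorem eq_one_or_eq {F K : Type*} [Field F] [CharZero F] [Field K] [Algebra F K]
    [Algebra.IsQuadraticExtension F K] {ρ : K ≃ₐ[F] K} (hρ : ρ ≠ 1) (σ : K ≃ₐ[F] K) :
    σ = 1 ∨ σ = ρ := by
  have hcard : Nat.card (K ≃ₐ[F] K) = 2 := by
    rw [IsGalois.card_aut_eq_finrank, Algebra.IsQuadraticExtension.finrank_eq_two]
  obtain ⟨a, -, ha⟩ := Nat.card_eq_two_iff' (1 : K ≃ₐ[F] K) |>.1 hcard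
  by_cases h : σ = 1
  · exact Or.inl h
  · exact Or.inr ((ha σ h).trans (ha ρ hρ).symm)

open scoped Pointwise in
/-- A prime that is unramified in a quadratic extension has an integral element whose discriminant
is a unit at that prime. -/
theorem exists_unit_discriminant {F K : Type*} [Field F] [NumberField F] [Field K] [NumberField K]
    [Algebra F K] [Algebra.IsQuadraticExtension F K] {ρ : K ≃ₐ[F] K} (hρ : ρ ≠ 1)
    (v : HeightOneSpectrum (𝓞 F))
    (hunr : ∀ w : HeightOneSpectrum (𝓞 K), w.under (𝓞 F) = v →
      Algebra.IsUnramifiedAt (𝓞 F) w.asIdeal) :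
    ∃ (θ : K) (s P : 𝓞 F), algebraMap F K (algebraMap (𝓞 F) F s) = θ + ρ θ ∧
      algebraMap F K (algebraMap (𝓞 F) F P) = θ * ρ θ ∧ s ^ 2 - 4 * P ∉ v.asIdeal := by
  obtain ⟨⟨Q, hQ⟩⟩ := v.asIdeal.nonempty_primesOver (S := 𝓞 K)
  have hQp : Q.IsPrime := hQ.1
  have hQl : Q.LiesOver v.asIdeal := hQ.2
  have hQ0 : Q ≠ ⊥ := Ideal.ne_bot_of_liesOver_of_ne_bot v.ne_bot Q
  let w : HeightOneSpectrum (𝓞 K) := ⟨Q, hQp, hQ0⟩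
  have hw : w.under (𝓞 F) = v := HeightOneSpectrum.ext hQl.over.symm
  have hunrQ : Algebra.IsUnramifiedAt (𝓞 F) Q := hunr w hw
  have hfinite : Finite (𝓞 F ⧸ v.asIdeal) := v.asIdeal.finiteQuotientOfFreeOfNeBot v.ne_bot
  have hcard := Ideal.card_inertia_eq_ramificationIdxIn (G := K ≃ₐ[F] K) v.asIdeal Q
  rw [Ideal.ramificationIdxIn_eq_ramificationIdx v.asIdeal Q (K ≃ₐ[F] K),
    Ideal.ramificationIdx_eq_one] at hcard
  -- Unramified means trivial inertia, so $\rho$ moves some $\theta$ modulo $Q$. The discriminant is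
  -- $(\rho\theta - \theta)^2$, hence prime to $Q$; residue characteristic 2 needs no separate
  -- treatment.
  have hin : ρ ∉ Ideal.inertia (K ≃ₐ[F] K) Q := by
    intro h
    have := (Subgroup.card_eq_one.1 hcard) ▸ h
    exact hρ (Subgroup.mem_bot.1 this)
  obtain ⟨θ, hθ⟩ : ∃ θ : 𝓞 K, ρ • θ - θ ∉ Q := by
    by_contra! h
    exact hin h
  have hinv : ∀ x : 𝓞 K, ρ • x = x → ∃ a : 𝓞 F, algebraMap (𝓞 F) (𝓞 K) a = x := by
    intro x hx
    refine Algebra.IsInvariant.isInvariant (G := K ≃ₐ[F] K) x fun σ => ?_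
    rcases eq_one_or_eq hρ σ with rfl | rfl
    · exact one_smul _ x
    · exact hx
  have hρρ : ρ • ρ • θ = θ := Subtype.ext (conj_conj_eq ρ θ)
  obtain ⟨s, hs⟩ := hinv (θ + ρ • θ) (by rw [smul_add, hρρ, add_comm])
  obtain ⟨P, hP⟩ := hinv (θ * ρ • θ) (by rw [smul_mul', hρρ, mul_comm])
  refine ⟨θ, s, P, congrArg Subtype.val hs, congrArg Subtype.val hP, fun hd => hθ ?_⟩
  have h1 : algebraMap (𝓞 F) (𝓞 K) (s ^ 2 - 4 * P) ∈ Q := by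
    rw [hQl.over] at hd
    exact hd
  have h2 : algebraMap (𝓞 F) (𝓞 K) (s ^ 2 - 4 * P) = (ρ • θ - θ) ^ 2 := by
    rw [map_sub, map_pow, map_mul, hs, hP, map_ofNat]
    ring
  rw [h2] at h1
  exact hQp.mem_of_pow_mem _ h1

variable {F K : Type*} [Field F] [NumberField F] [Field K] [Algebra F K]

theorem localConj_tmul (ρ : K ≃ₐ[F] K) (v : HeightOneSpectrum (𝓞 F)) (a : v.adicCompletion F)
    (k : K) : localConj F ρ v (a ⊗ₜ k) = a ⊗ₜ ρ k :=
  tensorMap_tmul _ _ _ _ _ a k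

theorem algebraMap_algebraMap_localAlg (v : HeightOneSpectrum (𝓞 F)) (a : F) :
    algebraMap (v.adicCompletion F) (LocalAlg F K v) (algebraMap F _ a) =
      1 ⊗ₜ algebraMap F K a := by
  rw [Algebra.TensorProduct.algebraMap_apply, Algebra.algebraMap_self_apply,
    Algebra.algebraMap_eq_smul_one, TensorProduct.smul_tmul, Algebra.algebraMap_eq_smul_one]

/-- As the discriminant is nonzero, $\theta \notin F$; so $1, \theta$ is a basis of $K/F$ and, after
tensoring, of $K_v/F_v$, whether or not $K_v$ is a field. -/
theorem isUnramifiedQuadratic_localAlg [Algebra.IsQuadraticExtension F K] {ρ : K ≃ₐ[F] K}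
    (v : HeightOneSpectrum (𝓞 F)) {θ : K} {s P : F}
    (hs : algebraMap F K s = θ + ρ θ) (hP : algebraMap F K P = θ * ρ θ)
    (hsv : v.valuation F s ≤ 1) (hPv : v.valuation F P ≤ 1)
    (hdv : v.valuation F (s ^ 2 - 4 * P) = 1) :
    IsUnramifiedQuadratic (v.adicCompletionIntegers F) (localConj F ρ v)
      ((1 : v.adicCompletion F) ⊗ₜ[F] θ) (algebraMap F _ s) (algebraMap F _ P) := by
  have hd0 : s ^ 2 - 4 * P ≠ 0 := by
    intro h0
    rw [h0, map_zero] at hdv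
    exact zero_ne_one hdv
  have hF := algebraMap_algebraMap_localAlg (K := K) v
  refine ⟨(algebraMap_mem_adicCompletionIntegers_iff F v s).2 hsv,
    (algebraMap_mem_adicCompletionIntegers_iff F v P).2 hPv,
    ⟨algebraMap F _ (s ^ 2 - 4 * P)⁻¹, ?_, ?_⟩, ?_, ?_, ?_, ?_⟩
  · rw [algebraMap_mem_adicCompletionIntegers_iff, map_inv₀, hdv, inv_one]
  · rw [← map_one (algebraMap F (v.adicCompletion F)), ← mul_inv_cancel₀ hd0, map_mul]
    simp only [map_sub, map_mul, map_pow, map_ofNat]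
  · rw [hF, hF, hs, hP, Algebra.TensorProduct.tmul_mul_tmul, Algebra.TensorProduct.tmul_mul_tmul,
      mul_one, ← TensorProduct.tmul_sub]
    congr 1
    ring
  · rw [hF, hs, localConj_tmul, ← TensorProduct.tmul_sub]
    congr 1
    ring
  · intro a
    rw [Algebra.TensorProduct.algebraMap_apply, localConj_tmul, map_one]
  · have hθ : θ ∉ Set.range (algebraMap F K) := by
      rintro ⟨a, rfl⟩
      rw [ρ.commutes, ← map_add] at hs
      rw [ρ.commutes, ← map_mul] at hP
      have h1 := (algebraMap F K).injective hs
      have h2 := (algebraMap F K).injective hP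
      exact hd0 (by rw [h1, h2]; ring)
    have hli : LinearIndependent F ![1, θ] := by
      rw [LinearIndependent.pair_iff' one_ne_zero]
      intro a ha
      exact hθ ⟨a, by rw [← ha, Algebra.smul_def, mul_one]⟩
    have hfin : Module.Finite F K := inferInstance
    let b := basisOfLinearIndependentOfCardEqFinrank hli
      (by rw [Fintype.card_fin, Algebra.IsQuadraticExtension.finrank_eq_two])
    let B := Algebra.TensorProduct.basis (v.adicCompletion F) b
    have h0 : B 0 = 1 ⊗ₜ 1 := by
      simp [B, b, Algebra.TensorProduct.basis_apply]
    have h1 : B 1 = 1 ⊗ₜ θ := by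
      simp [B, b, Algebra.TensorProduct.basis_apply]
    convert ((finTwoArrowEquiv (v.adicCompletion F)).symm.trans
      B.equivFun.symm.toEquiv).bijective using 1
    ext ab
    simp only [Equiv.trans_apply, LinearEquiv.coe_toEquiv, Module.Basis.equivFun_symm_apply,
      Fin.sum_univ_two, h0, h1]
    simp [Algebra.smul_def, finTwoArrowEquiv, ← Algebra.TensorProduct.one_def]

end Quadratic

end SiegelSeries

/-! ### Existence of reduced fractions -/

namespace SiegelSeries

/-- A matrix over the field of fractions of a principal ideal domain is a reduced fraction. -/
theorem exists_reduced_fraction {R K : Type*} [CommRing R] [IsDomain R] [IsPrincipalIdealRing R]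
    [Field K] [Algebra R K] [IsFractionRing R K] {n : ℕ} (x : Matrix (Fin n) (Fin n) K) :
    ∃ c d u w : Matrix (Fin n) (Fin n) R, d.det ≠ 0 ∧
      d.map (algebraMap R K) * x = c.map (algebraMap R K) ∧ c * u + d * w = 1 := by
  have hinj : Function.Injective (algebraMap R K) := IsFractionRing.injective R K
  -- The kernel of $(c, d) \mapsto dx - c$ is the module of possible rows of $[c\ d]$.
  let f : ((Fin n → R) × (Fin n → R)) →ₗ[R] (Fin n → K) :=
    { toFun := fun z => (fun i => algebraMap R K (z.2 i)) ᵥ* x - fun i => algebraMap R K (z.1 i)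
      map_add' := fun z z' => by
        ext j
        simp [Matrix.vecMul, dotProduct, add_mul, Finset.sum_add_distrib]
        ring
      map_smul' := fun a z => by
        ext j
        simp [Matrix.vecMul, dotProduct, Algebra.smul_def, mul_sub, Finset.mul_sum, mul_assoc] }
  have hker : ∀ z, z ∈ LinearMap.ker f ↔
      (fun i => algebraMap R K (z.2 i)) ᵥ* x = fun i => algebraMap R K (z.1 i) := fun z =>
    sub_eq_zero
  -- the kernel is free of rank `n`
  have hrank : Module.finrank R (LinearMap.ker f) = n := by
    apply le_antisymm
    · have h := LinearMap.finrank_le_finrank_of_injective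
        (f := (LinearMap.snd R (Fin n → R) (Fin n → R)).comp (LinearMap.ker f).subtype) (by
          rw [← LinearMap.ker_eq_bot, LinearMap.ker_eq_bot']
          rintro ⟨⟨a, b⟩, hz⟩ (rfl : b = 0)
          have h1 := (hker _).1 hz
          refine Subtype.ext (Prod.ext (funext fun i => hinj ?_) rfl)
          have h2 := congrFun h1 i
          simpa [Matrix.vecMul, dotProduct] using h2.symm)
      rwa [Module.finrank_fin_fun] at h
    -- A common denominator $D$ of the entries embeds $R^n$ in the kernel by $e \mapsto (eDx, De)$.
    · obtain ⟨D, hD⟩ := IsLocalization.exist_integer_multiples_of_finite (nonZeroDivisors R)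
        (fun ij : Fin n × Fin n => x ij.1 ij.2)
      choose y hy using hD
      let g : (Fin n → R) →ₗ[R] (Fin n → R) × (Fin n → R) :=
        (Matrix.vecMulLinear (Matrix.of fun i j => y (i, j))).prod
          ((D : R) • (LinearMap.id : (Fin n → R) →ₗ[R] (Fin n → R)))
      have hg : ∀ e, g e ∈ LinearMap.ker f := by
        intro e
        rw [hker]
        ext j
        have h1 : (g e).1 j = ∑ i, e i * y (i, j) := rfl
        have h2 : ∀ i, (g e).2 i = D * e i := fun i => rfl
        rw [h1, map_sum, Matrix.vecMul, dotProduct]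
        refine Finset.sum_congr rfl fun i _ => ?_
        have h3 : algebraMap R K (y (i, j)) = algebraMap R K D * x i j := by
          rw [hy, Algebra.smul_def]
        rw [h2, map_mul, map_mul, h3]
        ring
      have h := LinearMap.finrank_le_finrank_of_injective
        (f := g.codRestrict (LinearMap.ker f) hg) (by
          rw [← LinearMap.ker_eq_bot, LinearMap.ker_eq_bot']
          intro e he
          have h1 := congrArg (fun z : LinearMap.ker f => z.1.2) he
          have h2 : (D : R) • e = 0 := h1
          exact (smul_eq_zero.1 h2).resolve_left (nonZeroDivisors.ne_zero D.2))
      rwa [Module.finrank_fin_fun] at h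
  let b : Module.Basis (Fin n) R (LinearMap.ker f) := Module.finBasisOfFinrankEq R _ hrank
  -- the kernel is a direct summand
  obtain ⟨r, hr⟩ : ∃ r : ((Fin n → R) × (Fin n → R)) →ₗ[R] LinearMap.ker f,
      ∀ z : LinearMap.ker f, r z = z := by
    -- The image of `f` is finitely generated and torsion-free over a principal ideal domain, hence
    -- free, so `f` splits onto its image.
    have htf : Module.IsTorsionFree R (Fin n → K) := inferInstance
    have : Module.Free R (LinearMap.range f) := inferInstance
    obtain ⟨g, hg⟩ := Module.projective_lifting_property f.rangeRestrict
      (LinearMap.id : LinearMap.range f →ₗ[R] LinearMap.range f) f.surjective_rangeRestrict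
    refine ⟨LinearMap.codRestrict (LinearMap.ker f)
      (LinearMap.id - g.comp f.rangeRestrict) fun z => ?_, fun z => Subtype.ext ?_⟩
    · have h1 := congrArg Subtype.val (LinearMap.congr_fun hg (f.rangeRestrict z))
      have h2 : f (g (f.rangeRestrict z)) = f z := h1
      rw [LinearMap.mem_ker, LinearMap.sub_apply, map_sub, LinearMap.id_apply,
        LinearMap.comp_apply, h2, sub_self]
    · have h1 : f.rangeRestrict z.1 = 0 := Subtype.ext z.2
      rw [LinearMap.codRestrict_apply, LinearMap.sub_apply, LinearMap.comp_apply, h1, map_zero,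
        sub_zero, LinearMap.id_apply]
  -- A basis of the kernel gives the rows of $[c\ d]$; the coordinates of the retraction `r` give
  -- its right inverse.
  let c : Matrix (Fin n) (Fin n) R := Matrix.of fun i => (b i).1.1
  let d : Matrix (Fin n) (Fin n) R := Matrix.of fun i => (b i).1.2
  let u : Matrix (Fin n) (Fin n) R := Matrix.of fun i j => b.repr (r (Pi.single i 1, 0)) j
  let w : Matrix (Fin n) (Fin n) R := Matrix.of fun i j => b.repr (r (0, Pi.single i 1)) j
  have hdx : d.map (algebraMap R K) * x = c.map (algebraMap R K) := by
    ext i j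
    exact congrFun ((hker _).1 (b i).2) j
  have huw : c * u + d * w = 1 := by
    ext k j
    have h1 : (b k).1 = (∑ i, c k i • ((Pi.single i 1, 0) : (Fin n → R) × (Fin n → R))) +
        ∑ i, d k i • ((0, Pi.single i 1) : (Fin n → R) × (Fin n → R)) := by
      refine Prod.ext ?_ ?_
      · ext l
        simp [c, Prod.fst_sum, Finset.sum_apply, Pi.single_apply]
      · ext l
        simp [d, Prod.snd_sum, Finset.sum_apply, Pi.single_apply]
    have h2 := congrArg (fun z => b.repr (r z) j) h1
    simp only [hr, map_add, map_sum, map_smul, Module.Basis.repr_self, Finsupp.add_apply,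
      Finsupp.finsetSum_apply, Finsupp.smul_apply, smul_eq_mul] at h2
    rw [Matrix.one_apply, Matrix.add_apply, Matrix.mul_apply, Matrix.mul_apply]
    rw [Finsupp.single_apply] at h2
    exact h2.symm
  refine ⟨c, d, u, w, fun hdet => ?_, hdx, huw⟩
  -- If $yd = 0$ then $yc = ydx = 0$, so $y = y(cu + dw) = 0$.
  obtain ⟨y, hy0, hy⟩ := Matrix.exists_vecMul_eq_zero_iff.2 hdet
  have hyc : y ᵥ* c = 0 := by
    have h0 : (algebraMap R K ∘ y) ᵥ* d.map (algebraMap R K) = 0 := by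
      ext i
      rw [← RingHom.map_vecMul, hy, Pi.zero_apply, map_zero, Pi.zero_apply]
    have h1 : (algebraMap R K ∘ y) ᵥ* c.map (algebraMap R K) = 0 := by
      rw [← hdx, ← Matrix.vecMul_vecMul, h0, Matrix.zero_vecMul]
    ext i
    apply hinj
    rw [RingHom.map_vecMul, h1, Pi.zero_apply, Pi.zero_apply, map_zero]
  refine hy0 ?_
  rw [← Matrix.vecMul_one y, ← huw, Matrix.vecMul_add, ← Matrix.vecMul_vecMul,
    ← Matrix.vecMul_vecMul, hy, hyc]
  simp

/-- $K_v$ may be a product of two fields, so the principal ideal domain is found globally: $\mathcal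
O_K$ localized at the complement of $v$ in $\mathcal O_F$. Modulo integral matrices $x$ comes from
$M_n(K)$, and the integral part is restored by `IsReducedFraction.add`. -/
theorem exists_isReducedFraction_localAlg {F K : Type*} [Field F] [NumberField F] [Field K]
    [NumberField K] [Algebra F K] (v : HeightOneSpectrum (𝓞 F))
    {ρ : LocalAlg F K v →+* LocalAlg F K v} {θ : K} {s P : v.adicCompletion F}
    (h : IsUnramifiedQuadratic (v.adicCompletionIntegers F) ρ ((1 : v.adicCompletion F) ⊗ₜ[F] θ) s P)
    {n : ℕ} (x : Matrix (Fin n) (Fin n) (LocalAlg F K v)) :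
    ∃ c d, IsReducedFraction (v.adicCompletionIntegers F) x c d := by
  let ι : K →ₐ[F] LocalAlg F K v := Algebra.TensorProduct.includeRight
  let M := Algebra.algebraMapSubmonoid (𝓞 K) v.asIdeal.primeCompl
  let R := Localization M
  have hM : M ≤ nonZeroDivisors (𝓞 K) := by
    rintro _ ⟨m, hm, rfl⟩
    refine mem_nonZeroDivisors_of_ne_zero fun h0 => hm ?_
    have : m = 0 := (map_eq_zero_iff _ (FaithfulSMul.algebraMap_injective (𝓞 F) (𝓞 K))).1 h0
    rw [this]
    exact zero_mem _
  have hdom : IsDomain R := IsLocalization.isDomain_localization hM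
  have hpid : IsPrincipalIdealRing R :=
    IsDedekindDomain.isPrincipalIdealRing_localization_over_prime (𝓞 K) v.asIdeal v.ne_bot
  let f : R →+* K := IsLocalization.lift (M := M) (g := algebraMap (𝓞 K) K) fun m =>
    (map_ne_zero_iff _ (RingOfIntegers.coe_injective)).2
      (nonZeroDivisors.ne_zero (hM m.2)) |>.isUnit
  let _ : Algebra R K := f.toAlgebra
  have hf : ∀ a : 𝓞 K, algebraMap R K (algebraMap (𝓞 K) R a) = algebraMap (𝓞 K) K a := fun a =>
    IsLocalization.lift_eq _ a
  have : IsScalarTower (𝓞 K) R K := IsScalarTower.of_algebraMap_eq fun a => (hf a).symm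
  have : IsFractionRing R K := IsFractionRing.isFractionRing_of_isDomain_of_isLocalization M R K
  -- The denominators come from $\mathcal O_F$ outside $v$ and become units of $\mathfrak g$.
  have hmem : ∀ a : R, ι (algebraMap R K a) ∈
      maxOrder (v.adicCompletionIntegers F) (LocalAlg F K v) := by
    intro a
    obtain ⟨⟨b, ⟨_, m, hm, rfl⟩⟩, hab⟩ := IsLocalization.surj M a
    have h1 := congrArg (algebraMap R K) hab
    rw [map_mul, hf, hf] at h1
    have hm0 : algebraMap (𝓞 F) F m ≠ 0 := by
      intro h0
      rw [map_eq_zero_iff _ RingOfIntegers.coe_injective] at h0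
      exact hm (h0 ▸ zero_mem _)
    have h2 : algebraMap R K a =
        algebraMap F K (algebraMap (𝓞 F) F m)⁻¹ * algebraMap (𝓞 K) K b := by
      have h3 : algebraMap F K (algebraMap (𝓞 F) F m) ≠ 0 := (map_ne_zero _).2 hm0
      rw [map_inv₀, ← h1]
      change _ = _ * (_ * algebraMap F K (algebraMap (𝓞 F) F m))
      field_simp
    rw [h2, map_mul]
    refine mul_mem ?_ ?_
    · have h3 := algebraMap_algebraMap_localAlg (K := K) v (algebraMap (𝓞 F) F m)⁻¹
      change 1 ⊗ₜ[F] _ ∈ _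
      rw [← h3]
      refine h.algebraMap_mem_maxOrder_iff.2
        ((algebraMap_mem_adicCompletionIntegers_iff F v _).2 ?_)
      rw [map_inv₀, (v.valuation_eq_one_iff_notMem (K := F)).2 hm, inv_one]
    · exact (RingOfIntegers.isIntegral_coe b).map_of_comp_eq
        (algebraMap ℤ (v.adicCompletionIntegers F)) (ι : K →+* LocalAlg F K v)
        (RingHom.ext_int _ _)
  obtain ⟨y, hy⟩ : ∃ y : Matrix (Fin n) (Fin n) K, ∀ i j, x i j - ι (y i j) ∈
      maxOrder (v.adicCompletionIntegers F) (LocalAlg F K v) := by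
    have : ∀ z : LocalAlg F K v, ∃ y : K, z - ι y ∈
        maxOrder (v.adicCompletionIntegers F) (LocalAlg F K v) := by
      intro z
      obtain ⟨a, b, rfl⟩ := h.exists_rep z
      obtain ⟨a', ha'⟩ := exists_sub_mem_adicCompletionIntegers F v a
      obtain ⟨b', hb'⟩ := exists_sub_mem_adicCompletionIntegers F v b
      refine ⟨algebraMap F K a' + algebraMap F K b' * θ, ?_⟩
      convert h.rep_mem_maxOrder_iff.2 ⟨ha', hb'⟩ using 1
      have h1 : ι (algebraMap F K a' + algebraMap F K b' * θ) =
          algebraMap _ (LocalAlg F K v) (algebraMap F (v.adicCompletion F) a') +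
          algebraMap _ (LocalAlg F K v) (algebraMap F (v.adicCompletion F) b') * 1 ⊗ₜ θ := by
        rw [algebraMap_algebraMap_localAlg, algebraMap_algebraMap_localAlg, map_add, map_mul]
        rfl
      rw [h1, map_sub, map_sub]
      ring
    choose y hy using fun i j => this (x i j)
    exact ⟨Matrix.of y, hy⟩
  obtain ⟨c, d, u, w, hd, hdy, huw⟩ := exists_reduced_fraction (R := R) y
  let κ : R →+* maxOrder (v.adicCompletionIntegers F) (LocalAlg F K v) :=
    RingHom.codRestrict ((ι : K →+* LocalAlg F K v).comp (algebraMap R K)) _ hmem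
  have hκ : ∀ e : Matrix (Fin n) (Fin n) R,
      (e.map κ).map (algebraMap (maxOrder (v.adicCompletionIntegers F) (LocalAlg F K v)) _) =
        (e.map (algebraMap R K)).map ι := fun e => rfl
  have hred : IsReducedFraction (v.adicCompletionIntegers F) (y.map ι) (c.map κ) (d.map κ) := by
    refine ⟨?_, ?_, u.map κ, w.map κ, ?_⟩
    · have h1 := ((map_ne_zero_iff _ (IsFractionRing.injective R K)).2 hd).isUnit.map ι
      rw [hκ]
      rwa [RingHom.map_det, AlgHom.map_det] at h1
    · rw [hκ, hκ, ← hdy, Matrix.map_mul]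
    · rw [← Matrix.map_mul, ← Matrix.map_mul, ← Matrix.map_add _ (map_add κ), huw,
        Matrix.map_one _ (map_zero κ) (map_one κ)]
  refine ⟨c.map κ + d.map κ * Matrix.of fun i j => ⟨_, hy i j⟩, d.map κ, ?_⟩
  convert hred.add (Matrix.of fun i j => ⟨_, hy i j⟩)
  ext i j
  exact (add_sub_cancel (ι (y i j)) (x i j)).symm

end SiegelSeries

namespace SiegelSeries

/-! ### Base change of the local algebras -/

section

variable {F K F' K' : Type*} [Field F] [Field K] [Field F'] [Field K'] [Algebra F K]
  [Algebra F' K'] [Algebra F F'] [Algebra K K'] [Algebra F K'] [IsScalarTower F F' K']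
  [IsScalarTower F K K']

/-- $\rho'(k)$ is a root of $T^2 - (k + \rho k)T + k\rho k$, so it is $k$ or $\rho k$. If it is $k$,
then $k \in F'$ has degree over $F$ dividing both 2 and the odd $[F' : F]$, so $k \in F$ and $\rho k
= k$. -/
theorem conj_algebraMap_eq [CharZero F] [Algebra.IsQuadraticExtension F K]
    [Algebra.IsQuadraticExtension F' K'] [FiniteDimensional F F'] {ρ : K ≃ₐ[F] K} (hρ : ρ ≠ 1)
    {ρ' : K' ≃ₐ[F'] K'} (hρ' : ρ' ≠ 1) (hodd : Odd (Module.finrank F F')) (k : K) :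
    ρ' (algebraMap K K' k) = algebraMap K K' (ρ k) := by
  obtain ⟨t, ht⟩ := fixed_mem_range hρ (x := k + ρ k) (by rw [map_add, conj_conj_eq, add_comm])
  obtain ⟨N, hN⟩ := fixed_mem_range hρ (x := k * ρ k) (by rw [map_mul, conj_conj_eq, mul_comm])
  have hfix : ∀ a : F, ρ' (algebraMap K K' (algebraMap F K a)) =
      algebraMap K K' (algebraMap F K a) := by
    intro a
    rw [← IsScalarTower.algebraMap_apply, IsScalarTower.algebraMap_apply F F' K', ρ'.commutes]
  have ht' := hfix t
  have hN' := hfix N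
  rw [ht] at ht'
  rw [hN] at hN'
  simp only [map_add, map_mul] at ht' hN'
  have hmul : (ρ' (algebraMap K K' k) - algebraMap K K' k) *
      (ρ' (algebraMap K K' k) - algebraMap K K' (ρ k)) = 0 := by
    linear_combination ρ' (algebraMap K K' k) * ht' - hN'
  rcases mul_eq_zero.1 hmul with h | h
  swap
  · exact sub_eq_zero.1 h
  obtain ⟨c, hc⟩ := fixed_mem_range hρ' (sub_eq_zero.1 h)
  have hmin : minpoly F c = minpoly F k := by
    rw [← minpoly.algebraMap_eq (algebraMap F' K').injective c, hc,
      minpoly.algebraMap_eq (algebraMap K K').injective k]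
  have h1 : (minpoly F k).natDegree ∣ Module.finrank F F' := by
    rw [← hmin]
    exact minpoly.degree_dvd (Algebra.IsIntegral.isIntegral c)
  have h2 : (minpoly F k).natDegree ∣ 2 := by
    rw [← Algebra.IsQuadraticExtension.finrank_eq_two F K]
    exact minpoly.degree_dvd (Algebra.IsIntegral.isIntegral k)
  have h3 : (minpoly F k).natDegree = 1 :=
    Nat.eq_one_of_dvd_coprimes hodd.coprime_two_right h1 h2
  obtain ⟨a, rfl⟩ := minpoly.natDegree_eq_one_iff.1 h3
  rw [ρ.commutes, hfix]

end

variable {F K F' K' : Type*} [Field F] [NumberField F] [Field K] [Field F'] [NumberField F']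
  [Field K'] [Algebra F K] [Algebra F' K'] [Algebra F F'] [Algebra K K'] [Algebra F K']
  [IsScalarTower F F' K'] [IsScalarTower F K K']

variable (F K F' K') in
/-- The homomorphism `K_v → K'_w` for a prime `w` of `F'` above the prime `v` of `F`. -/
noncomputable def localAlgMap (w : HeightOneSpectrum (𝓞 F')) :
    LocalAlg F K (w.under (𝓞 F)) →+* LocalAlg F' K' w :=
  tensorMap (algebraMap F F') (completionMap F F' w) (algebraMap K K') (completionMap_coe F F' w)
    (fun x => by
      rw [← IsScalarTower.algebraMap_apply F K K', ← IsScalarTower.algebraMap_apply F F' K'])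

theorem localAlgMap_tmul (w : HeightOneSpectrum (𝓞 F'))
    (a : (w.under (𝓞 F)).adicCompletion F) (k : K) :
    localAlgMap F K F' K' w (a ⊗ₜ k) = completionMap F F' w a ⊗ₜ algebraMap K K' k :=
  tensorMap_tmul _ _ _ _ _ a k

theorem localAlgMap_algebraMap (w : HeightOneSpectrum (𝓞 F'))
    (a : (w.under (𝓞 F)).adicCompletion F) :
    localAlgMap F K F' K' w (algebraMap _ _ a) = algebraMap _ _ (completionMap F F' w a) := by
  rw [Algebra.TensorProduct.algebraMap_apply, localAlgMap_tmul, map_one]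
  rfl

theorem component_finiteAdelesMap (w : HeightOneSpectrum (𝓞 F')) (x : FiniteAdeles F K) :
    component F' K' w (finiteAdelesMap F K F' K' x) =
      localAlgMap F K F' K' w (component F K (w.under (𝓞 F)) x) := by
  induction x using TensorProduct.induction_on with
  | zero => simp
  | add x y hx hy => rw [map_add, map_add, hx, hy, map_add, map_add]
  | tmul a k =>
    have h1 : finiteAdelesMap F K F' K' (a ⊗ₜ k) = finiteAdeleMap F F' a ⊗ₜ algebraMap K K' k :=
      tensorMap_tmul _ _ _ _ _ a k
    have h2 : component F K (w.under (𝓞 F)) (a ⊗ₜ k) = a (w.under (𝓞 F)) ⊗ₜ k :=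
      tensorMap_tmul _ _ _ _ _ a k
    rw [h1, h2, localAlgMap_tmul]
    exact tensorMap_tmul _ _ _ _ _ _ _

theorem localConj_localAlgMap {ρ : K ≃ₐ[F] K} {ρ' : K' ≃ₐ[F'] K'}
    (hρρ' : ∀ k, ρ' (algebraMap K K' k) = algebraMap K K' (ρ k)) (w : HeightOneSpectrum (𝓞 F'))
    (x : LocalAlg F K (w.under (𝓞 F))) :
    localConj F' ρ' w (localAlgMap F K F' K' w x) =
      localAlgMap F K F' K' w (localConj F ρ (w.under (𝓞 F)) x) := by
  induction x using TensorProduct.induction_on with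
  | zero => simp
  | add x y hx hy => rw [map_add, map_add, hx, hy, map_add, map_add]
  | tmul a k => rw [localAlgMap_tmul, localConj_tmul, localConj_tmul, localAlgMap_tmul, hρρ']

/-- Conjugation, adelic components and $\beta$ all commute with base change; only the ratio $u$ of
the generators of the differents remains. -/
theorem zeta_map {ρ : K ≃ₐ[F] K} {ρ' : K' ≃ₐ[F'] K'}
    (hρρ' : ∀ k, ρ' (algebraMap K K' k) = algebraMap K K' (ρ k))
    {ω : ∀ v : HeightOneSpectrum (𝓞 F), v.adicCompletionIntegers F}
    {ω' : ∀ w : HeightOneSpectrum (𝓞 F'), w.adicCompletionIntegers F'} {n : ℕ}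
    (β : Matrix (Fin n) (Fin n) K) (A : GL (Fin n) (FiniteAdeles F K))
    (w : HeightOneSpectrum (𝓞 F')) {u : w.adicCompletion F'}
    (hu : (ω' w : w.adicCompletion F') = u * completionMap F F' w (ω (w.under (𝓞 F)))) :
    zeta ρ' ω' (β.map (algebraMap K K'))
        (Matrix.GeneralLinearGroup.map (finiteAdelesMap F K F' K') A) w =
      u • (zeta ρ ω β A (w.under (𝓞 F))).map (localAlgMap F K F' K' w) := by
  have hA : (Matrix.GeneralLinearGroup.map (finiteAdelesMap F K F' K') A).1.map
      (component F' K' w) =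
        (A.1.map (component F K (w.under (𝓞 F)))).map (localAlgMap F K F' K' w) := by
    ext i j
    exact component_finiteAdelesMap w _
  have hadj : adjT (localConj F' ρ' w)
      ((A.1.map (component F K (w.under (𝓞 F)))).map (localAlgMap F K F' K' w)) =
        (adjT (localConj F ρ (w.under (𝓞 F))) (A.1.map (component F K (w.under (𝓞 F))))).map
          (localAlgMap F K F' K' w) := by
    ext i j
    exact localConj_localAlgMap hρρ' w _
  have hβ : (β.map (algebraMap K K')).map
      (Algebra.TensorProduct.includeRight : K' →ₐ[F'] LocalAlg F' K' w) =
        (β.map (Algebra.TensorProduct.includeRight : K →ₐ[F] LocalAlg F K (w.under (𝓞 F)))).map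
          (localAlgMap F K F' K' w) := by
    ext i j
    exact ((localAlgMap_tmul w _ _).trans (by rw [map_one]; rfl)).symm
  rw [zeta, zeta, hA, hadj, hβ, hu, mul_smul, ← Matrix.map_mul, ← Matrix.map_mul]
  congr 1
  ext i j
  rw [Matrix.smul_apply, Matrix.map_apply, Matrix.map_apply, Matrix.smul_apply, Algebra.smul_def,
    Algebra.smul_def, map_mul, localAlgMap_algebraMap]

/-- By transitivity $\mathfrak d(F'/\mathbb Q) = \mathfrak d(F'/F)\,\mathfrak d(F/\mathbb Q)$, and
the relative different is trivial at the unramified prime $w$. -/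
theorem exists_unit_different {ω : ∀ v : HeightOneSpectrum (𝓞 F), v.adicCompletionIntegers F}
    (hω : IsDifferentFamily ω) {ω' : ∀ w : HeightOneSpectrum (𝓞 F'), w.adicCompletionIntegers F'}
    (hω' : IsDifferentFamily ω') (w : HeightOneSpectrum (𝓞 F'))
    (hunr : Algebra.IsUnramifiedAt (𝓞 F) w.asIdeal) :
    ∃ u : (w.adicCompletionIntegers F')ˣ, (ω' w : w.adicCompletion F') =
      ((u : w.adicCompletionIntegers F') : w.adicCompletion F') *
        completionMap F F' w (ω (w.under (𝓞 F))) := by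
  let κ : (w.under (𝓞 F)).adicCompletionIntegers F →+* w.adicCompletionIntegers F' :=
    (completionMap F F' w).restrict _ _ (completionMap_mapsTo F F' w)
  have hκ : (algebraMap (𝓞 F') (w.adicCompletionIntegers F')).comp (algebraMap (𝓞 F) (𝓞 F')) =
      κ.comp (algebraMap (𝓞 F) ((w.under (𝓞 F)).adicCompletionIntegers F)) := by
    refine RingHom.ext fun x => Subtype.ext ?_
    exact (completionMap_coe F F' w (algebraMap (𝓞 F) F x)).symm
  have htop : (differentIdeal (𝓞 F) (𝓞 F')).map
      (algebraMap (𝓞 F') (w.adicCompletionIntegers F')) = ⊤ := by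
    have h1 := not_dvd_differentIdeal_iff.2 hunr
    rw [Ideal.dvd_iff_le, SetLike.not_le_iff_exists] at h1
    obtain ⟨x, hx, hxw⟩ := h1
    refine Ideal.eq_top_of_isUnit_mem _ (Ideal.mem_map_of_mem _ hx) ?_
    rw [HeightOneSpectrum.adicCompletionIntegers.isUnit_iff_valued_eq_one]
    have h2 : Valued.v (algebraMap F' (w.adicCompletion F') (algebraMap (𝓞 F') F' x)) =
        w.valuation F' (algebraMap (𝓞 F') F' x) :=
      HeightOneSpectrum.valuedAdicCompletion_eq_valuation' w _
    exact h2.trans ((w.valuation_eq_one_iff_notMem (K := F')).2 hxw)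
  have hspan : Ideal.span {κ (ω (w.under (𝓞 F)))} = Ideal.span {ω' w} := by
    rw [← hω' w, differentIdeal_eq_differentIdeal_mul_differentIdeal ℤ (𝓞 F) (𝓞 F'),
      Ideal.map_mul, htop, Ideal.top_mul, Ideal.map_map, hκ, ← Ideal.map_map, hω,
      Ideal.map_span, Set.image_singleton]
  obtain ⟨u, hu⟩ := Ideal.span_singleton_eq_span_singleton.1 hspan
  refine ⟨u, ?_⟩
  rw [← hu, mul_comm]
  rfl

end SiegelSeries

/-! ### From the local congruence to the coefficients at powers of a prime -/

namespace SiegelSeries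

section

variable {F K F' K' : Type*} [Field F] [NumberField F] [Field K] [NumberField K] [Field F']
  [NumberField F'] [Field K'] [NumberField K'] [Algebra F K] [Algebra F' K'] [Algebra F F']
  [Algebra K K'] [Algebra F K'] [IsScalarTower F F' K'] [IsScalarTower F K K']
  [Algebra.IsQuadraticExtension F K] [Algebra.IsQuadraticExtension F' K'] [IsGalois F F']

theorem exists_int_coeff_siegelG {p : ℕ} (hp : p.Prime) (hp2 : p ≠ 2)
    (hdeg : Module.finrank F F' = p) {ρ : K ≃ₐ[F] K} (hρ : ρ ≠ 1) {ρ' : K' ≃ₐ[F'] K'}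
    (hρ' : ρ' ≠ 1) {χ : ∀ v : HeightOneSpectrum (𝓞 F), AddChar (v.adicCompletion F) Circle}
    (hχ : IsCharFamily χ)
    {χ' : ∀ w : HeightOneSpectrum (𝓞 F'), AddChar (w.adicCompletion F') Circle}
    (hχ' : IsCharFamily χ') {ω : ∀ v : HeightOneSpectrum (𝓞 F), v.adicCompletionIntegers F}
    (hω : IsDifferentFamily ω) {ω' : ∀ w : HeightOneSpectrum (𝓞 F'), w.adicCompletionIntegers F'}
    (hω' : IsDifferentFamily ω') {n : ℕ} (β : Matrix (Fin n) (Fin n) K)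
    (A : GL (Fin n) (FiniteAdeles F K)) (w : HeightOneSpectrum (𝓞 F'))
    (hpw : (p : 𝓞 F') ∉ w.asIdeal) (hw : Algebra.IsUnramifiedAt (𝓞 F) w.asIdeal)
    (hK : ∀ w' : HeightOneSpectrum (𝓞 K), w'.under (𝓞 F) = w.under (𝓞 F) →
      Algebra.IsUnramifiedAt (𝓞 F) w'.asIdeal) (j : ℕ) :
    ∃ a a' : ℤ, PowerSeries.coeff j (siegelG ρ χ ω β A (w.under (𝓞 F))) = a ∧
      PowerSeries.coeff j (siegelG ρ' χ' ω' (β.map (algebraMap K K'))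
        (Matrix.GeneralLinearGroup.map (finiteAdelesMap F K F' K') A) w) = a' ∧
      a ≡ a' [ZMOD p] := by
  have := Fact.mk hp
  have hodd : Odd p := hp.odd_of_ne_two hp2
  have hρρ' := conj_algebraMap_eq (F := F) (K := K) (F' := F') (K' := K') hρ hρ' (hdeg ▸ hodd)
  obtain ⟨θ, s, P, hs, hP, hd⟩ := exists_unit_discriminant hρ (w.under (𝓞 F)) hK
  have he := ramificationIdx_under_eq_one F F' w hw
  have hval : ∀ x : F, w.valuation F' (algebraMap F F' x) = (w.under (𝓞 F)).valuation F x := by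
    intro x
    rw [← HeightOneSpectrum.valuation_liesOver F' (w.under (𝓞 F)) w, he, pow_one]
  have hsv := (w.under (𝓞 F)).valuation_le_one (K := F) s
  have hPv := (w.under (𝓞 F)).valuation_le_one (K := F) P
  have hdv : (w.under (𝓞 F)).valuation F
      (algebraMap (𝓞 F) F s ^ 2 - 4 * algebraMap (𝓞 F) F P) = 1 := by
    rw [← (w.under (𝓞 F)).valuation_eq_one_iff_notMem (K := F)] at hd
    simpa only [map_sub, map_mul, map_pow, map_ofNat] using hd
  have h := isUnramifiedQuadratic_localAlg (w.under (𝓞 F)) hs hP hsv hPv hdv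
  have hcomp : ∀ a : F, algebraMap F' K' (algebraMap F F' a) =
      algebraMap K K' (algebraMap F K a) := fun a => by
    rw [← IsScalarTower.algebraMap_apply, ← IsScalarTower.algebraMap_apply]
  -- The image of $\theta$ serves over $F'_w$: its trace and norm are the images of $s$ and $P$, and
  -- valuations are unchanged since $e = 1$.
  have h' := isUnramifiedQuadratic_localAlg (ρ := ρ') w (θ := algebraMap K K' θ)
    (s := algebraMap F F' (algebraMap (𝓞 F) F s)) (P := algebraMap F F' (algebraMap (𝓞 F) F P))
    (by rw [hcomp, hs, hρρ', map_add]) (by rw [hcomp, hP, hρρ', map_mul])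
    ((hval _).trans_le hsv) ((hval _).trans_le hPv) (by
      rw [← hdv, ← hval]
      simp only [map_sub, map_mul, map_pow, map_ofNat])
  have hθ : localAlgMap F K F' K' w (1 ⊗ₜ θ) = 1 ⊗ₜ algebraMap K K' θ := by
    rw [localAlgMap_tmul, map_one]
  rw [← hθ, ← completionMap_coe, ← completionMap_coe] at h'
  obtain ⟨u, hu⟩ := exists_unit_different (F := F) hω hω' w hw
  obtain ⟨γ, ϖ, ϖ', B⟩ := exists_isCyclicBaseChange F F' hp hdeg w hpw hw
  have key := B.exists_int_coeff_seriesG hodd h h' (localAlgMap_algebraMap w)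
    (exists_isReducedFraction_localAlg (w.under (𝓞 F)) h) (hχ _) (hχ' w)
    (zeta ρ ω β A (w.under (𝓞 F))) u j
  rw [siegelG, siegelG, zeta_map hρρ' β A w hu]
  exact key

end

theorem siegelCoeff_one {F K : Type*} [Field F] [NumberField F] [Field K] [Algebra F K]
    (ρ : K ≃ₐ[F] K) (χ : ∀ v : HeightOneSpectrum (𝓞 F), AddChar (v.adicCompletion F) Circle)
    (ω : ∀ v : HeightOneSpectrum (𝓞 F), v.adicCompletionIntegers F) {n : ℕ}
    (β : Matrix (Fin n) (Fin n) K) (A : GL (Fin n) (FiniteAdeles F K)) :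
    siegelCoeff ρ χ ω β A 1 = 1 := by
  refine finprod_eq_one_of_forall_eq_one fun v => ?_
  have : IsEmpty (v.asIdeal ∣ 1) := ⟨fun h =>
    v.isPrime.ne_top (Ideal.isUnit_iff.1 (isUnit_of_dvd_one h))⟩
  exact finprod_of_isEmpty _

theorem siegelCoeff_prime_pow {F K : Type*} [Field F] [NumberField F] [Field K] [Algebra F K]
    (ρ : K ≃ₐ[F] K) (χ : ∀ v : HeightOneSpectrum (𝓞 F), AddChar (v.adicCompletion F) Circle)
    (ω : ∀ v : HeightOneSpectrum (𝓞 F), v.adicCompletionIntegers F) {n : ℕ}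
    (β : Matrix (Fin n) (Fin n) K) (A : GL (Fin n) (FiniteAdeles F K))
    (v : HeightOneSpectrum (𝓞 F)) {j : ℕ} (hj : j ≠ 0) :
    siegelCoeff ρ χ ω β A (v.asIdeal ^ j) = PowerSeries.coeff j (siegelG ρ χ ω β A v) := by
  have hset : ∀ v' : HeightOneSpectrum (𝓞 F), v'.asIdeal ∣ v.asIdeal ^ j ↔ v' ∈ ({v} : Set _) := by
    intro v'
    rw [Set.mem_singleton_iff]
    refine ⟨fun h => ?_, fun h => h ▸ dvd_pow_self _ hj⟩
    have h1 := v'.prime.dvd_of_dvd_pow h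
    rw [Prime.dvd_prime_iff_associated v'.prime v.prime, associated_iff_eq] at h1
    exact HeightOneSpectrum.ext h1
  rw [siegelCoeff]
  simp only [hset]
  rw [finprod_mem_singleton, multiplicity_pow_self_of_prime v.prime]

/-- As $v$ is unramified in $F'$, each prime above it divides $v\mathcal O_{F'}$ exactly once, so
all local factors are taken at the same exponent $j$. -/
theorem siegelCoeff_map_pow {F F' K' : Type*} [Field F] [NumberField F] [Field F'] [NumberField F']
    [Algebra F F'] [Field K'] [Algebra F' K'] (ρ' : K' ≃ₐ[F'] K')
    (χ' : ∀ w : HeightOneSpectrum (𝓞 F'), AddChar (w.adicCompletion F') Circle)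
    (ω' : ∀ w : HeightOneSpectrum (𝓞 F'), w.adicCompletionIntegers F') {n : ℕ}
    (β : Matrix (Fin n) (Fin n) K') (A : GL (Fin n) (FiniteAdeles F' K'))
    (v : HeightOneSpectrum (𝓞 F))
    (hunr : ∀ w : HeightOneSpectrum (𝓞 F'), w.under (𝓞 F) = v →
      Algebra.IsUnramifiedAt (𝓞 F) w.asIdeal) {j : ℕ} (hj : j ≠ 0) :
    siegelCoeff ρ' χ' ω' β A (v.asIdeal.map (algebraMap (𝓞 F) (𝓞 F')) ^ j) =
      ∏ᶠ w ∈ {w : HeightOneSpectrum (𝓞 F') | w.under (𝓞 F) = v},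
        PowerSeries.coeff j (siegelG ρ' χ' ω' β A w) := by
  have hset : ∀ w : HeightOneSpectrum (𝓞 F'),
      w.asIdeal ∣ v.asIdeal.map (algebraMap (𝓞 F) (𝓞 F')) ^ j ↔
        w ∈ {w : HeightOneSpectrum (𝓞 F') | w.under (𝓞 F) = v} := by
    intro w
    rw [Set.mem_ofPred_eq]
    have h1 : w.asIdeal ∣ v.asIdeal.map (algebraMap (𝓞 F) (𝓞 F')) ↔ w.under (𝓞 F) = v := by
      rw [Ideal.dvd_iff_le, Ideal.map_le_iff_le_comap]
      refine ⟨fun h => HeightOneSpectrum.ext ?_, fun h => h ▸ le_rfl⟩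
      exact (v.isMaximal.eq_of_le (w.under (𝓞 F)).isPrime.ne_top h).symm
    rw [← h1]
    exact ⟨fun h => w.prime.dvd_of_dvd_pow h, fun h => dvd_pow h hj⟩
  rw [siegelCoeff]
  simp only [hset]
  refine finprod_mem_congr rfl fun w hw => ?_
  obtain rfl : w.under (𝓞 F) = v := hw
  have h0 : (w.under (𝓞 F)).asIdeal.map (algebraMap (𝓞 F) (𝓞 F')) ≠ ⊥ :=
    Ideal.map_ne_bot_of_ne_bot (w.under (𝓞 F)).ne_bot
  have hm : multiplicity w.asIdeal ((w.under (𝓞 F)).asIdeal.map (algebraMap (𝓞 F) (𝓞 F'))) = 1 := by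
    have := hunr w rfl
    rw [← Ideal.IsDedekindDomain.ramificationIdx_eq_multiplicity _ _ h0]
    exact Ideal.ramificationIdx_eq_one _ _
  have hfin : FiniteMultiplicity w.asIdeal
      ((w.under (𝓞 F)).asIdeal.map (algebraMap (𝓞 F) (𝓞 F'))) :=
    FiniteMultiplicity.of_prime_left w.prime h0
  rw [hfin.multiplicity_pow w.prime, hm, mul_one]

/-- This is $r \cdot e \cdot f = [F' : F]$ for a Galois extension, with $r$ the number of primes
above $v$. -/
theorem ncard_under_eq_dvd {F F' : Type*} [Field F] [NumberField F] [Field F'] [NumberField F']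
    [Algebra F F'] [IsGalois F F'] (v : HeightOneSpectrum (𝓞 F)) :
    {w : HeightOneSpectrum (𝓞 F') | w.under (𝓞 F) = v}.ncard ∣ Module.finrank F F' := by
  have h1 : (HeightOneSpectrum.asIdeal '' {w : HeightOneSpectrum (𝓞 F') | w.under (𝓞 F) = v}) =
      v.asIdeal.primesOver (𝓞 F') := by
    ext Q
    constructor
    · rintro ⟨w, rfl, rfl⟩
      exact ⟨w.isPrime, ⟨rfl⟩⟩
    · rintro ⟨hQ, hQl⟩
      exact ⟨⟨Q, hQ, Ideal.ne_bot_of_liesOver_of_ne_bot v.ne_bot Q⟩,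
        HeightOneSpectrum.ext hQl.over.symm, rfl⟩
  rw [← Set.ncard_image_of_injective _ HeightOneSpectrum.asIdeal_injective, h1,
    ← IsGalois.card_aut_eq_finrank,
    ← Ideal.ncard_primesOver_mul_ramificationIdxIn_mul_inertiaDegIn v.asIdeal (𝓞 F') Gal(F'/F)]
  exact dvd_mul_right _ _

end SiegelSeries
open SiegelSeries in
theorem mainTheorem11
    (p : ℕ) (hp : p.Prime) (hp2 : p ≠ 2)
    (F K F' K' : Type*) [Field F] [NumberField F] [Field K] [NumberField K]
    [Field F'] [NumberField F'] [Field K'] [NumberField K']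
    [Algebra F K] [Algebra F F'] [Algebra F' K'] [Algebra K K'] [Algebra F K']
    [IsScalarTower F F' K'] [IsScalarTower F K K']
    -- `F` and `F'` are totally real, `K` is a CM field with maximal totally real subfield `F`
    [IsTotallyReal F] [IsTotallyReal F'] [IsTotallyComplex K]
    [Algebra.IsQuadraticExtension F K]
    -- `K' = F' K`, which is equivalent to `[K' : F'] = 2` as `F'` is totally real and `K` is not
    [Algebra.IsQuadraticExtension F' K']
    -- `F'/F` is Galois of degree `p` and unramified outside `p`
    [IsGalois F F'] (hdeg : Module.finrank F F' = p)
    (hunram : ∀ w : HeightOneSpectrum (𝓞 F'), (p : 𝓞 F') ∉ w.asIdeal →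
      Algebra.IsUnramifiedAt (𝓞 F) w.asIdeal)
    -- the nontrivial automorphisms of `K/F` and `K'/F'`
    (ρ : K ≃ₐ[F] K) (hρ : ρ ≠ 1) (ρ' : K' ≃ₐ[F'] K') (hρ' : ρ' ≠ 1)
    -- a finite set of primes of `F` that contains those above `p` and those ramified in `K`
    (S : Finset (HeightOneSpectrum (𝓞 F)))
    (hSp : ∀ v : HeightOneSpectrum (𝓞 F), (p : 𝓞 F) ∈ v.asIdeal → v ∈ S)
    (hSK : ∀ w : HeightOneSpectrum (𝓞 K), ¬ Algebra.IsUnramifiedAt (𝓞 F) w.asIdeal →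
      w.under (𝓞 F) ∈ S)
    -- the local additive characters and generators of the local differents over `F` and `F'`
    (χ : ∀ v : HeightOneSpectrum (𝓞 F), AddChar (v.adicCompletion F) Circle)
    (hχ : IsCharFamily χ)
    (χ' : ∀ w : HeightOneSpectrum (𝓞 F'), AddChar (w.adicCompletion F') Circle)
    (hχ' : IsCharFamily χ')
    (ω : ∀ v : HeightOneSpectrum (𝓞 F), v.adicCompletionIntegers F)
    (hω : IsDifferentFamily ω)
    (ω' : ∀ w : HeightOneSpectrum (𝓞 F'), w.adicCompletionIntegers F')
    (hω' : IsDifferentFamily ω')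
    (n : ℕ) (β : Matrix (Fin n) (Fin n) K) (hβ : IsPosDefHermitian ρ β)
    (A : GL (Fin n) (Adeles F K))
    (𝔮 : HeightOneSpectrum (𝓞 F)) (h𝔮 : 𝔮 ∉ S) (j : ℕ) :
    ∃ a a' : ℤ,
      siegelCoeff ρ χ ω β (Matrix.GeneralLinearGroup.map (finitePart F K) A)
        (𝔮.asIdeal ^ j) = a ∧
      siegelCoeff ρ' χ' ω' (β.map (algebraMap K K'))
        (Matrix.GeneralLinearGroup.map ((finiteAdelesMap F K F' K').comp (finitePart F K)) A)
        ((𝔮.asIdeal.map (algebraMap (𝓞 F) (𝓞 F'))) ^ j) = a' ∧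
      a ≡ a' [ZMOD p] := by
  have hmem : ∀ w : HeightOneSpectrum (𝓞 F'), w.under (𝓞 F) = 𝔮 → (p : 𝓞 F') ∉ w.asIdeal := by
    rintro w rfl hpw
    refine h𝔮 (hSp _ ?_)
    change algebraMap (𝓞 F) (𝓞 F') p ∈ w.asIdeal
    rwa [map_natCast]
  have hK : ∀ w : HeightOneSpectrum (𝓞 K), w.under (𝓞 F) = 𝔮 →
      Algebra.IsUnramifiedAt (𝓞 F) w.asIdeal := by
    intro w hw
    by_contra hram
    exact h𝔮 (hw ▸ hSK w hram)
  have hA : Matrix.GeneralLinearGroup.map ((finiteAdelesMap F K F' K').comp (finitePart F K)) A =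
      Matrix.GeneralLinearGroup.map (finiteAdelesMap F K F' K')
        (Matrix.GeneralLinearGroup.map (finitePart F K) A) := rfl
  rw [hA]
  generalize Matrix.GeneralLinearGroup.map (finitePart F K) A = B
  -- For $j = 0$ no prime divides the unit ideal and both products are empty.
  rcases eq_or_ne j 0 with rfl | hj
  · refine ⟨1, 1, ?_, ?_, rfl⟩
    · rw [pow_zero, siegelCoeff_one, Int.cast_one]
    · rw [pow_zero, siegelCoeff_one, Int.cast_one]
  have key : ∀ w : HeightOneSpectrum (𝓞 F'), w.under (𝓞 F) = 𝔮 →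
      ∃ a a' : ℤ, PowerSeries.coeff j (siegelG ρ χ ω β B 𝔮) = a ∧
        PowerSeries.coeff j (siegelG ρ' χ' ω' (β.map (algebraMap K K'))
          (Matrix.GeneralLinearGroup.map (finiteAdelesMap F K F' K') B) w) = a' ∧
        a ≡ a' [ZMOD p] := by
    rintro w rfl
    have hpw := hmem w rfl
    exact exists_int_coeff_siegelG hp hp2 hdeg hρ hρ' hχ hχ' hω hω' β B w hpw (hunram w hpw) hK j
  have hdvd := ncard_under_eq_dvd (F' := F') 𝔮
  rw [hdeg] at hdvd
  have hfin : {w : HeightOneSpectrum (𝓞 F') | w.under (𝓞 F) = 𝔮}.Finite :=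
    Set.finite_of_ncard_ne_zero (ne_zero_of_dvd_ne_zero hp.ne_zero hdvd)
  have hne : {w : HeightOneSpectrum (𝓞 F') | w.under (𝓞 F) = 𝔮}.Nonempty :=
    Set.nonempty_of_ncard_ne_zero (ne_zero_of_dvd_ne_zero hp.ne_zero hdvd)
  obtain ⟨w₀, hw₀⟩ := hne
  obtain ⟨a, -, ha, -, -⟩ := key w₀ hw₀
  have key' : ∀ w : HeightOneSpectrum (𝓞 F'), ∃ a' : ℤ, w.under (𝓞 F) = 𝔮 →
      PowerSeries.coeff j (siegelG ρ' χ' ω' (β.map (algebraMap K K'))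
        (Matrix.GeneralLinearGroup.map (finiteAdelesMap F K F' K') B) w) = a' ∧
        a ≡ a' [ZMOD p] := by
    intro w
    by_cases hw : w.under (𝓞 F) = 𝔮
    · obtain ⟨b, a', hb, ha', hmod⟩ := key w hw
      -- The integer over $F$ does not depend on $w$, because it equals the same complex coefficient
      -- for every $w$.
      obtain rfl : a = b := Int.cast_injective (α := ℂ) (ha.symm.trans hb)
      exact ⟨a', fun _ => ⟨ha', hmod⟩⟩
    · exact ⟨0, fun h => absurd h hw⟩
  choose a' ha' using key'
  refine ⟨a, ∏ w ∈ hfin.toFinset, a' w, ?_, ?_, ?_⟩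
  · rw [siegelCoeff_prime_pow _ _ _ _ _ _ hj, ha]
  · rw [siegelCoeff_map_pow _ _ _ _ _ _ (fun w hw => hunram w (hmem w hw)) hj,
      finprod_mem_eq_finite_toFinset_prod _ hfin, Int.cast_prod]
    exact Finset.prod_congr rfl fun w hw => (ha' w (hfin.mem_toFinset.1 hw)).1
  · have h1 : (∏ _w ∈ hfin.toFinset, a) ≡ ∏ w ∈ hfin.toFinset, a' w [ZMOD p] :=
      Int.ModEq.prod fun w hw => (ha' w (hfin.mem_toFinset.1 hw)).2
    refine Int.ModEq.trans ?_ h1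
    rw [Finset.prod_const, ← Set.ncard_eq_toFinset_card _ hfin]
    -- One prime above $\mathfrak q$ (inert), or $p$ of them (split); in the split case Fermat gives
    -- $a^p \equiv a$.
    rcases (Nat.dvd_prime hp).1 hdvd with h | h
    · rw [h, pow_one]
    · have := Fact.mk hp
      rw [h, ← ZMod.intCast_eq_intCast_iff, Int.cast_pow, ZMod.pow_card]
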